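/- Let $\alpha\in(0,1)$, $\beta\ge 0$, $q\in L_1(0,1)$, and consider the eigenvalue problem $$u''(x)-[\beta\delta(x-\alpha)+q(x)]u(x)+\lambda u(x)=0,\quad x\in(0,1),\qquad u(0)=u(1)=0,\quad u'(0)=1,$$ i.e. $u$ is continuous on $[0,1]$, $u'$ is absolutely continuous on each of the pieces $[0,\alpha]$, $[\alpha,1]$ (with one-sided values at $\alpha$), $u''-qu+\lambda u=0$ a.e., and $u'(\alpha+0)-u'(\alpha-0)=\beta u(\alpha)$. Its eigenvalues are numbered increasingly by $n=1,2,\dots$. Fix $n\ge1$. **FD-method.** Let $\lambda^{(0)}$ be the root of $\sqrt{\lambda}\sin\sqrt{\lambda}=-\beta\sin(\sqrt{\lambda}\,\alpha)\sin(\sqrt{\lambda}(1-\alpha))$ in $[\pi^2n^2,\pi^2(n+1)^2)$ and put $y=\sqrt{\lambda^{(0)}}$. Let $u^{(0)}(x)=\sin(yx)/y$ for $x\in[0,\alpha]$ and $u^{(0)}(x)=c^{(0)}\sin(y(1-x))$ for $x\in(\alpha,1]$, where $c^{(0)}=\frac{\sin(y\alpha)}{y\sin(y(1-\alpha))}$ if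 $\sin(y(1-\alpha))\ne0$ and $c^{(0)}=-\cos(y)/y$ otherwise. Put $M=\lambda^{(0)}\int_0^1(u^{(0)})^2$. For $j\ge1$ define successively $$\lambda^{(j)}=\frac{\lambda^{(0)}}{M}\Bigl(-\sum_{p=1}^{j-1}\lambda^{(j-p)}\int_0^1u^{(0)}u^{(p)}+\int_0^1q\,u^{(j-1)}u^{(0)}\Bigr),\qquad F^{(j)}=-\sum_{p=0}^{j-1}\lambda^{(j-p)}u^{(p)}+q\,u^{(j-1)},$$ $$u^{(j)}(x)=\int_0^x\frac{\sin(y(x-\xi))}{y}F^{(j)}(\xi)\,d\xi\quad(0\le x\le\alpha),$$ $$u^{(j)}(x)=c^{(j)}\sin(y(1-x))-\int_x^1\frac{\sin(y(x-\xi))}{y}F^{(j)}(\xi)\,d\xi\quad(\alpha\le x\le1),$$ where the number $c^{(j)}$ satisfies both $$c^{(j)}\sin(y(1-\alpha))=\int_0^1\frac{\sin(y(\alpha-\xi))}{y}F^{(j)}(\xi)\,d\xi,$$ $$c^{(j)}\cos(y(1-\alpha))=-\int_0^1\frac{\cos(y(\alpha-\xi))}{y}F^{(j)}(\xi)\,d\xi-\beta\int_0^\alpha\frac{\sin(y(\alpha-\xi))}{y^2}F^{(j)}(\xi)\,d\xi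 .$$ The approximation of rank $m$ is $\overset{m}{\lambda}=\sum_{j=0}^m\lambda^{(j)}$, $\overset{m}{u}=\sum_{j=0}^mu^{(j)}$. **Constants.** Let $\|f\|_\infty=\max_{[0,1]}|f|$, $\|q\|=\int_0^1|q|$, $\tilde c=\sin^2(y\alpha)+\bigl(\cos(y\alpha)+\tfrac{\beta}{y}\sin(y\alpha)\bigr)^2$, $\bar v_0=\max\{1,\,y/M,\,y\sqrt{\tilde c}/M\}\,\|u^{(0)}\|_\infty$, $$\frac1R=(1+\bar v_0)\|q\|\bigl(1+2\bar v_0+2\sqrt{\bar v_0(1+\bar v_0)}\bigr),\qquad r_n=\frac{1+\sqrt{1+(1+\beta/y)^2}}{y\,R},$$ $$\alpha_j=\frac{(2j-3)!!}{2\,(2j)!!}\ \ (j\ge1,\ (-1)!!=1),\qquad C_{n,m}=\frac{\alpha_{m+1}M}{1-r_n}.$$ **Theorem.** Suppose $r_n<1$. Then the FD-method is well defined (such $\lambda^{(j)},c^{(j)},u^{(j)}$ exist), all $u^{(j)}$ are continuous on $[0,1]$, the orthogonality conditions $\int_0^1F^{(j)}u^{(0)}=0$ ($j\ge1$) hold,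 and $(\overset{m}{\lambda},\overset{m}{u})$ converges, uniformly on $[0,1]$ in the second component, to the exact $n$-th eigenpair $(\lambda_n,u_n)$ of the problem. For all $m\ge0$ $$\|u_n-\overset{m}{u}\|_\infty\le\sum_{j=m+1}^\infty\|u^{(j)}\|_\infty\le C_{n,m}\min\Bigl\{\frac1M,\frac1y,\frac1{y\sqrt{\tilde c}}\Bigr\}\,r_n^{m+1},$$ $$|\lambda_n-\overset{m}{\lambda}|\le\sum_{j=m+1}^\infty|\lambda^{(j)}|\le\frac{C_{n,m}}{\bigl(M+\max\{1,\tilde c,\sqrt{\tilde c}\,M/y\}\bigr)R}\,r_n^m .$$ In particular the convergence is superexponential in the sense that $\|u_n-\overset{m}{u}\|_\infty=o(r_n^{m+1})$ and $|\lambda_n-\overset{m}{\lambda}|=o(r_n^m)$ as $m\to\infty$. -/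

import Mathlib

open MeasureTheory Set Filter Topology

noncomputable section

namespace FD

/-- The maximum norm `max_{x ∈ [0,1]} |f x|` (of a function continuous on `[0,1]`). -/
def supNorm (f : ℝ → ℝ) : ℝ := sSup ((fun x => |f x|) '' Icc 0 1)

/-! ### The exact problem -/

/-- `u` (restricted to `[0,1]`) solves
`u'' - [β δ(x - α) + q] u + lam u = 0`, `u(0) = u(1) = 0`, `u'(0) = 1`, in the Carathéodory sense:
`u` is continuous, `u'` exists on each of the two pieces `[0,α]`, `[α,1]` (one-sided at the ends),
it is absolutely continuous there (`du₁`, resp. `du₂`), the equation `u'' - q u + lam u = 0` holds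
a.e., and `u'(α+0) - u'(α-0) = β u(α)`. -/
def IsSolution (α β : ℝ) (q : ℝ → ℝ) (lam : ℝ) (u : ℝ → ℝ) : Prop :=
  u 0 = 0 ∧ u 1 = 0 ∧
  ∃ du₁ du₂ : ℝ → ℝ,
    AbsolutelyContinuousOnInterval du₁ 0 α ∧
    AbsolutelyContinuousOnInterval du₂ α 1 ∧
    (∀ x ∈ Icc 0 α, HasDerivWithinAt u (du₁ x) (Icc 0 α) x) ∧
    (∀ x ∈ Icc α 1, HasDerivWithinAt u (du₂ x) (Icc α 1) x) ∧
    (∀ᵐ x, x ∈ Ioo 0 α → ∃ d : ℝ, HasDerivAt du₁ d x ∧ d - q x * u x + lam * u x = 0) ∧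
    (∀ᵐ x, x ∈ Ioo α 1 → ∃ d : ℝ, HasDerivAt du₂ d x ∧ d - q x * u x + lam * u x = 0) ∧
    du₁ 0 = 1 ∧
    du₂ α - du₁ α = β * u α

/-- Eigenvalues.  (A nontrivial solution has `u'(0) ≠ 0`, so the normalization `u'(0) = 1` contained
in `IsSolution` loses nothing.) -/
def IsEigenvalue (α β : ℝ) (q : ℝ → ℝ) (lam : ℝ) : Prop :=
  ∃ u : ℝ → ℝ, IsSolution α β q lam u

/-- `(lam, u)` is the `n`-th eigenpair, `n = 1, 2, …`, the eigenvalues being enumerated in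
increasing order: there are exactly `n - 1` eigenvalues below `lam`. -/
def IsNthEigenpair (α β : ℝ) (q : ℝ → ℝ) (n : ℕ) (lam : ℝ) (u : ℝ → ℝ) : Prop :=
  IsSolution α β q lam u ∧
    {μ : ℝ | IsEigenvalue α β q μ ∧ μ < lam}.encard + 1 = (n : ℕ∞)

/-! ### The basic problem -/

/-- `lam0` is the root, in `[π²n², π²(n+1)²)`, of the characteristic equation of the basic
problem `u'' - β δ(x - α) u + lam0 u = 0`. -/
def IsBasicEigenvalue (α β : ℝ) (n : ℕ) (lam0 : ℝ) : Prop :=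
  lam0 ∈ Ico (Real.pi ^ 2 * (n : ℝ) ^ 2) (Real.pi ^ 2 * ((n : ℝ) + 1) ^ 2) ∧
    √lam0 * Real.sin √lam0 =
      -β * Real.sin (√lam0 * α) * Real.sin (√lam0 * (1 - α))

open Classical in
/-- The coefficient `c^(0)` of the solution to the basic problem. -/
def basicC (α lam0 : ℝ) : ℝ :=
  if Real.sin (√lam0 * (1 - α)) ≠ 0 then
    Real.sin (√lam0 * α) / (√lam0 * Real.sin (√lam0 * (1 - α)))
  else -Real.cos √lam0 / √lam0

open Classical in
/-- The solution `u^(0)` to the basic problem. -/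
def basicU (α lam0 : ℝ) (x : ℝ) : ℝ :=
  if x ≤ α then Real.sin (√lam0 * x) / √lam0
  else basicC α lam0 * Real.sin (√lam0 * (1 - x))

/-! ### Constants in the convergence condition and in the error estimates -/

/-- `‖q‖_{0,1} = ∫₀¹ |q|`. -/
def normL1 (q : ℝ → ℝ) : ℝ := ∫ x in (0 : ℝ)..1, |q x|

/-- `M_n = λ_n^(0) ∫₀¹ (u_n^(0))²`. -/
def M (α lam0 : ℝ) : ℝ := lam0 * ∫ x in (0 : ℝ)..1, basicU α lam0 x ^ 2

/-- `c̃_n`, which is `λ_n^(0) (c_n^(0))²`. -/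
def cTilde (α β lam0 : ℝ) : ℝ :=
  Real.sin (√lam0 * α) ^ 2 +
    (Real.cos (√lam0 * α) + β / √lam0 * Real.sin (√lam0 * α)) ^ 2

/-- `b(n) = max{1, √λ_n^(0)/M_n, √λ_n^(0) √c̃_n/M_n}`. -/
def b (α β lam0 : ℝ) : ℝ :=
  max 1 (max (√lam0 / M α lam0) (√lam0 * √(cTilde α β lam0) / M α lam0))

/-- `v̄₀(n) = b(n) ‖u_n^(0)‖_∞`. -/
def v0 (α β lam0 : ℝ) : ℝ := b α β lam0 * supNorm (basicU α lam0)

/-- `w₁ = 1 + 2 v̄₀ + 2 √(v̄₀ (1 + v̄₀))`. -/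
def w1 (α β lam0 : ℝ) : ℝ :=
  1 + 2 * v0 α β lam0 + 2 * √(v0 α β lam0 * (1 + v0 α β lam0))

/-- `w₂ = (1 + v̄₀) ‖q‖_{0,1}`. -/
def w2 (α β : ℝ) (q : ℝ → ℝ) (lam0 : ℝ) : ℝ := (1 + v0 α β lam0) * normL1 q

/-- `1/R(n) = w₁ w₂`.  (The reciprocal is used since `R = +∞` when `q = 0`.) -/
def invR (α β : ℝ) (q : ℝ → ℝ) (lam0 : ℝ) : ℝ := w1 α β lam0 * w2 α β q lam0

/-- `r_n = (1 + √(1 + (1 + β/√λ_n^(0))²)) / (√λ_n^(0) R)`. -/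
def r (α β : ℝ) (q : ℝ → ℝ) (lam0 : ℝ) : ℝ :=
  (1 + √(1 + (1 + β / √lam0) ^ 2)) / √lam0 * invR α β q lam0

/-- `α_j = (2j-3)!! / (2 (2j)!!)` for `j ≥ 1`, with `(-1)!! = 1` (for `j = 1` the truncated
subtraction gives `0!! = 1`, the same value). -/
def alphaCoeff (j : ℕ) : ℝ :=
  (Nat.doubleFactorial (2 * j - 3) : ℝ) / (2 * (Nat.doubleFactorial (2 * j) : ℝ))

/-- `C_{n,m} = α_{m+1} M_n / (1 - r_n)`. -/
def C (α β : ℝ) (q : ℝ → ℝ) (lam0 : ℝ) (m : ℕ) : ℝ :=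
  alphaCoeff (m + 1) * M α lam0 / (1 - r α β q lam0)

/-- The bound `C_{n,m} min{1/M_n, 1/√λ_n^(0), 1/(√λ_n^(0) √c̃_n)} r_n^{m+1}` for eigenfunctions. -/
def boundU (α β : ℝ) (q : ℝ → ℝ) (lam0 : ℝ) (m : ℕ) : ℝ :=
  C α β q lam0 m *
    min (1 / M α lam0) (min (1 / √lam0) (1 / (√lam0 * √(cTilde α β lam0)))) *
    r α β q lam0 ^ (m + 1)

/-- The bound `C_{n,m} / ((M_n + max{1, c̃_n, √c̃_n M_n/√λ_n^(0)}) R) r_n^m` for eigenvalues. -/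
def boundLam (α β : ℝ) (q : ℝ → ℝ) (lam0 : ℝ) (m : ℕ) : ℝ :=
  C α β q lam0 m /
    (M α lam0 +
      max 1 (max (cTilde α β lam0) (√(cTilde α β lam0) * M α lam0 / √lam0))) *
    invR α β q lam0 * r α β q lam0 ^ m

/-! ### The FD-method -/

/-- The right-hand side `F^(j) = -∑_{p=0}^{j-1} λ^(j-p) u^(p) + q u^(j-1)`, `j ≥ 1`. -/
def rhs (q : ℝ → ℝ) (lam : ℕ → ℝ) (u : ℕ → ℝ → ℝ) (j : ℕ) (x : ℝ) : ℝ :=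
  -(∑ p ∈ Finset.range j, lam (j - p) * u p x) + q x * u (j - 1) x

/-- The sequences `λ^(j)`, `u^(j)` (on `[0,1]`), `c^(j)` are produced by the FD-method: the basic
problem for `j = 0`, and for `j ≥ 1` the formula for `λ^(j)`, the two equations for `c^(j)` and the
two integral representations of `u^(j)`, on `[0,α]` and on `[α,1]`. -/
structure IsFDMethod (α β : ℝ) (q : ℝ → ℝ) (lam0 : ℝ)
    (lam : ℕ → ℝ) (u : ℕ → ℝ → ℝ) (c : ℕ → ℝ) : Prop where
  lam_zero : lam 0 = lam0
  c_zero : c 0 = basicC α lam0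
  u_zero : ∀ x ∈ Icc (0 : ℝ) 1, u 0 x = basicU α lam0 x
  lam_succ : ∀ j : ℕ, 1 ≤ j →
    lam j = lam0 / M α lam0 *
      (-(∑ p ∈ Finset.Ico 1 j, lam (j - p) * ∫ ξ in (0 : ℝ)..1, u 0 ξ * u p ξ)
        + ∫ ξ in (0 : ℝ)..1, q ξ * u (j - 1) ξ * u 0 ξ)
  c_sin : ∀ j : ℕ, 1 ≤ j →
    c j * Real.sin (√lam0 * (1 - α)) =
      ∫ ξ in (0 : ℝ)..1, Real.sin (√lam0 * (α - ξ)) / √lam0 * rhs q lam u j ξ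
  c_cos : ∀ j : ℕ, 1 ≤ j →
    c j * Real.cos (√lam0 * (1 - α)) =
      -(∫ ξ in (0 : ℝ)..1, Real.cos (√lam0 * (α - ξ)) / √lam0 * rhs q lam u j ξ)
        - β * ∫ ξ in (0 : ℝ)..α, Real.sin (√lam0 * (α - ξ)) / lam0 * rhs q lam u j ξ
  u_left : ∀ j : ℕ, 1 ≤ j → ∀ x ∈ Icc 0 α,
    u j x = ∫ ξ in (0 : ℝ)..x, Real.sin (√lam0 * (x - ξ)) / √lam0 * rhs q lam u j ξ
  u_right : ∀ j : ℕ, 1 ≤ j → ∀ x ∈ Icc α 1,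
    u j x = c j * Real.sin (√lam0 * (1 - x))
      - ∫ ξ in x..1, Real.sin (√lam0 * (x - ξ)) / √lam0 * rhs q lam u j ξ

/-- The approximation of rank `m` to the eigenvalue. -/
def lamApprox (lam : ℕ → ℝ) (m : ℕ) : ℝ := ∑ j ∈ Finset.range (m + 1), lam j

/-- The approximation of rank `m` to the eigenfunction. -/
def uApprox (u : ℕ → ℝ → ℝ) (m : ℕ) (x : ℝ) : ℝ := ∑ j ∈ Finset.range (m + 1), u j x

end FD

end

namespace FD

/-! The FD-method is perturbation theory along the potentials t q, 0 ≤ t ≤ 1. Inserting λ(t) = ∑ tʲ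
λ⁽ʲ⁾ and u(t) = ∑ tʲ u⁽ʲ⁾ into the equation gives, at order tʲ, the problem u⁽ʲ⁾'' + λ⁽⁰⁾ u⁽ʲ⁾ =
F⁽ʲ⁾ with the same jump condition at α. It is resonant and requires F⁽ʲ⁾ to be orthogonal to u⁽⁰⁾;
the formula for λ⁽ʲ⁾ is this condition (`integral_rhs_mul`), and it makes the two equations for c⁽ʲ⁾
compatible (`exists_corrector`).

Size of the corrections: put ℓ_j = |λ⁽ʲ⁾| and v_j = b ‖u⁽ʲ⁾‖. With S_j = ∑ ℓ_{j-p} v_p + ‖q‖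
v_{j-1}, where 1 ≤ p < j, one has ℓ_j ≤ S_j and v_j ≤ κ S_j. After scaling, the extremal sequence
has a generating function g with g = g² + X g + v̄₀ X, that is, g = (1 - X - √((1 - wX)(1 - X/w)))/2
with w + 1/w = 2 + 4 v̄₀. Its coefficients are at most α_j wʲ (`majCoeff_le`), whence v_j ≤ α_j rʲ
(`recurrence_majorized`, `IsFDMethod.correction_le`). As α_j decreases to 0, the tails are bounded
by geometric series with a vanishing factor.

Identification of the limit: both series converge absolutely for all |t| ≤ 1, and summing the
integral equations of the corrections shows that u(t) solves the problem with potential t q and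
eigenvalue λ(t) (`IsFDMethod.isSolution`). For the index, the eigenvalues are the zeros of D(μ, t),
the value at 1 of the normalized solution. D is continuous, its zeros are bounded below uniformly in
t, and Lagrange's identity makes them locally unique with a change of sign
(`exists_characteristic`). So zeros below the curve λ(t) can neither appear, disappear nor cross it,
and their number is constant in t (`encard_zeros_eq`). At t = 0 it is n - 1, because the
characteristic equation has exactly one root in each [πk, π(k+1)), k ≥ 1, and none in (0, π)
(`encard_basic_eigenvalues`). -/

/-! ### Absolutely continuous functions and the fundamental theorem of calculus. -/

theorem integral_eq_sub_of_absolutelyContinuous {f g : ℝ → ℝ} {a b : ℝ} (hab : a ≤ b)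
    (hf : AbsolutelyContinuousOnInterval f a b)
    (hg : ∀ᵐ x, x ∈ Ioo a b → HasDerivAt f (g x) x) :
    IntervalIntegrable g volume a b ∧ ∫ x in a..b, g x = f b - f a := by
  have hne : ∀ᵐ x : ℝ, x ≠ b := by
    simp [ae_iff, measure_singleton]
  have h : ∀ᵐ x, x ∈ uIoc a b → deriv f x = g x := by
    filter_upwards [hg, hne] with x hx hxb hmem
    rw [uIoc_of_le hab] at hmem
    exact (hx ⟨hmem.1, lt_of_le_of_ne hmem.2 hxb⟩).deriv
  constructor
  · exact hf.intervalIntegrable_deriv.congr_ae ((ae_restrict_iff' measurableSet_uIoc).2 h)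
  · rw [← hf.integral_deriv_eq_sub]
    exact (intervalIntegral.integral_congr_ae h).symm

/-- An absolutely continuous function is the integral of its a.e. derivative; if that derivative is
continuous, the integral is differentiable everywhere. This upgrades the a.e. derivatives of
parameter integrals to the pointwise ones demanded by `IsSolution`. -/
theorem hasDerivWithinAt_of_absolutelyContinuous {f g : ℝ → ℝ} {a b : ℝ} (hab : a ≤ b)
    (hf : AbsolutelyContinuousOnInterval f a b)
    (hg : ∀ᵐ x, x ∈ Ioo a b → HasDerivAt f (g x) x) (hgc : ContinuousOn g (Icc a b)) :
    ∀ x ∈ Icc a b, HasDerivWithinAt f (g x) (Icc a b) x := by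
  intro x hx
  have key : ∀ z ∈ Icc a b, f z = f a + ∫ t in a..z, g t := by
    intro z hz
    have := (integral_eq_sub_of_absolutelyContinuous (f := f) (g := g) hz.1
      (hf.mono (by
        rw [uIcc_of_le hz.1, uIcc_of_le hab]; exact Icc_subset_Icc_right hz.2)) (by
        filter_upwards [hg] with t ht htm
        exact ht ⟨htm.1, htm.2.trans_le hz.2⟩)).2
    linarith
  have hint : ∀ z ∈ Icc a b, IntervalIntegrable g volume a z := fun z hz =>
    (hgc.mono (by rw [uIcc_of_le hz.1]; exact Icc_subset_Icc_right hz.2)).intervalIntegrable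
  have : HasDerivWithinAt (fun z => ∫ t in a..z, g t) (g x) (Icc a b) x := by
    have : Fact (x ∈ Icc a b) := ⟨hx⟩
    exact intervalIntegral.integral_hasDerivWithinAt_right (hint x hx)
      (hgc.stronglyMeasurableAtFilter_nhdsWithin measurableSet_Icc x) (hgc x hx)
  exact (this.const_add (f a)).congr (fun z hz => key z hz) (key x hx)

theorem absolutelyContinuous_of_hasDerivWithinAt {f g : ℝ → ℝ} {a b : ℝ} (hab : a ≤ b)
    (hf : ∀ x ∈ Icc a b, HasDerivWithinAt f (g x) (Icc a b) x) (hgc : ContinuousOn g (Icc a b)) :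
    AbsolutelyContinuousOnInterval f a b := by
  obtain ⟨C, hC⟩ := isCompact_Icc.exists_bound_of_continuousOn hgc
  have : LipschitzOnWith C.toNNReal f (uIcc a b) := by
    rw [uIcc_of_le hab]
    refine (convex_Icc a b).lipschitzOnWith_of_nnnorm_hasDerivWithin_le hf (fun x hx => ?_)
    rw [← NNReal.coe_le_coe, coe_nnnorm]
    exact (hC x hx).trans (Real.le_coe_toNNReal C)
  exact this.absolutelyContinuousOnInterval

theorem absolutelyContinuous_of_contDiff {f : ℝ → ℝ} (a b : ℝ) (hf : ContDiff ℝ 1 f) :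
    AbsolutelyContinuousOnInterval f a b := hf.contDiffOn.absolutelyContinuousOnInterval

/-! ### Carathéodory solutions on one interval. -/

/-- `u'' = p u` on `[a,b]` in the Carathéodory sense, with `u' = du`. -/
structure SolvesOn (a b : ℝ) (p u du : ℝ → ℝ) : Prop where
  ac : AbsolutelyContinuousOnInterval du a b
  deriv : ∀ x ∈ Icc a b, HasDerivWithinAt u (du x) (Icc a b) x
  ode : ∀ᵐ x, x ∈ Ioo a b → HasDerivAt du (p x * u x) x

namespace SolvesOn

variable {a b : ℝ} {p u du : ℝ → ℝ}

theorem ac_self (h : SolvesOn a b p u du) (hab : a ≤ b) : AbsolutelyContinuousOnInterval u a b :=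
  absolutelyContinuous_of_hasDerivWithinAt hab h.deriv
    (by have := h.ac.continuousOn; rwa [uIcc_of_le hab] at this)

theorem hasDerivAt (h : SolvesOn a b p u du) {x : ℝ} (hx : x ∈ Ioo a b) : HasDerivAt u (du x) x :=
  (h.deriv x (Ioo_subset_Icc_self hx)).hasDerivAt (Icc_mem_nhds hx.1 hx.2)

theorem mono (h : SolvesOn a b p u du) {c d : ℝ} (hac : a ≤ c) (hcd : c ≤ d) (hdb : d ≤ b) :
    SolvesOn c d p u du where
  ac := h.ac.mono (by
    rw [uIcc_of_le hcd, uIcc_of_le (hac.trans (hcd.trans hdb))]; exact Icc_subset_Icc hac hdb)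
  deriv x hx := (h.deriv x (Icc_subset_Icc hac hdb hx)).mono (Icc_subset_Icc hac hdb)
  ode := by
    filter_upwards [h.ode] with x hx hxm
    exact hx (Ioo_subset_Ioo hac hdb hxm)

/-- Lagrange's identity. -/
theorem lagrange (hab : a ≤ b) {p₂ v dv : ℝ → ℝ} (hu : SolvesOn a b p u du)
    (hv : SolvesOn a b p₂ v dv) :
    IntervalIntegrable (fun x => (p₂ x - p x) * (u x * v x)) volume a b ∧
    ∫ x in a..b, (p₂ x - p x) * (u x * v x) = (u b * dv b - v b * du b) - (u a * dv a - v a * du a) := by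
  refine integral_eq_sub_of_absolutelyContinuous (f := fun x => u x * dv x - v x * du x) hab
    (((hu.ac_self hab).mul hv.ac).sub ((hv.ac_self hab).mul hu.ac)) ?_
  filter_upwards [hu.ode, hv.ode] with x h1 h2 hx
  exact (((hu.hasDerivAt hx).mul (h2 hx)).sub ((hv.hasDerivAt hx).mul (h1 hx))).congr_deriv
    (by ring)

/-- The energy identity. -/
theorem energy (hab : a ≤ b) (hu : SolvesOn a b p u du) :
    IntervalIntegrable (fun x => du x ^ 2 + p x * u x ^ 2) volume a b ∧
    ∫ x in a..b, (du x ^ 2 + p x * u x ^ 2) = u b * du b - u a * du a := by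
  refine integral_eq_sub_of_absolutelyContinuous (f := fun x => u x * du x) hab
    ((hu.ac_self hab).mul hu.ac) ?_
  filter_upwards [hu.ode] with x h1 hx
  exact ((hu.hasDerivAt hx).mul (h1 hx)).congr_deriv (by ring)

/-- Variation of constants. -/
theorem variation (hab : a ≤ b) (hu : SolvesOn a b p u du) {y : ℝ} (hy : y ≠ 0) (x : ℝ) :
    ∫ ξ in a..b, Real.sin (y * (x - ξ)) / y * ((p ξ + y ^ 2) * u ξ) =
      (Real.sin (y * (x - b)) / y * du b + Real.cos (y * (x - b)) * u b) -
      (Real.sin (y * (x - a)) / y * du a + Real.cos (y * (x - a)) * u a) := by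
  -- In the derivative of this expression the terms with u' cancel and (p + y²) u times the kernel
  -- remains. No relation between y and p is needed.
  refine (integral_eq_sub_of_absolutelyContinuous
    (f := fun ξ => Real.sin (y * (x - ξ)) / y * du ξ + Real.cos (y * (x - ξ)) * u ξ) hab
    (((absolutelyContinuous_of_contDiff a b (by fun_prop)).mul hu.ac).add
      ((absolutelyContinuous_of_contDiff a b (by fun_prop)).mul (hu.ac_self hab))) ?_).2
  filter_upwards [hu.ode] with ξ h1 hξ
  have hl : HasDerivAt (fun ξ => y * (x - ξ)) (y * (-1)) ξ :=
    ((hasDerivAt_id ξ).const_sub x).const_mul y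
  refine (((hl.sin.div_const y).mul (h1 hξ)).add (hl.cos.mul (hu.hasDerivAt hξ))).congr_deriv ?_
  field_simp
  ring

end SolvesOn

/-- The Duhamel integral with base point `e`, as a solution of `u'' + y² u = F`. -/
theorem duhamel {a b e y A B : ℝ} {F : ℝ → ℝ} (hab : a ≤ b) (he : e ∈ Icc a b) (hy : y ≠ 0)
    (hF : IntervalIntegrable F volume a b) {u : ℝ → ℝ}
    (hu : ∀ x ∈ Icc a b, u x = A * Real.sin (y * x) / y + B * Real.cos (y * x) +
      ∫ ξ in e..x, Real.sin (y * (x - ξ)) / y * F ξ) :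
    ∃ du : ℝ → ℝ, AbsolutelyContinuousOnInterval du a b ∧
      (∀ x ∈ Icc a b, HasDerivWithinAt u (du x) (Icc a b) x) ∧
      (∀ᵐ x, x ∈ Ioo a b → HasDerivAt du (F x - y ^ 2 * u x) x) ∧
      ∀ x ∈ Icc a b, du x = A * Real.cos (y * x) - B * y * Real.sin (y * x) +
        ∫ ξ in e..x, Real.cos (y * (x - ξ)) * F ξ := by
  have hei : e ∈ uIcc a b := by rwa [uIcc_of_le hab]
  have hc : IntervalIntegrable (fun ξ => Real.cos (y * ξ) * F ξ) volume a b :=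
    hF.continuousOn_mul (by fun_prop)
  have hs : IntervalIntegrable (fun ξ => Real.sin (y * ξ) * F ξ) volume a b :=
    hF.continuousOn_mul (by fun_prop)
  -- The addition theorem removes x from the integrands, so Lebesgue differentiation applies to c
  -- and s. The contributions of c' and s' cancel in w' and add up to F in dw', by sin² + cos² = 1.
  set c : ℝ → ℝ := fun x => ∫ ξ in e..x, Real.cos (y * ξ) * F ξ with hcdef
  set s : ℝ → ℝ := fun x => ∫ ξ in e..x, Real.sin (y * ξ) * F ξ with hsdef
  have hcac : AbsolutelyContinuousOnInterval c a b :=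
    hc.absolutelyContinuousOnInterval_intervalIntegral hei
  have hsac : AbsolutelyContinuousOnInterval s a b :=
    hs.absolutelyContinuousOnInterval_intervalIntegral hei
  have hcd := hc.ae_hasDerivAt_integral
  have hsd := hs.ae_hasDerivAt_integral
  have hsub : ∀ x ∈ Icc a b, ∀ {G : ℝ → ℝ}, IntervalIntegrable G volume a b →
      IntervalIntegrable G volume e x := fun x hx G hG =>
    hG.mono_set (by rw [uIcc_of_le hab]; exact uIcc_subset_Icc he hx)
  set w : ℝ → ℝ := fun x => A * Real.sin (y * x) / y + B * Real.cos (y * x) +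
    (Real.sin (y * x) * c x - Real.cos (y * x) * s x) / y with hw
  set dw : ℝ → ℝ := fun x => A * Real.cos (y * x) - B * y * Real.sin (y * x) +
    (Real.cos (y * x) * c x + Real.sin (y * x) * s x) with hdw
  have huw : ∀ x ∈ Icc a b, u x = w x := by
    intro x hx
    rw [hu x hx, hw]
    simp only [hcdef, hsdef]
    rw [← intervalIntegral.integral_const_mul, ← intervalIntegral.integral_const_mul,
      ← intervalIntegral.integral_sub ((hsub x hx hc).const_mul _) ((hsub x hx hs).const_mul _),
      ← intervalIntegral.integral_div]
    congr 1
    refine intervalIntegral.integral_congr (fun ξ _ => ?_)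
    simp only [mul_sub, Real.sin_sub]
    ring
  have hsinAC := absolutelyContinuous_of_contDiff (f := fun x => Real.sin (y * x)) a b (by fun_prop)
  have hcosAC := absolutelyContinuous_of_contDiff (f := fun x => Real.cos (y * x)) a b (by fun_prop)
  have hdwac : AbsolutelyContinuousOnInterval dw a b :=
    (absolutelyContinuous_of_contDiff
      (f := fun x => A * Real.cos (y * x) - B * y * Real.sin (y * x)) a b (by fun_prop)).add
      ((hcosAC.mul hcac).add (hsinAC.mul hsac))
  have hwac : AbsolutelyContinuousOnInterval w a b := by
    have := (absolutelyContinuous_of_contDiff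
      (f := fun x => A * Real.sin (y * x) / y + B * Real.cos (y * x)) a b (by fun_prop)).add
      (((hsinAC.mul hcac).sub (hcosAC.mul hsac)).const_mul y⁻¹)
    have hwe : w = (fun x => A * Real.sin (y * x) / y + B * Real.cos (y * x)) + fun x =>
        y⁻¹ * ((fun x => Real.sin (y * x)) * c - (fun x => Real.cos (y * x)) * s) x := by
      funext x
      simp only [hw, Pi.add_apply, Pi.sub_apply, Pi.mul_apply]
      ring
    rwa [hwe]
  have hder : ∀ᵐ x, x ∈ Ioo a b → HasDerivAt w (dw x) x ∧ HasDerivAt dw (F x - y ^ 2 * w x) x := by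
    filter_upwards [hcd, hsd] with x h1 h2 hx
    have hxm : x ∈ uIcc a b := by rw [uIcc_of_le hab]; exact Ioo_subset_Icc_self hx
    have h1 := h1 hxm e hei
    have h2 := h2 hxm e hei
    have hl : HasDerivAt (fun x => y * x) y x := by
      simpa using (hasDerivAt_id x).const_mul y
    constructor
    · refine ((((hl.sin.const_mul A).div_const y).add (hl.cos.const_mul B)).add
        (((hl.sin.mul h1).sub (hl.cos.mul h2)).div_const y)).congr_deriv ?_
      simp only [hdw]
      field_simp
      ring
    · refine (((hl.cos.const_mul A).sub (hl.sin.const_mul (B * y))).add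
        ((hl.cos.mul h1).add (hl.sin.mul h2))).congr_deriv ?_
      have := Real.sin_sq_add_cos_sq (y * x)
      simp only [hw]
      field_simp
      linear_combination (F x) * this
  refine ⟨dw, hdwac, ?_, ?_, ?_⟩
  · have hdc : ContinuousOn dw (Icc a b) := by
      have := hdwac.continuousOn; rwa [uIcc_of_le hab] at this
    have := hasDerivWithinAt_of_absolutelyContinuous hab hwac
      (hder.mono fun x hx hm => (hx hm).1) hdc
    exact fun x hx => (this x hx).congr huw (huw x hx)
  · filter_upwards [hder] with x hx hm
    rw [huw x (Ioo_subset_Icc_self hm)]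
    exact (hx hm).2
  · intro x hx
    simp only [hdw, hcdef, hsdef]
    rw [← intervalIntegral.integral_const_mul, ← intervalIntegral.integral_const_mul,
      ← intervalIntegral.integral_add ((hsub x hx hc).const_mul _) ((hsub x hx hs).const_mul _)]
    congr 1
    refine intervalIntegral.integral_congr (fun ξ _ => ?_)
    simp only [mul_sub, Real.cos_sub]
    ring

/-! ### The initial value problem with a point interaction and its Volterra form. -/

/-- The initial value problem `u'' = (p + β δ(x - α)) u`, `u(0) = 0`, `u'(0) = 1`. -/
structure IsIVP (α β : ℝ) (p u du₁ du₂ : ℝ → ℝ) : Prop where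
  zero : u 0 = 0
  left : SolvesOn 0 α p u du₁
  right : SolvesOn α 1 p u du₂
  slope : du₁ 0 = 1
  jump : du₂ α - du₁ α = β * u α

theorem isSolution_iff {α β : ℝ} {q : ℝ → ℝ} {lam : ℝ} {u : ℝ → ℝ} :
    IsSolution α β q lam u ↔
      u 1 = 0 ∧ ∃ du₁ du₂, IsIVP α β (fun x => q x - lam) u du₁ du₂ := by
  have aux : ∀ (du : ℝ → ℝ) (x : ℝ), (∃ d : ℝ, HasDerivAt du d x ∧ d - q x * u x + lam * u x = 0) ↔
      HasDerivAt du ((q x - lam) * u x) x := by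
    intro du x
    constructor
    · rintro ⟨d, hd, h⟩
      exact hd.congr_deriv (by linarith)
    · intro h
      exact ⟨_, h, by ring⟩
  constructor
  · rintro ⟨h0, h1, d1, d2, ac1, ac2, hd1, hd2, o1, o2, hs, hj⟩
    refine ⟨h1, d1, d2, h0, ⟨ac1, hd1, ?_⟩, ⟨ac2, hd2, ?_⟩, hs, hj⟩
    · filter_upwards [o1] with x hx hm using (aux d1 x).1 (hx hm)
    · filter_upwards [o2] with x hx hm using (aux d2 x).1 (hx hm)
  · rintro ⟨h1, d1, d2, h0, ⟨ac1, hd1, o1⟩, ⟨ac2, hd2, o2⟩, hs, hj⟩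
    refine ⟨h0, h1, d1, d2, ac1, ac2, hd1, hd2, ?_, ?_, hs, hj⟩
    · filter_upwards [o1] with x hx hm using (aux d1 x).2 (hx hm)
    · filter_upwards [o2] with x hx hm using (aux d2 x).2 (hx hm)

theorem intervalIntegrable_sub {f : ℝ → ℝ} (hf : IntervalIntegrable f volume 0 1) {a b : ℝ}
    (ha : a ∈ Icc (0 : ℝ) 1) (hb : b ∈ Icc (0 : ℝ) 1) : IntervalIntegrable f volume a b :=
  hf.mono_set (by rw [uIcc_of_le (zero_le_one' ℝ)]; exact uIcc_subset_Icc ha hb)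

theorem intervalIntegrable_mul_continuousOn {p u : ℝ → ℝ} (hp : IntervalIntegrable p volume 0 1)
    (hu : ContinuousOn u (Icc 0 1)) : IntervalIntegrable (fun x => p x * u x) volume 0 1 :=
  hp.mul_continuousOn (by rwa [uIcc_of_le (zero_le_one' ℝ)])

/-- The Volterra form, with respect to `u'' + y² u`, of the initial value problem `IsIVP`. -/
def IsVolterra (α β y : ℝ) (p u : ℝ → ℝ) : Prop :=
  ∀ x ∈ Icc (0 : ℝ) 1, u x = Real.sin (y * x) / y +
    (∫ ξ in (0 : ℝ)..x, Real.sin (y * (x - ξ)) / y * ((p ξ + y ^ 2) * u ξ)) +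
    β * (Real.sin (y * max (x - α) 0) / y) * u α

theorem IsIVP.continuousOn {α β : ℝ} {p u du₁ du₂ : ℝ → ℝ} (hα : α ∈ Ioo (0 : ℝ) 1)
    (h : IsIVP α β p u du₁ du₂) : ContinuousOn u (Icc 0 1) := by
  rw [← Icc_union_Icc_eq_Icc hα.1.le hα.2.le]
  exact ContinuousOn.union_of_isClosed (fun x hx => (h.left.deriv x hx).continuousWithinAt)
    (fun x hx => (h.right.deriv x hx).continuousWithinAt) isClosed_Icc isClosed_Icc

/-- Variation of constants on [0,α] and [α,x]: the boundary terms at α cancel up to the jump of u',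
which leaves β u(α) times the kernel. The number y is free: y = 1 serves the general theory, y = √μ
solves the case q = 0 explicitly, y = √λ⁽⁰⁾ fits the FD-series. -/
theorem IsIVP.isVolterra {α β y : ℝ} {p u du₁ du₂ : ℝ → ℝ} (hα : α ∈ Ioo (0 : ℝ) 1) (hy : y ≠ 0)
    (hp : IntervalIntegrable p volume 0 1) (h : IsIVP α β p u du₁ du₂) :
    IsVolterra α β y p u := by
  intro x hx
  have hF : IntervalIntegrable (fun ξ => (p ξ + y ^ 2) * u ξ) volume 0 1 :=
    intervalIntegrable_mul_continuousOn (hp.add intervalIntegrable_const) (h.continuousOn hα)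
  rcases le_total x α with hxα | hxα
  · have := (h.left.mono le_rfl hx.1 hxα).variation hx.1 hy x
    rw [this, max_eq_right (by linarith), h.slope, h.zero]
    simp
  · have hG : IntervalIntegrable (fun ξ => Real.sin (y * (x - ξ)) / y * ((p ξ + y ^ 2) * u ξ))
        volume 0 1 := hF.continuousOn_mul (by fun_prop)
    have h1 := h.left.variation hα.1.le hy x
    have h2 := (h.right.mono le_rfl hxα hx.2).variation hxα hy x
    rw [← intervalIntegral.integral_add_adjacent_intervals
      (intervalIntegrable_sub hG (by simp) (Ioo_subset_Icc_self hα))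
      (intervalIntegrable_sub hG (Ioo_subset_Icc_self hα) hx), h1, h2,
      max_eq_left (by linarith), h.slope, h.zero]
    have := h.jump
    simp only [sub_self, mul_zero, Real.sin_zero, Real.cos_zero, sub_zero]
    linear_combination (Real.sin (y * (x - α)) / y) * this

theorem integral_sin_sub {y x e z : ℝ} {F : ℝ → ℝ} (hF : IntervalIntegrable F volume e z) :
    ∫ ξ in e..z, Real.sin (y * (x - ξ)) / y * F ξ =
      Real.sin (y * x) / y * (∫ ξ in e..z, Real.cos (y * ξ) * F ξ) -
        Real.cos (y * x) / y * ∫ ξ in e..z, Real.sin (y * ξ) * F ξ := by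
  have hc : IntervalIntegrable (fun ξ => Real.cos (y * ξ) * F ξ) volume e z :=
    hF.continuousOn_mul (by fun_prop)
  have hs : IntervalIntegrable (fun ξ => Real.sin (y * ξ) * F ξ) volume e z :=
    hF.continuousOn_mul (by fun_prop)
  rw [← intervalIntegral.integral_const_mul, ← intervalIntegral.integral_const_mul,
    ← intervalIntegral.integral_sub (hc.const_mul _) (hs.const_mul _)]
  refine intervalIntegral.integral_congr (fun ξ _ => ?_)
  simp only [mul_sub, Real.sin_sub]
  ring

theorem integral_cos_sub {y x e z : ℝ} {F : ℝ → ℝ} (hF : IntervalIntegrable F volume e z) :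
    ∫ ξ in e..z, Real.cos (y * (x - ξ)) * F ξ =
      Real.cos (y * x) * (∫ ξ in e..z, Real.cos (y * ξ) * F ξ) +
        Real.sin (y * x) * ∫ ξ in e..z, Real.sin (y * ξ) * F ξ := by
  have hc : IntervalIntegrable (fun ξ => Real.cos (y * ξ) * F ξ) volume e z :=
    hF.continuousOn_mul (by fun_prop)
  have hs : IntervalIntegrable (fun ξ => Real.sin (y * ξ) * F ξ) volume e z :=
    hF.continuousOn_mul (by fun_prop)
  rw [← intervalIntegral.integral_const_mul, ← intervalIntegral.integral_const_mul,
    ← intervalIntegral.integral_add (hc.const_mul _) (hs.const_mul _)]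
  refine intervalIntegral.integral_congr (fun ξ _ => ?_)
  simp only [mul_sub, Real.cos_sub]
  ring

/-- Lets solutions be recognised from the integral equation alone, so that no series has to be
differentiated. -/
theorem IsVolterra.isIVP {α β y : ℝ} {p u : ℝ → ℝ} (hα : α ∈ Ioo (0 : ℝ) 1) (hy : y ≠ 0)
    (hp : IntervalIntegrable p volume 0 1) (hu : ContinuousOn u (Icc 0 1))
    (h : IsVolterra α β y p u) : ∃ du₁ du₂, IsIVP α β p u du₁ du₂ := by
  have hF : IntervalIntegrable (fun ξ => (p ξ + y ^ 2) * u ξ) volume 0 1 :=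
    intervalIntegrable_mul_continuousOn (hp.add intervalIntegrable_const) hu
  have hαm : α ∈ Icc (0 : ℝ) 1 := Ioo_subset_Icc_self hα
  set F : ℝ → ℝ := fun ξ => (p ξ + y ^ 2) * u ξ with hFdef
  have hF1 : IntervalIntegrable F volume 0 α := intervalIntegrable_sub hF (by simp) hαm
  have hF2 : IntervalIntegrable F volume α 1 := intervalIntegrable_sub hF hαm (by simp)
  obtain ⟨d1, ac1, hd1, ho1, hv1⟩ := duhamel (e := 0) (A := 1) (B := 0) hα.1.le
    (left_mem_Icc.2 hα.1.le) hy hF1 (u := u) (fun x hx => by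
      rw [h x ⟨hx.1, hx.2.trans hα.2.le⟩, max_eq_right (by linarith [hx.2])]
      simp [hFdef])
  set I := ∫ ξ in (0 : ℝ)..α, Real.cos (y * ξ) * F ξ with hI
  set J := ∫ ξ in (0 : ℝ)..α, Real.sin (y * ξ) * F ξ with hJ
  -- Beyond α, the integral over [0,α] and the delta term solve the homogeneous equation; A and B
  -- collect their coefficients, together with that of the initial sine.
  obtain ⟨d2, ac2, hd2, ho2, hv2⟩ := duhamel (e := α) (A := 1 + I + β * Real.cos (y * α) * u α)
    (B := -(J + β * Real.sin (y * α) * u α) / y) hα.2.le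
    (left_mem_Icc.2 hα.2.le) hy hF2 (u := u) (fun x hx => by
      have hx1 : x ∈ Icc (0 : ℝ) 1 := ⟨hα.1.le.trans hx.1, hx.2⟩
      have hG : IntervalIntegrable (fun ξ => Real.sin (y * (x - ξ)) / y * F ξ)
        volume 0 1 := hF.continuousOn_mul (by fun_prop)
      have h0 := h x hx1
      change u x = _ + (∫ ξ in (0 : ℝ)..x, Real.sin (y * (x - ξ)) / y * F ξ) + _ at h0
      rw [h0, max_eq_left (by linarith [hx.1]),
        ← intervalIntegral.integral_add_adjacent_intervals
          (intervalIntegrable_sub hG (by simp) hαm) (intervalIntegrable_sub hG hαm hx1),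
        integral_sin_sub hF1, mul_sub, Real.sin_sub]
      field_simp
      ring)
  have ode : ∀ {a b : ℝ} {d : ℝ → ℝ}, (∀ᵐ x, x ∈ Ioo a b → HasDerivAt d (F x - y ^ 2 * u x) x) →
      ∀ᵐ x, x ∈ Ioo a b → HasDerivAt d (p x * u x) x := by
    intro a b d hd
    filter_upwards [hd] with x hx hm
    exact (hx hm).congr_deriv (by simp only [hFdef]; ring)
  refine ⟨d1, d2, ?_, ⟨ac1, hd1, ode ho1⟩, ⟨ac2, hd2, ode ho2⟩, ?_, ?_⟩
  · rw [h 0 (by simp), max_eq_right (by linarith [hα.1])]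
    simp
  · rw [hv1 0 (left_mem_Icc.2 hα.1.le)]
    simp
  · rw [hv1 α (right_mem_Icc.2 hα.1.le), hv2 α (left_mem_Icc.2 hα.2.le), integral_cos_sub hF1]
    have := Real.sin_sq_add_cos_sq (y * α)
    simp only [intervalIntegral.integral_same]
    field_simp
    linear_combination (β * u α) * this

/-- Lagrange's identity for two initial value problems. -/
theorem IsIVP.lagrange {α β : ℝ} {p p₂ u du₁ du₂ v dv₁ dv₂ : ℝ → ℝ} (hα : α ∈ Ioo (0 : ℝ) 1)
    (hu : IsIVP α β p u du₁ du₂) (hv : IsIVP α β p₂ v dv₁ dv₂) :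
    ∫ x in (0 : ℝ)..1, (p₂ x - p x) * (u x * v x) = u 1 * dv₂ 1 - v 1 * du₂ 1 := by
  obtain ⟨i1, h1⟩ := hu.left.lagrange hα.1.le hv.left
  obtain ⟨i2, h2⟩ := hu.right.lagrange hα.2.le hv.right
  rw [← intervalIntegral.integral_add_adjacent_intervals i1 i2, h1, h2, hu.zero, hv.zero]
  -- Both problems share β, so the Wronskian does not jump at α.
  linear_combination v α * hu.jump - u α * hv.jump

theorem IsVolterra.congr {α β y : ℝ} {p u v : ℝ → ℝ} (hα : α ∈ Ioo (0 : ℝ) 1)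
    (h : ∀ x ∈ Icc (0 : ℝ) 1, u x = v x) (hu : IsVolterra α β y p u) : IsVolterra α β y p v := by
  intro x hx
  rw [← h x hx, hu x hx, h α (Ioo_subset_Icc_self hα)]
  congr 2
  refine intervalIntegral.integral_congr (fun ξ hξ => ?_)
  rw [uIcc_of_le hx.1] at hξ
  simp only [h ξ ⟨hξ.1, hξ.2.trans hx.2⟩]

/-! ### Energy estimates and lower bounds for eigenvalues. -/

/-- A pointwise Sobolev inequality for functions vanishing at `0`. -/
theorem IsIVP.sq_le {α β : ℝ} {p u du₁ du₂ : ℝ → ℝ} (hα : α ∈ Ioo (0 : ℝ) 1)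
    (hu : IsIVP α β p u du₁ du₂) {Q : ℝ} (hQ : 0 < Q) {x : ℝ} (hx : x ∈ Icc (0 : ℝ) 1) :
    u x ^ 2 ≤ Q⁻¹ * ((∫ t in (0 : ℝ)..α, du₁ t ^ 2) + ∫ t in α..1, du₂ t ^ 2) +
      Q * ∫ t in (0 : ℝ)..1, u t ^ 2 := by
  have huc := hu.continuousOn hα
  have hαm : α ∈ Icc (0 : ℝ) 1 := Ioo_subset_Icc_self hα
  have hu2 : IntervalIntegrable (fun t => u t ^ 2) volume 0 1 :=
    (huc.pow 2).intervalIntegrable_of_Icc zero_le_one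
  have piece : ∀ {a b c : ℝ} {d : ℝ → ℝ}, 0 ≤ a → b ≤ 1 → a ≤ c → c ≤ b → SolvesOn a b p u d →
      u c ^ 2 - u a ^ 2 ≤ Q⁻¹ * (∫ t in a..b, d t ^ 2) + Q * ∫ t in a..b, u t ^ 2 := by
    intro a b c d ha hb hac hcb hs
    have hab := hac.trans hcb
    have hdc : ContinuousOn d (Icc a b) := by
      have := hs.ac.continuousOn; rwa [uIcc_of_le hab] at this
    have i1 : IntervalIntegrable (fun t => Q⁻¹ * d t ^ 2) volume a b :=
      ((hdc.pow 2).intervalIntegrable_of_Icc hab).const_mul _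
    have i2 : IntervalIntegrable (fun t => Q * u t ^ 2) volume a b :=
      (intervalIntegrable_sub hu2 ⟨ha, hab.trans hb⟩ ⟨ha.trans hab, hb⟩).const_mul _
    have hs' := hs.mono le_rfl hac hcb
    obtain ⟨j1, j2⟩ := integral_eq_sub_of_absolutelyContinuous (f := fun t => u t * u t)
      (g := fun t => d t * u t + u t * d t) hac ((hs'.ac_self hac).mul (hs'.ac_self hac))
      (Eventually.of_forall fun t ht => (hs'.hasDerivAt ht).mul (hs'.hasDerivAt ht))
    rw [← intervalIntegral.integral_const_mul, ← intervalIntegral.integral_const_mul,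
      ← intervalIntegral.integral_add i1 i2]
    -- The inequality is (u²)' = 2 u u' ≤ Q⁻¹ u'² + Q u², integrated.
    calc u c ^ 2 - u a ^ 2 = ∫ t in a..c, (d t * u t + u t * d t) := by rw [j2]; ring
      _ ≤ ∫ t in a..c, (Q⁻¹ * d t ^ 2 + Q * u t ^ 2) := by
          refine intervalIntegral.integral_mono_on hac j1 ((i1.add i2).mono_set ?_) ?_
          · rw [uIcc_of_le hac, uIcc_of_le hab]; exact Icc_subset_Icc_right hcb
          · intro t _
            have h1 : Q⁻¹ * d t ^ 2 + Q * u t ^ 2 - (d t * u t + u t * d t)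
                = Q⁻¹ * (d t - Q * u t) ^ 2 := by field_simp; ring
            have h2 : 0 ≤ Q⁻¹ * (d t - Q * u t) ^ 2 := by positivity
            linarith
      _ ≤ ∫ t in a..b, (Q⁻¹ * d t ^ 2 + Q * u t ^ 2) := by
          refine intervalIntegral.integral_mono_interval le_rfl hac hcb ?_ (i1.add i2)
          exact Eventually.of_forall fun t => by simp only [Pi.zero_apply]; positivity
  have hsplit : ∫ t in (0 : ℝ)..1, u t ^ 2 = (∫ t in (0 : ℝ)..α, u t ^ 2) + ∫ t in α..1, u t ^ 2 :=
    (intervalIntegral.integral_add_adjacent_intervals (intervalIntegrable_sub hu2 (by simp) hαm)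
      (intervalIntegrable_sub hu2 hαm (by simp))).symm
  have n1 : 0 ≤ ∫ t in α..1, du₂ t ^ 2 :=
    intervalIntegral.integral_nonneg hα.2.le fun t _ => sq_nonneg _
  have n2 : 0 ≤ ∫ t in α..1, u t ^ 2 :=
    intervalIntegral.integral_nonneg hα.2.le fun t _ => sq_nonneg _
  have hQi : 0 < Q⁻¹ := inv_pos.2 hQ
  have m1 := mul_nonneg hQi.le n1
  have m2 := mul_nonneg hQ.le n2
  have hz := hu.zero
  rw [hsplit]
  rcases le_total x α with hxα | hxα
  · have := piece le_rfl hα.2.le hx.1 hxα hu.left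
    rw [hz] at this
    nlinarith
  · have h1 := piece le_rfl hα.2.le hα.1.le le_rfl hu.left
    have h2 := piece hα.1.le le_rfl hxα hx.2 hu.right
    rw [hz] at h1
    nlinarith

/-- If the integral were zero, u would vanish on [0,α], against u'(0) = 1. This nondegeneracy is
behind the simplicity of the eigenvalues. -/
theorem IsIVP.integral_sq_pos {α β : ℝ} {p u du₁ du₂ : ℝ → ℝ} (hα : α ∈ Ioo (0 : ℝ) 1)
    (hu : IsIVP α β p u du₁ du₂) : 0 < ∫ t in (0 : ℝ)..1, u t ^ 2 := by
  refine intervalIntegral.integral_pos zero_lt_one ((hu.continuousOn hα).pow 2)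
    (fun _ _ => sq_nonneg _) ?_
  by_contra! hcon
  have hz : ∀ x ∈ Icc (0 : ℝ) α, u x = 0 := fun x hx =>
    pow_eq_zero_iff two_ne_zero |>.1
      (le_antisymm (hcon x ⟨hx.1, hx.2.trans hα.2.le⟩) (sq_nonneg _))
  have h0 : (0 : ℝ) ∈ Icc 0 α := left_mem_Icc.2 hα.1.le
  have h1 : HasDerivWithinAt u 0 (Icc 0 α) 0 :=
    (hasDerivWithinAt_const 0 (Icc 0 α) (0 : ℝ)).congr hz (hz 0 h0)
  have := (uniqueDiffOn_Icc hα.1 0 h0).eq_deriv _ h1 (hu.left.deriv 0 h0)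
  rw [hu.slope] at this
  exact zero_ne_one this

theorem SolvesOn.continuousOn_deriv {a b : ℝ} {p u du : ℝ → ℝ} (h : SolvesOn a b p u du)
    (hab : a ≤ b) : ContinuousOn du (Icc a b) := by
  have := h.ac.continuousOn
  rwa [uIcc_of_le hab] at this

/-- The energy identity for eigenfunctions. -/
theorem IsIVP.energy {α β : ℝ} {p u du₁ du₂ : ℝ → ℝ} (hα : α ∈ Ioo (0 : ℝ) 1)
    (hp : IntervalIntegrable p volume 0 1)
    (hu : IsIVP α β p u du₁ du₂) (h1 : u 1 = 0) :
    ((∫ t in (0 : ℝ)..α, du₁ t ^ 2) + ∫ t in α..1, du₂ t ^ 2) + β * u α ^ 2 +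
      ∫ t in (0 : ℝ)..1, p t * u t ^ 2 = 0 := by
  have hαm : α ∈ Icc (0 : ℝ) 1 := Ioo_subset_Icc_self hα
  have hpu : IntervalIntegrable (fun t => p t * u t ^ 2) volume 0 1 :=
    intervalIntegrable_mul_continuousOn hp ((hu.continuousOn hα).pow 2)
  have e1 := (hu.left.energy hα.1.le).2
  have e2 := (hu.right.energy hα.2.le).2
  have i1 : IntervalIntegrable (fun t => du₁ t ^ 2) volume 0 α :=
    ((hu.left.continuousOn_deriv hα.1.le).pow 2).intervalIntegrable_of_Icc hα.1.le
  have i2 : IntervalIntegrable (fun t => du₂ t ^ 2) volume α 1 :=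
    ((hu.right.continuousOn_deriv hα.2.le).pow 2).intervalIntegrable_of_Icc hα.2.le
  rw [intervalIntegral.integral_add i1 (intervalIntegrable_sub hpu (by simp) hαm)] at e1
  rw [intervalIntegral.integral_add i2 (intervalIntegrable_sub hpu hαm (by simp))] at e2
  rw [← intervalIntegral.integral_add_adjacent_intervals
    (intervalIntegrable_sub hpu (by simp) hαm) (intervalIntegrable_sub hpu hαm (by simp))]
  rw [hu.zero] at e1
  rw [h1] at e2
  linear_combination e1 + e2 - u α * hu.jump

/-- With E = ∫ u'² and N = ∫ u², the Sobolev inequality gives |∫ t q u²| ≤ ‖q‖ (Q⁻¹ E + Q N) ≤ E +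
Q² N, and E cancels in the energy identity. The bound does not depend on t, so no eigenvalue escapes
to -∞ along the homotopy. -/
theorem IsIVP.neg_sq_le {α β t μ Q : ℝ} {q u du₁ du₂ : ℝ → ℝ} (hα : α ∈ Ioo (0 : ℝ) 1)
    (hβ : 0 ≤ β) (hq : IntervalIntegrable q volume 0 1) (ht : |t| ≤ 1) (hQ : 0 < Q)
    (hqQ : normL1 q ≤ Q)
    (hu : IsIVP α β (fun x => t * q x - μ) u du₁ du₂) (h1 : u 1 = 0) : -Q ^ 2 ≤ μ := by
  have hp : IntervalIntegrable (fun x => t * q x - μ) volume 0 1 :=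
    (hq.const_mul t).sub intervalIntegrable_const
  have huc := hu.continuousOn hα
  have he := hu.energy hα hp h1
  have hN := hu.integral_sq_pos hα
  set E := (∫ t in (0 : ℝ)..α, du₁ t ^ 2) + ∫ t in α..1, du₂ t ^ 2 with hE
  set N := ∫ t in (0 : ℝ)..1, u t ^ 2 with hNdef
  have i1 : IntervalIntegrable (fun x => t * q x * u x ^ 2) volume 0 1 :=
    intervalIntegrable_mul_continuousOn (hq.const_mul t) (huc.pow 2)
  have i2 : IntervalIntegrable (fun x => u x ^ 2) volume 0 1 :=
    (huc.pow 2).intervalIntegrable_of_Icc zero_le_one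
  have hsplit : ∫ x in (0 : ℝ)..1, (t * q x - μ) * u x ^ 2 =
      (∫ x in (0 : ℝ)..1, t * q x * u x ^ 2) - μ * N := by
    rw [hNdef, ← intervalIntegral.integral_const_mul,
      ← intervalIntegral.integral_sub i1 (i2.const_mul μ)]
    exact intervalIntegral.integral_congr fun x _ => by ring
  have hE0 : 0 ≤ E := add_nonneg
    (intervalIntegral.integral_nonneg hα.1.le fun _ _ => sq_nonneg _)
    (intervalIntegral.integral_nonneg hα.2.le fun _ _ => sq_nonneg _)
  have hS : 0 ≤ Q⁻¹ * E + Q * N := by positivity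
  have hb : ‖∫ x in (0 : ℝ)..1, t * q x * u x ^ 2‖ ≤ ∫ x in (0 : ℝ)..1, |q x| * (Q⁻¹ * E + Q * N) := by
    refine intervalIntegral.norm_integral_le_of_norm_le zero_le_one
      (Eventually.of_forall fun x hx => ?_) (hq.abs.mul_const _)
    have := hu.sq_le hα hQ (Ioc_subset_Icc_self hx)
    rw [Real.norm_eq_abs, abs_mul, abs_mul, abs_of_nonneg (sq_nonneg (u x))]
    exact mul_le_mul (mul_le_of_le_one_left (abs_nonneg _) ht) this (sq_nonneg _) (abs_nonneg _)
  rw [intervalIntegral.integral_mul_const] at hb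
  have hb2 : normL1 q * (Q⁻¹ * E + Q * N) ≤ E + Q ^ 2 * N := by
    calc _ ≤ Q * (Q⁻¹ * E + Q * N) := mul_le_mul_of_nonneg_right hqQ hS
      _ = _ := by field_simp
  have hb3 := (abs_le.1 (hb.trans hb2)).1
  rw [hsplit] at he
  have hbu : 0 ≤ β * u α ^ 2 := by positivity
  by_contra! hcon
  nlinarith

theorem IsIVP.pos_of_potential_zero {α β μ : ℝ} {u du₁ du₂ : ℝ → ℝ} (hα : α ∈ Ioo (0 : ℝ) 1)
    (hβ : 0 ≤ β) (hu : IsIVP α β (fun _ => -μ) u du₁ du₂) (h1 : u 1 = 0) : 0 < μ := by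
  have huc := hu.continuousOn hα
  have he := hu.energy hα intervalIntegrable_const h1
  have hN := hu.integral_sq_pos hα
  -- With Q = 1/2, integration over [0,1] gives N ≤ 2 E + N/2, so E > 0, and the energy identity
  -- reads μ N = E + β u(α)².
  have hS := fun x (hx : x ∈ Icc (0 : ℝ) 1) => hu.sq_le hα (Q := 1 / 2) (by norm_num) hx
  set E := (∫ t in (0 : ℝ)..α, du₁ t ^ 2) + ∫ t in α..1, du₂ t ^ 2 with hE
  set N := ∫ t in (0 : ℝ)..1, u t ^ 2 with hNdef
  rw [intervalIntegral.integral_const_mul] at he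
  have i2 : IntervalIntegrable (fun x => u x ^ 2) volume 0 1 :=
    (huc.pow 2).intervalIntegrable_of_Icc zero_le_one
  have hle : N ≤ ∫ x in (0 : ℝ)..1, ((1 / 2 : ℝ)⁻¹ * E + 1 / 2 * N) :=
    intervalIntegral.integral_mono_on zero_le_one i2 intervalIntegrable_const hS
  simp only [intervalIntegral.integral_const, sub_zero, one_smul] at hle
  have hbu : 0 ≤ β * u α ^ 2 := by positivity
  by_contra! hcon
  have : μ * N ≤ 0 := mul_nonpos_of_nonpos_of_nonneg hcon hN.le
  change _ + -μ * N = 0 at he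
  nlinarith

/-! ### The Volterra operator on C[0,1] and continuous dependence on parameters. -/

theorem abs_sin_div_le {y z : ℝ} (hy : 0 < y) : |Real.sin (y * z) / y| ≤ |z| := by
  rw [abs_div, abs_of_pos hy, div_le_iff₀ hy]
  calc |Real.sin (y * z)| ≤ |y * z| := Real.abs_sin_le_abs
    _ = |z| * y := by rw [abs_mul, abs_of_pos hy, mul_comm]

/-- The source of factorial decay. The gain 1/(k+1) comes pointwise from the vanishing of the kernel
on the diagonal, so q need only be integrable, and the delta term, an evaluation at ξ = α, obeys the
same bound. -/
theorem sub_mul_pow_le {x ξ : ℝ} (k : ℕ) (hξ : 0 ≤ ξ) (hx : ξ ≤ x) :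
    (x - ξ) * ξ ^ k ≤ x ^ (k + 1) / (k + 1) := by
  rw [le_div_iff₀ (by positivity)]
  induction k with
  | zero => simp; linarith
  | succ k ih =>
    have h1 : ξ ^ (k + 1) ≤ x ^ (k + 1) := pow_le_pow_left₀ hξ hx _
    have h2 : (x - ξ) * ξ ^ (k + 1) * ((k + 1 : ℕ) + 1) =
        ξ * ((x - ξ) * ξ ^ k * (k + 1)) + (x - ξ) * ξ ^ (k + 1) := by push_cast; ring
    rw [h2]
    calc _ ≤ ξ * x ^ (k + 1) + (x - ξ) * x ^ (k + 1) :=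
          add_le_add (mul_le_mul_of_nonneg_left ih hξ)
            (mul_le_mul_of_nonneg_left h1 (by linarith))
      _ = x ^ (k + 1 + 1) := by ring

theorem abs_integral_kernel_le {y A x : ℝ} {p w : ℝ → ℝ} (hy : 0 < y)
    (hp : IntervalIntegrable p volume 0 1) (hA : 0 ≤ A) (k : ℕ) (hx : x ∈ Icc (0 : ℝ) 1)
    (hw : ∀ ξ ∈ Icc (0 : ℝ) 1, |w ξ| ≤ A * ξ ^ k) :
    |∫ ξ in (0 : ℝ)..x, Real.sin (y * (x - ξ)) / y * (p ξ * w ξ)| ≤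
      A * normL1 p * (x ^ (k + 1) / (k + 1)) := by
  have hxk : 0 ≤ x ^ (k + 1) / ((k : ℝ) + 1) := div_nonneg (pow_nonneg hx.1 _) (by positivity)
  have h1 : ‖∫ ξ in (0 : ℝ)..x, Real.sin (y * (x - ξ)) / y * (p ξ * w ξ)‖ ≤
      ∫ ξ in (0 : ℝ)..x, A * (x ^ (k + 1) / (k + 1)) * |p ξ| := by
    refine intervalIntegral.norm_integral_le_of_norm_le hx.1
      (Eventually.of_forall fun ξ hξ => ?_)
      ((intervalIntegrable_sub hp (by simp) hx).abs.const_mul _)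
    have hξ1 : ξ ∈ Icc (0 : ℝ) 1 := ⟨hξ.1.le, hξ.2.trans hx.2⟩
    rw [Real.norm_eq_abs, abs_mul, abs_mul]
    have a1 : |Real.sin (y * (x - ξ)) / y| ≤ x - ξ :=
      (abs_sin_div_le hy).trans_eq (abs_of_nonneg (by linarith [hξ.2]))
    calc _ ≤ (x - ξ) * (|p ξ| * (A * ξ ^ k)) :=
          mul_le_mul a1 (mul_le_mul_of_nonneg_left (hw ξ hξ1) (abs_nonneg _)) (by positivity)
            (by linarith [hξ.2])
      _ = A * ((x - ξ) * ξ ^ k) * |p ξ| := by ring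
      _ ≤ _ := by
        gcongr
        exact sub_mul_pow_le k hξ.1.le hξ.2
  refine h1.trans ?_
  rw [intervalIntegral.integral_const_mul]
  calc _ ≤ A * (x ^ (k + 1) / (k + 1)) * normL1 p := by
        refine mul_le_mul_of_nonneg_left ?_ (mul_nonneg hA hxk)
        exact intervalIntegral.integral_mono_interval le_rfl hx.1 hx.2
          (Eventually.of_forall fun _ => abs_nonneg _) hp.abs
    _ = _ := by ring

theorem abs_delta_kernel_le {y A α β x : ℝ} {w : ℝ → ℝ} (hy : 0 < y) (hα : α ∈ Ioo (0 : ℝ) 1)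
    (hβ : 0 ≤ β) (hA : 0 ≤ A) (k : ℕ) (hx : x ∈ Icc (0 : ℝ) 1)
    (hw : ∀ ξ ∈ Icc (0 : ℝ) 1, |w ξ| ≤ A * ξ ^ k) :
    |β * (Real.sin (y * max (x - α) 0) / y) * w α| ≤ A * β * (x ^ (k + 1) / (k + 1)) := by
  have hxk : 0 ≤ x ^ (k + 1) / ((k : ℝ) + 1) := div_nonneg (pow_nonneg hx.1 _) (by positivity)
  rw [abs_mul, abs_mul, abs_of_nonneg hβ]
  rcases le_total x α with h | h
  · rw [max_eq_right (by linarith)]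
    simpa using mul_nonneg (mul_nonneg hA hβ) hxk
  · rw [max_eq_left (by linarith)]
    have a1 : |Real.sin (y * (x - α)) / y| ≤ x - α :=
      (abs_sin_div_le hy).trans_eq (abs_of_nonneg (by linarith))
    calc _ ≤ β * (x - α) * (A * α ^ k) :=
          mul_le_mul (mul_le_mul_of_nonneg_left a1 hβ) (hw α (Ioo_subset_Icc_self hα))
            (abs_nonneg _) (mul_nonneg hβ (by linarith))
      _ = A * β * ((x - α) * α ^ k) := by ring
      _ ≤ _ := mul_le_mul_of_nonneg_left (sub_mul_pow_le k hα.1.le h) (mul_nonneg hA hβ)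

theorem continuousOn_integral_kernel {y : ℝ} {F : ℝ → ℝ} (hF : IntervalIntegrable F volume 0 1) :
    ContinuousOn (fun x => ∫ ξ in (0 : ℝ)..x, Real.sin (y * (x - ξ)) / y * F ξ) (Icc 0 1) := by
  have hm : (0 : ℝ) ∈ uIcc (0 : ℝ) 1 := left_mem_uIcc
  have hc : IntervalIntegrable (fun ξ => Real.cos (y * ξ) * F ξ) volume 0 1 :=
    hF.continuousOn_mul (by fun_prop)
  have hs : IntervalIntegrable (fun ξ => Real.sin (y * ξ) * F ξ) volume 0 1 :=
    hF.continuousOn_mul (by fun_prop)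
  have h1 := (hc.absolutelyContinuousOnInterval_intervalIntegral hm).continuousOn
  have h2 := (hs.absolutelyContinuousOnInterval_intervalIntegral hm).continuousOn
  rw [uIcc_of_le zero_le_one] at h1 h2
  have h3 : ContinuousOn (fun x => Real.sin (y * x) / y * (∫ ξ in (0 : ℝ)..x, Real.cos (y * ξ) * F ξ) -
        Real.cos (y * x) / y * ∫ ξ in (0 : ℝ)..x, Real.sin (y * ξ) * F ξ) (Icc 0 1) :=
    ((by fun_prop : Continuous fun x => Real.sin (y * x) / y).continuousOn.mul h1).sub
      ((by fun_prop : Continuous fun x => Real.cos (y * x) / y).continuousOn.mul h2)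
  exact h3.congr fun x hx => integral_sin_sub (intervalIntegrable_sub hF (by simp) hx)

/-- The constant extension of a continuous function on `[0,1]`. -/
noncomputable abbrev ext (u : C(Icc (0 : ℝ) 1, ℝ)) : ℝ → ℝ := IccExtend zero_le_one u

theorem continuous_ext (u : C(Icc (0 : ℝ) 1, ℝ)) : Continuous (ext u) := u.continuous.Icc_extend'

theorem abs_ext_le (u : C(Icc (0 : ℝ) 1, ℝ)) (x : ℝ) : |ext u x| ≤ ‖u‖ := u.norm_coe_le_norm _

theorem ext_coe (u : C(Icc (0 : ℝ) 1, ℝ)) (x : Icc (0 : ℝ) 1) : ext u x = u x :=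
  IccExtend_val _ _ _

theorem continuous_integral_kernel {y : ℝ} {F : ℝ → ℝ} (hF : IntervalIntegrable F volume 0 1) :
    Continuous fun x : Icc (0 : ℝ) 1 =>
      ∫ ξ in (0 : ℝ)..x, Real.sin (y * (x - ξ)) / y * F ξ :=
  (continuousOn_integral_kernel hF).comp_continuous continuous_subtype_val fun x => x.2

/-- The integral operator `u ↦ ∫₀ˣ sin(y(x-ξ))/y p(ξ) u(ξ) dξ` on `C[0,1]`. -/
noncomputable def integralOp (y : ℝ) (hy : 0 < y) (p : ℝ → ℝ) (hp : IntervalIntegrable p volume 0 1) :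
    C(Icc (0 : ℝ) 1, ℝ) →L[ℝ] C(Icc (0 : ℝ) 1, ℝ) :=
  LinearMap.mkContinuous
    { toFun := fun u =>
        ⟨fun x => ∫ ξ in (0 : ℝ)..x, Real.sin (y * (x - ξ)) / y * (p ξ * ext u ξ),
          continuous_integral_kernel
            (intervalIntegrable_mul_continuousOn hp (continuous_ext u).continuousOn)⟩
      map_add' := by
        intro u v
        ext x
        have hint : ∀ w : C(Icc (0 : ℝ) 1, ℝ), IntervalIntegrable
            (fun ξ => Real.sin (y * (x - ξ)) / y * (p ξ * ext w ξ)) volume 0 x := fun w =>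
          intervalIntegrable_sub ((intervalIntegrable_mul_continuousOn hp
            (continuous_ext w).continuousOn).continuousOn_mul (by fun_prop)) (by simp) x.2
        simp only [ContinuousMap.add_apply, ContinuousMap.coe_mk]
        rw [← intervalIntegral.integral_add (hint u) (hint v)]
        refine intervalIntegral.integral_congr fun ξ _ => ?_
        simp only [ext, IccExtend, Function.comp_apply, ContinuousMap.add_apply]
        ring
      map_smul' := by
        intro c u
        ext x
        simp only [ContinuousMap.smul_apply, ContinuousMap.coe_mk, smul_eq_mul, RingHom.id_apply]
        rw [← intervalIntegral.integral_const_mul]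
        refine intervalIntegral.integral_congr fun ξ _ => ?_
        simp only [ext, IccExtend, Function.comp_apply, ContinuousMap.smul_apply, smul_eq_mul]
        ring } (normL1 p) (by
    intro u
    have hN : 0 ≤ normL1 p := intervalIntegral.integral_nonneg zero_le_one fun _ _ => abs_nonneg _
    rw [ContinuousMap.norm_le _ (mul_nonneg hN (norm_nonneg _))]
    intro x
    refine (abs_integral_kernel_le hy hp (norm_nonneg u) 0 x.2
      (fun ξ _ => by simpa using abs_ext_le u ξ)).trans ?_
    have := x.2.2
    have h2 := mul_nonneg hN (norm_nonneg u)
    simp only [Nat.cast_zero, zero_add, pow_one, div_one]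
    nlinarith)

theorem integralOp_apply {y : ℝ} (hy : 0 < y) {p : ℝ → ℝ} (hp : IntervalIntegrable p volume 0 1)
    (u : C(Icc (0 : ℝ) 1, ℝ)) (x : Icc (0 : ℝ) 1) :
    integralOp y hy p hp u x =
      ∫ ξ in (0 : ℝ)..x, Real.sin (y * (x - ξ)) / y * (p ξ * ext u ξ) := rfl

/-- The function `β sin(y (x-α)⁺)/y` on `[0,1]`. -/
noncomputable def deltaKernel (α β y : ℝ) : C(Icc (0 : ℝ) 1, ℝ) :=
  ⟨fun x => β * (Real.sin (y * max ((x : ℝ) - α) 0) / y), by fun_prop⟩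

/-- The rank one operator produced by the delta potential. -/
noncomputable def deltaOp (α β y : ℝ) (hα : α ∈ Icc (0 : ℝ) 1) :
    C(Icc (0 : ℝ) 1, ℝ) →L[ℝ] C(Icc (0 : ℝ) 1, ℝ) :=
  (ContinuousMap.evalCLM ℝ (⟨α, hα⟩ : Icc (0 : ℝ) 1)).smulRight (deltaKernel α β y)

/-- The Volterra operator of `u'' = (t q - μ + β δ(x - α)) u` relative to `u'' + y² u`. -/
noncomputable def volterraOp (α β y : ℝ) (hα : α ∈ Icc (0 : ℝ) 1) (hy : 0 < y) (q : ℝ → ℝ)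
    (hq : IntervalIntegrable q volume 0 1) (μ t : ℝ) :
    C(Icc (0 : ℝ) 1, ℝ) →L[ℝ] C(Icc (0 : ℝ) 1, ℝ) :=
  t • integralOp y hy q hq + (y ^ 2 - μ) • integralOp y hy (fun _ => 1) intervalIntegrable_const +
    deltaOp α β y hα

section

variable {α β y : ℝ} {q : ℝ → ℝ}

theorem volterraOp_apply (hα : α ∈ Icc (0 : ℝ) 1) (hy : 0 < y)
    (hq : IntervalIntegrable q volume 0 1) (μ t : ℝ) (u : C(Icc (0 : ℝ) 1, ℝ))
    (x : Icc (0 : ℝ) 1) :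
    volterraOp α β y hα hy q hq μ t u x =
      (∫ ξ in (0 : ℝ)..x, Real.sin (y * (x - ξ)) / y * ((t * q ξ - μ + y ^ 2) * ext u ξ)) +
        β * (Real.sin (y * max (x - α) 0) / y) * ext u α := by
  have hint : ∀ {p : ℝ → ℝ}, IntervalIntegrable p volume 0 1 → IntervalIntegrable
      (fun ξ => Real.sin (y * (x - ξ)) / y * (p ξ * ext u ξ)) volume 0 x := fun hp =>
    intervalIntegrable_sub ((intervalIntegrable_mul_continuousOn hp
      (continuous_ext u).continuousOn).continuousOn_mul (by fun_prop)) (by simp) x.2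
  have h1 : (∫ ξ in (0 : ℝ)..x, Real.sin (y * (x - ξ)) / y * ((t * q ξ - μ + y ^ 2) * ext u ξ)) =
      t * integralOp y hy q hq u x +
        (y ^ 2 - μ) * integralOp y hy (fun _ => 1) intervalIntegrable_const u x := by
    rw [integralOp_apply, integralOp_apply, ← intervalIntegral.integral_const_mul,
      ← intervalIntegral.integral_const_mul, ← intervalIntegral.integral_add
      ((hint hq).const_mul _) ((hint intervalIntegrable_const).const_mul _)]
    refine intervalIntegral.integral_congr fun ξ _ => ?_
    ring
  have h2 : ext u α = u ⟨α, hα⟩ := ext_coe u ⟨α, hα⟩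
  rw [h1, h2]
  simp [volterraOp, deltaOp, deltaKernel, mul_comm]

/-- Each application turns a bound A ξᵏ into A N xᵏ⁺¹/(k+1), where N adds the L¹-norm of the
potential and the weight β of the delta term. -/
theorem abs_volterraOp_pow_apply_le (hα : α ∈ Ioo (0 : ℝ) 1) (hβ : 0 ≤ β) (hy : 0 < y)
    (hq : IntervalIntegrable q volume 0 1) (μ t : ℝ) (u : C(Icc (0 : ℝ) 1, ℝ)) (k : ℕ)
    (x : Icc (0 : ℝ) 1) :
    |(volterraOp α β y (Ioo_subset_Icc_self hα) hy q hq μ t ^ k) u x| ≤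
      ‖u‖ * ((normL1 (fun x => t * q x - μ + y ^ 2) + β) ^ k / k.factorial) * (x : ℝ) ^ k := by
  set N := normL1 (fun x => t * q x - μ + y ^ 2) + β with hN
  have hN0 : 0 ≤ N := add_nonneg
    (intervalIntegral.integral_nonneg zero_le_one fun _ _ => abs_nonneg _) hβ
  have hp : IntervalIntegrable (fun x => t * q x - μ + y ^ 2) volume 0 1 :=
    ((hq.const_mul t).sub intervalIntegrable_const).add intervalIntegrable_const
  induction k generalizing x with
  | zero => simpa using u.norm_coe_le_norm x
  | succ k ih =>
    set w := (volterraOp α β y (Ioo_subset_Icc_self hα) hy q hq μ t ^ k) u with hw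
    have hA : 0 ≤ ‖u‖ * (N ^ k / k.factorial) := by positivity
    have hwb : ∀ ξ ∈ Icc (0 : ℝ) 1, |ext w ξ| ≤ ‖u‖ * (N ^ k / k.factorial) * ξ ^ k := by
      intro ξ hξ
      have := ih ⟨ξ, hξ⟩
      rwa [← ext_coe] at this
    rw [pow_succ', mul_apply_eq_comp, ← hw, volterraOp_apply]
    refine (abs_add_le _ _).trans ((add_le_add (abs_integral_kernel_le hy hp hA k x.2 hwb)
      (abs_delta_kernel_le hy hα hβ hA k x.2 hwb)).trans_eq ?_)
    rw [Nat.factorial_succ, ← add_mul, ← mul_add, ← hN]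
    push_cast
    field_simp
    ring

/-- Some power Tᵏ has norm less than 1, so 1 - Tᵏ is invertible; it is the product of the commuting
factors 1 - T and ∑ Tⁱ, hence 1 - T is invertible too. -/
theorem isUnit_one_sub_volterraOp (hα : α ∈ Ioo (0 : ℝ) 1) (hβ : 0 ≤ β) (hy : 0 < y)
    (hq : IntervalIntegrable q volume 0 1) (μ t : ℝ) :
    IsUnit (1 - volterraOp α β y (Ioo_subset_Icc_self hα) hy q hq μ t) := by
  set T := volterraOp α β y (Ioo_subset_Icc_self hα) hy q hq μ t with hT
  set N := normL1 (fun x => t * q x - μ + y ^ 2) + β with hN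
  have hN0 : 0 ≤ N := add_nonneg
    (intervalIntegral.integral_nonneg zero_le_one fun _ _ => abs_nonneg _) hβ
  obtain ⟨k, hk⟩ := ((FloorSemiring.tendsto_pow_div_factorial_atTop N).eventually
    (gt_mem_nhds zero_lt_one)).exists
  have hle : ‖T ^ k‖ < 1 := by
    refine lt_of_le_of_lt (ContinuousLinearMap.opNorm_le_bound _ (by positivity) fun u => ?_) hk
    rw [ContinuousMap.norm_le _ (by positivity)]
    intro x
    refine (abs_volterraOp_pow_apply_le hα hβ hy hq μ t u k x).trans ?_
    rw [mul_comm ‖u‖]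
    exact mul_le_of_le_one_right (by positivity) (pow_le_one₀ x.2.1 x.2.2)
  have h1 := isUnit_one_sub_of_norm_lt_one
    (R := C(Icc (0 : ℝ) 1, ℝ) →L[ℝ] C(Icc (0 : ℝ) 1, ℝ)) hle
  have hc : Commute (1 - T) (∑ i ∈ Finset.range k, T ^ i) := by
    rw [Commute, SemiconjBy, mul_neg_geom_sum, geom_sum_mul_neg]
  rw [← mul_neg_geom_sum, hc.isUnit_mul_iff] at h1
  exact h1.1

/-- Existence, uniqueness, and continuous dependence on the parameters. -/
theorem exists_continuous_solution (hα : α ∈ Ioo (0 : ℝ) 1) (hβ : 0 ≤ β) (hy : 0 < y)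
    (hq : IntervalIntegrable q volume 0 1) :
    ∃ Φ : ℝ × ℝ → C(Icc (0 : ℝ) 1, ℝ), Continuous Φ ∧
      (∀ μ t, IsVolterra α β y (fun x => t * q x - μ) (ext (Φ (μ, t)))) ∧
      ∀ μ t u, ContinuousOn u (Icc 0 1) → IsVolterra α β y (fun x => t * q x - μ) u →
        ∀ x ∈ Icc (0 : ℝ) 1, u x = ext (Φ (μ, t)) x := by
  have hαm : α ∈ Icc (0 : ℝ) 1 := Ioo_subset_Icc_self hα
  set s : C(Icc (0 : ℝ) 1, ℝ) := ⟨fun x => Real.sin (y * x) / y, by fun_prop⟩ with hs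
  have hunit := isUnit_one_sub_volterraOp hα hβ hy hq
  set T := volterraOp α β y hαm hy q hq with hT
  have hTc : Continuous fun z : ℝ × ℝ => 1 - T z.1 z.2 := by
    simp only [hT, volterraOp]
    fun_prop
  refine ⟨fun z => Ring.inverse (1 - T z.1 z.2) s, ?_, ?_, ?_⟩
  · refine Continuous.clm_apply (continuous_iff_continuousAt.2 fun z => ?_) continuous_const
    obtain ⟨U, hU⟩ := hunit z.1 z.2
    -- T is affine in (μ, t) and inversion is continuous at units; this is all that continuous
    -- dependence needs.
    have := NormedRing.inverse_continuousAt
      (R := C(Icc (0 : ℝ) 1, ℝ) →L[ℝ] C(Icc (0 : ℝ) 1, ℝ)) U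
    rw [hU] at this
    exact ContinuousAt.comp (f := fun z : ℝ × ℝ => 1 - T z.1 z.2) this hTc.continuousAt
  · intro μ t x hx
    set v := Ring.inverse (1 - T μ t) s with hv
    have h1 : (1 - T μ t) v = s := by
      rw [hv, ← mul_apply_eq_comp, Ring.mul_inverse_cancel _ (hunit μ t)]
      rfl
    have h2 : v ⟨x, hx⟩ - T μ t v ⟨x, hx⟩ = Real.sin (y * x) / y :=
      DFunLike.congr_fun h1 (⟨x, hx⟩ : Icc (0 : ℝ) 1)
    have h3 : ext v x = v ⟨x, hx⟩ := ext_coe v ⟨x, hx⟩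
    rw [hT, volterraOp_apply] at h2
    rw [h3]
    linarith
  · intro μ t u hu hV x hx
    set w : C(Icc (0 : ℝ) 1, ℝ) := ⟨fun x => u x,
      hu.comp_continuous continuous_subtype_val fun x => x.2⟩ with hw
    have hwu : ∀ x ∈ Icc (0 : ℝ) 1, u x = ext w x := fun x hx => (ext_coe w ⟨x, hx⟩).symm
    have hV' := IsVolterra.congr hα hwu hV
    have h1 : (1 - T μ t) w = s := by
      ext x
      have := hV' x x.2
      change w x - T μ t w x = Real.sin (y * x) / y
      rw [hT, volterraOp_apply, ← ext_coe w x]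
      linarith
    have h2 : w = Ring.inverse (1 - T μ t) s := by
      rw [← h1, ← mul_apply_eq_comp, Ring.inverse_mul_cancel _ (hunit μ t)]
      rfl
    rw [hwu x hx, h2]

end

/-! ### Counting zeros along a homotopy. -/

/-- Cardinalities are handled through injective tuples because these pass to limits by compactness
and to nearby parameters by persistence of zeros. -/
theorem natCast_le_encard_iff {k : ℕ} {s : Set ℝ} :
    (k : ℕ∞) ≤ s.encard ↔ ∃ z : Fin k → ℝ, Function.Injective z ∧ ∀ i, z i ∈ s := by
  constructor
  · intro h
    obtain ⟨t, hts, htk⟩ := exists_subset_encard_eq h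
    have hfin : t.Finite := finite_of_encard_eq_coe htk
    rw [hfin.encard_eq_coe_toFinset_card] at htk
    have e := (Finset.equivFinOfCardEq (Nat.cast_injective htk)).symm
    exact ⟨fun i => e i, Subtype.val_injective.comp e.injective,
      fun i => hts (hfin.mem_toFinset.1 (e i).2)⟩
  · rintro ⟨z, hz, hzs⟩
    refine le_trans ?_ (encard_le_encard (range_subset_iff.2 hzs))
    simpa using hz.encard_range

section Counting

variable {D : ℝ × ℝ → ℝ}

/-- A change of sign survives a small change of t, and the intermediate value theorem returns a
zero. -/
theorem eventually_exists_zero (hD : Continuous D)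
    (hsign : ∀ μ t, D (μ, t) = 0 → ∀ ε > 0, ∃ a b : ℝ,
      |a - μ| < ε ∧ |b - μ| < ε ∧ D (a, t) < 0 ∧ 0 < D (b, t))
    {μ t : ℝ} (h : D (μ, t) = 0) {ε : ℝ} (hε : 0 < ε) :
    ∀ᶠ s in 𝓝 t, ∃ ν, |ν - μ| < ε ∧ D (ν, s) = 0 := by
  obtain ⟨a, b, ha, hb, hDa, hDb⟩ := hsign μ t h ε hε
  have h1 : ∀ᶠ s in 𝓝 t, D (a, s) < 0 :=
    (by fun_prop : Continuous fun s => D (a, s)).continuousAt.eventually_lt_const hDa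
  have h2 : ∀ᶠ s in 𝓝 t, 0 < D (b, s) :=
    (by fun_prop : Continuous fun s => D (b, s)).continuousAt.eventually_const_lt hDb
  filter_upwards [h1, h2] with s hs1 hs2
  have hc : Continuous fun ν => D (ν, s) := by fun_prop
  obtain ⟨ν, hν, hν0⟩ := intermediate_value_uIcc (hc.continuousOn (s := uIcc a b))
    (show (0 : ℝ) ∈ uIcc (D (a, s)) (D (b, s)) from mem_uIcc.2 (Or.inl ⟨hs1.le, hs2.le⟩))
  refine ⟨ν, ?_, hν0⟩
  rw [abs_lt] at *
  rcases mem_uIcc.1 hν with hν | hν <;> constructor <;> linarith [hν.1, hν.2]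

/-- The number of zeros of `D(·, t)` below a continuous curve of zeros does not depend on `t`. -/
theorem encard_zeros_eq (hD : Continuous D)
    (huniq : ∀ μ t, D (μ, t) = 0 → ∀ᶠ z : ℝ × ℝ × ℝ in 𝓝 (μ, μ, t),
      D (z.1, z.2.2) = 0 → D (z.2.1, z.2.2) = 0 → z.1 = z.2.1)
    (hsign : ∀ μ t, D (μ, t) = 0 → ∀ ε > 0, ∃ a b : ℝ,
      |a - μ| < ε ∧ |b - μ| < ε ∧ D (a, t) < 0 ∧ 0 < D (b, t))
    {L : ℝ} (hbelow : ∀ t ∈ Icc (0 : ℝ) 1, ∀ μ, D (μ, t) = 0 → L ≤ μ)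
    {Λ : unitInterval → ℝ} (hΛ : Continuous Λ) (hΛ0 : ∀ t : unitInterval, D (Λ t, t) = 0) :
    {μ | D (μ, 0) = 0 ∧ μ < Λ 0}.encard = {μ | D (μ, 1) = 0 ∧ μ < Λ 1}.encard := by
  set E : unitInterval → Set ℝ := fun t => {μ | D (μ, t) = 0 ∧ μ < Λ t} with hE
  have hclopen : ∀ k : ℕ, IsClopen {t | (k : ℕ∞) ≤ (E t).encard} := by
    intro k
    constructor
    -- Closed: k distinct zeros below the curve stay in the compact interval [L, B], so a
    -- subsequence converges. By local uniqueness their limits neither collide with each other nor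
    -- lie on Λ.
    · refine IsSeqClosed.isClosed fun t t₀ ht htt => ?_
      simp only [mem_ofPred_eq, natCast_le_encard_iff] at ht ⊢
      choose z hzi hzE using ht
      obtain ⟨B, hB⟩ := isCompact_univ.exists_bound_of_continuousOn hΛ.continuousOn
      have hbox : ∀ m, z m ∈ univ.pi fun _ : Fin k => Icc L B := fun m i _ =>
        ⟨hbelow _ (t m).2 _ (hzE m i).1,
          (hzE m i).2.le.trans ((le_abs_self _).trans (hB (t m) (mem_univ _)))⟩
      obtain ⟨w, -, φ, hφ, hw⟩ := (isCompact_univ_pi fun _ => isCompact_Icc).tendsto_subseq hbox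
      have hwi : ∀ i, Tendsto (fun m => z (φ m) i) atTop (𝓝 (w i)) := fun i =>
        ((continuous_apply i).tendsto w).comp hw
      have htφ : Tendsto (fun m => t (φ m)) atTop (𝓝 t₀) := htt.comp hφ.tendsto_atTop
      have htφ' : Tendsto (fun m => (t (φ m) : ℝ)) atTop (𝓝 t₀) :=
        (continuous_subtype_val.tendsto t₀).comp htφ
      have hΛφ : Tendsto (fun m => Λ (t (φ m))) atTop (𝓝 (Λ t₀)) := (hΛ.tendsto t₀).comp htφ
      have hDw : ∀ i, D (w i, t₀) = 0 := fun i => by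
        refine tendsto_nhds_unique ((hD.tendsto (w i, (t₀ : ℝ))).comp
          ((hwi i).prodMk_nhds htφ')) ?_
        refine tendsto_const_nhds.congr fun m => ?_
        exact ((hzE (φ m) i).1).symm
      refine ⟨w, fun i j hij => ?_, fun i => ⟨hDw i, ?_⟩⟩
      · have h2 : Tendsto (fun m => z (φ m) j) atTop (𝓝 (w i)) := hij ▸ hwi j
        obtain ⟨m, hm⟩ := (((hwi i).prodMk_nhds (h2.prodMk_nhds htφ')).eventually
          (huniq _ _ (hDw i))).exists
        exact hzi _ (hm (hzE (φ m) i).1 (hzE (φ m) j).1)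
      · have hle : w i ≤ Λ t₀ := le_of_tendsto_of_tendsto' (hwi i) hΛφ fun m => (hzE _ i).2.le
        refine lt_of_le_of_ne hle fun heq => ?_
        have h2 : Tendsto (fun m => Λ (t (φ m))) atTop (𝓝 (w i)) := heq ▸ hΛφ
        obtain ⟨m, hm⟩ := (((hwi i).prodMk_nhds (h2.prodMk_nhds htφ')).eventually
          (huniq _ _ (hDw i))).exists
        exact (hzE (φ m) i).2.ne (hm (hzE (φ m) i).1 (hΛ0 _))
    -- Open: every zero persists within distance ε. Taking 2ε below all mutual distances and all
    -- gaps to Λ(t₀) keeps the new zeros distinct and below Λ.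
    · rw [isOpen_iff_mem_nhds]
      intro t₀ ht₀
      simp only [mem_ofPred_eq, natCast_le_encard_iff] at ht₀
      obtain ⟨z, hzi, hzE⟩ := ht₀
      have small : ∀ {c : ℝ}, 0 < c → ∀ᶠ ε in 𝓝[>] (0 : ℝ), 2 * ε < c := fun hc =>
        nhdsWithin_le_nhds ((by fun_prop : Continuous fun ε : ℝ => 2 * ε).continuousAt.eventually_lt_const
          (by simpa using hc))
      have h1 : ∀ᶠ ε in 𝓝[>] (0 : ℝ), ∀ i j, i ≠ j → 2 * ε < |z i - z j| := by
        refine eventually_all.2 fun i => eventually_all.2 fun j => ?_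
        by_cases hij : i = j
        · exact Eventually.of_forall fun _ h => absurd hij h
        · exact (small (abs_pos.2 (sub_ne_zero.2 fun h => hij (hzi h)))).mono fun _ h _ => h
      have h2 : ∀ᶠ ε in 𝓝[>] (0 : ℝ), ∀ i, 2 * ε < Λ t₀ - z i :=
        eventually_all.2 fun i => small (sub_pos.2 (hzE i).2)
      obtain ⟨ε, hε1, hε2, hε⟩ := (h1.and (h2.and self_mem_nhdsWithin)).exists
      have hε : 0 < ε := hε
      have h3 : ∀ᶠ t : unitInterval in 𝓝 t₀, ∀ i, ∃ ν, |ν - z i| < ε ∧ D (ν, t) = 0 :=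
        eventually_all.2 fun i => (continuous_subtype_val.tendsto t₀).eventually
          (eventually_exists_zero hD hsign (hzE i).1 hε)
      have h4 : ∀ᶠ t : unitInterval in 𝓝 t₀, ∀ i, z i + ε < Λ t :=
        eventually_all.2 fun i => hΛ.continuousAt.eventually_const_lt (by linarith [hε2 i])
      filter_upwards [h3, h4] with t ht3 ht4
      simp only [natCast_le_encard_iff]
      choose w hw hwD using ht3
      refine ⟨w, fun i j hij => ?_, fun i => ⟨hwD i, ?_⟩⟩
      · by_contra hne
        have a1 := hε1 i j hne
        have a2 := hw i
        have a3 := hw j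
        rw [← hij] at a3
        have : |z i - z j| ≤ |w i - z i| + |w i - z j| := by
          rw [abs_sub_comm (w i) (z i)]
          exact abs_sub_le _ _ _
        linarith
      · linarith [ht4 i, (abs_lt.1 (hw i)).2]
  refine ENat.eq_of_forall_natCast_le_iff fun k => ?_
  -- The unit interval is connected, so each clopen set is empty or everything.
  have key : ∀ t : unitInterval, t ∈ {t | (k : ℕ∞) ≤ (E t).encard} ↔
      (0 : unitInterval) ∈ {t | (k : ℕ∞) ≤ (E t).encard} := by
    intro t
    rcases isClopen_iff.1 (hclopen k) with h | h <;> simp [h]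
  exact (key 1).symm

end Counting

/-! ### The characteristic function of the potentials t q. -/

theorem continuous_integral_mul_ext {Φ : ℝ × ℝ → C(Icc (0 : ℝ) 1, ℝ)} (hΦ : Continuous Φ) :
    Continuous fun z : ℝ × ℝ × ℝ =>
      ∫ x in (0 : ℝ)..1, ext (Φ (z.1, z.2.2)) x * ext (Φ (z.2.1, z.2.2)) x := by
  refine intervalIntegral.continuous_parametric_intervalIntegral_of_continuous' ?_ 0 1
  have h : Continuous fun x : ℝ => projIcc (0 : ℝ) 1 zero_le_one x := continuous_projIcc
  simp only [ext, IccExtend, Function.comp_apply]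
  fun_prop

/-- The characteristic function of the family of potentials `t q`, and its properties. -/
theorem exists_characteristic {α β : ℝ} {q : ℝ → ℝ} (hα : α ∈ Ioo (0 : ℝ) 1) (hβ : 0 ≤ β)
    (hq : IntervalIntegrable q volume 0 1) :
    ∃ D : ℝ × ℝ → ℝ, Continuous D ∧
      (∀ μ t, IsEigenvalue α β (fun x => t * q x) μ ↔ D (μ, t) = 0) ∧
      (∀ μ t, D (μ, t) = 0 → ∀ᶠ z : ℝ × ℝ × ℝ in 𝓝 (μ, μ, t),
        D (z.1, z.2.2) = 0 → D (z.2.1, z.2.2) = 0 → z.1 = z.2.1) ∧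
      (∀ μ t, D (μ, t) = 0 → ∀ ε > 0, ∃ a b : ℝ,
        |a - μ| < ε ∧ |b - μ| < ε ∧ D (a, t) < 0 ∧ 0 < D (b, t)) := by
  obtain ⟨Φ, hΦ, hV, hU⟩ := exists_continuous_solution (y := 1) hα hβ zero_lt_one hq
  have hp : ∀ μ t : ℝ, IntervalIntegrable (fun x => t * q x - μ) volume 0 1 := fun μ t =>
    (hq.const_mul t).sub intervalIntegrable_const
  have hI : ∀ μ t, ∃ d₁ d₂, IsIVP α β (fun x => t * q x - μ) (ext (Φ (μ, t))) d₁ d₂ := fun μ t =>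
    (hV μ t).isIVP hα one_ne_zero (hp μ t) (continuous_ext _).continuousOn
  choose d₁ d₂ hd using hI
  set G : ℝ × ℝ × ℝ → ℝ := fun z =>
    ∫ x in (0 : ℝ)..1, ext (Φ (z.1, z.2.2)) x * ext (Φ (z.2.1, z.2.2)) x with hG
  have hGc : Continuous G := continuous_integral_mul_ext hΦ
  have hGpos : ∀ μ t, 0 < G (μ, μ, t) := by
    intro μ t
    have := (hd μ t).integral_sq_pos hα
    simpa only [hG, pow_two] using this
  -- This identity replaces differentiability of D in μ. G is positive near the diagonal, so two
  -- zeros a, b close to μ must coincide, and near a single zero the sign of D can be read off.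
  have hL : ∀ a b t, (a - b) * G (a, b, t) =
      ext (Φ (a, t)) 1 * d₂ b t 1 - ext (Φ (b, t)) 1 * d₂ a t 1 := by
    intro a b t
    rw [← (hd a t).lagrange hα (hd b t), hG]
    simp only
    rw [← intervalIntegral.integral_const_mul]
    exact intervalIntegral.integral_congr fun x _ => by ring
  refine ⟨fun z => ext (Φ z) 1, ?_, ?_, ?_, ?_⟩
  · simp only [ext, IccExtend, Function.comp_apply]
    fun_prop
  · intro μ t
    constructor
    · rintro ⟨u, hu⟩
      obtain ⟨h1, e₁, e₂, hI⟩ := isSolution_iff.1 hu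
      change ext (Φ (μ, t)) 1 = 0
      rw [← hU μ t u (hI.continuousOn hα) (hI.isVolterra hα one_ne_zero (hp μ t)) 1 (by simp), h1]
    · intro h
      exact ⟨_, isSolution_iff.2 ⟨h, _, _, hd μ t⟩⟩
  · intro μ t _
    filter_upwards [hGc.continuousAt.eventually_const_lt (hGpos μ t)] with z hz h1 h2
    have := hL z.1 z.2.1 z.2.2
    rw [h1, h2, zero_mul, zero_mul, sub_zero] at this
    exact sub_eq_zero.1 ((mul_eq_zero.1 this).resolve_right hz.ne')
  · intro μ t h ε hε
    have hc : Continuous fun ν => G (μ, ν, t) := by fun_prop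
    obtain ⟨δ, hδ, hball⟩ := Metric.eventually_nhds_iff.1
      (hc.continuousAt.eventually_const_lt (hGpos μ t))
    set η := min δ ε / 2 with hη
    have hη0 : 0 < η := by positivity
    have hηδ : η < δ := by have := min_le_left δ ε; linarith
    have hηε : η < ε := by have := min_le_right δ ε; linarith
    have g1 : 0 < G (μ, μ + η, t) := hball (by simpa [abs_of_pos hη0] using hηδ)
    have g2 : 0 < G (μ, μ - η, t) := hball (by simpa [abs_of_pos hη0, Real.dist_eq] using hηδ)
    have l1 := hL μ (μ + η) t
    have l2 := hL μ (μ - η) t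
    simp only at h
    rw [h] at l1 l2
    -- With D(μ,t) = 0 the identity becomes D(μ ± η, t) u'(1) = ± η G, where u' is the slope for μ.
    -- In particular u'(1) ≠ 0 and D changes sign.
    have m1 : 0 < ext (Φ (μ + η, t)) 1 * d₂ μ t 1 := by nlinarith
    have m2 : ext (Φ (μ - η, t)) 1 * d₂ μ t 1 < 0 := by nlinarith
    have n1 : |μ + η - μ| < ε := by simpa [abs_of_pos hη0] using hηε
    have n2 : |μ - η - μ| < ε := by simpa [abs_of_pos hη0] using hηε
    rcases lt_trichotomy (d₂ μ t 1) 0 with hs | hs | hs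
    · exact ⟨μ + η, μ - η, n1, n2, neg_of_mul_pos_left m1 hs.le, pos_of_mul_neg_left m2 hs.le⟩
    · simp [hs] at m1
    · exact ⟨μ - η, μ + η, n2, n1, neg_of_mul_neg_left m2 hs.le, pos_of_mul_pos_left m1 hs.le⟩

/-! ### The basic problem q = 0: location and number of its eigenvalues. -/

/-- The characteristic function of the basic problem. -/
noncomputable def basicChar (α β z : ℝ) : ℝ :=
  z * Real.sin z + β * (Real.sin (z * α) * Real.sin (z * (1 - α)))

/-- The solution of `u'' + y² u = β δ(x - α) u`, `u(0) = 0`, `u'(0) = 1`. -/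
noncomputable def basicSol (α β y x : ℝ) : ℝ :=
  Real.sin (y * x) / y + β * (Real.sin (y * max (x - α) 0) / y) * (Real.sin (y * α) / y)

theorem basicSol_one {α β y : ℝ} (hα : α ∈ Ioo (0 : ℝ) 1) (hy : y ≠ 0) :
    basicSol α β y 1 = basicChar α β y / y ^ 2 := by
  rw [basicSol, basicChar, max_eq_left (by linarith [hα.2])]
  field_simp

theorem continuous_basicSol (α β y : ℝ) : Continuous (basicSol α β y) := by
  unfold basicSol
  fun_prop

theorem isVolterra_basicSol {α β y : ℝ} {p : ℝ → ℝ}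
    (hp : ∀ x, p x + y ^ 2 = 0) : IsVolterra α β y p (basicSol α β y) := by
  intro x _
  have hαα : basicSol α β y α = Real.sin (y * α) / y := by simp [basicSol]
  rw [hαα]
  simp [hp, basicSol]

/-- For y = η the integral in the Volterra form vanishes, so the solution is explicit and its value
at 1 is the characteristic function divided by η². -/
theorem isEigenvalue_zero_iff {α β η : ℝ} (hα : α ∈ Ioo (0 : ℝ) 1) (hη : 0 < η) (q : ℝ → ℝ) :
    IsEigenvalue α β (fun x => 0 * q x) (η ^ 2) ↔ basicChar α β η = 0 := by
  have hp : IntervalIntegrable (fun x => 0 * q x - η ^ 2) volume 0 1 := by simp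
  have h1 : basicSol α β η 1 = 0 ↔ basicChar α β η = 0 := by
    rw [basicSol_one hα hη.ne', div_eq_zero_iff, or_iff_left (by positivity)]
  rw [← h1]
  constructor
  · rintro ⟨u, hu⟩
    obtain ⟨h1, e₁, e₂, hI⟩ := isSolution_iff.1 hu
    have hV := hI.isVolterra hα hη.ne' hp
    have hx : ∀ x ∈ Icc (0 : ℝ) 1, u x = Real.sin (η * x) / η +
        β * (Real.sin (η * max (x - α) 0) / η) * u α := fun x hx => by
      rw [hV x hx]; simp
    have hαu : u α = Real.sin (η * α) / η := by
      rw [hx α (Ioo_subset_Icc_self hα)]; simp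
    rw [← h1, hx 1 (by simp), hαu, basicSol]
  · intro h
    obtain ⟨d₁, d₂, hd⟩ := (isVolterra_basicSol (α := α) (β := β) (y := η)
      (p := fun x => 0 * q x - η ^ 2) (by simp)).isIVP hα hη.ne' hp
      (continuous_basicSol _ _ _).continuousOn
    exact ⟨_, isSolution_iff.2 ⟨h, d₁, d₂, hd⟩⟩

/-- The derivative of `basicChar`. -/
noncomputable def basicChar' (α β z : ℝ) : ℝ :=
  Real.sin z + z * Real.cos z + β * (α * Real.cos (z * α) * Real.sin (z * (1 - α)) +
    Real.sin (z * α) * ((1 - α) * Real.cos (z * (1 - α))))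

theorem hasDerivAt_basicChar (α β z : ℝ) :
    HasDerivAt (basicChar α β) (basicChar' α β z) z := by
  have h1 := ((hasDerivAt_id z).mul_const α).sin
  have h2 := ((hasDerivAt_id z).mul_const (1 - α)).sin
  refine (((hasDerivAt_id z).mul (Real.hasDerivAt_sin z)).add
    ((h1.mul h2).const_mul β)).congr_deriv ?_
  simp only [basicChar', id_eq]
  ring

theorem continuous_basicChar (α β : ℝ) : Continuous (basicChar α β) := by
  unfold basicChar
  fun_prop

/-- All roots in one interval are crossed in the same direction. Multiply the derivative by P =
sin(zα) sin(z(1-α)) and eliminate β by the equation: the result is P sin z - z (α sin²(z(1-α)) +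
(1-α) sin²(zα)). For z > πk the equation also forces (-1)ᵏ P < 0, so both parts are negative and the
derivative has the sign of (-1)ᵏ. -/
theorem basicChar'_pos {α β z : ℝ} (hα : α ∈ Ioo (0 : ℝ) 1) (hβ : 0 ≤ β) (hz : 0 < z) (k : ℕ)
    (hk : z ∈ Ico (Real.pi * k) (Real.pi * (k + 1))) (h : basicChar α β z = 0) :
    0 < (-1) ^ k * basicChar' α β z := by
  unfold basicChar at h
  unfold basicChar'
  set θ := z - k * Real.pi with hθ
  have hzθ : z = θ + k * Real.pi := by rw [hθ]; ring
  have hs : Real.sin z = (-1) ^ k * Real.sin θ := by rw [hzθ, Real.sin_add_nat_mul_pi]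
  have hc : Real.cos z = (-1) ^ k * Real.cos θ := by rw [hzθ, Real.cos_add_nat_mul_pi]
  have hσ : ((-1 : ℝ) ^ k) * (-1) ^ k = 1 := by rw [← mul_pow]; simp
  set σ : ℝ := (-1) ^ k with hσd
  have hab : z = z * α + z * (1 - α) := by ring
  have hsz : Real.sin z = Real.sin (z * α) * Real.cos (z * (1 - α)) +
      Real.cos (z * α) * Real.sin (z * (1 - α)) := by rw [← Real.sin_add, ← hab]
  have hcz : Real.cos z = Real.cos (z * α) * Real.cos (z * (1 - α)) -
      Real.sin (z * α) * Real.sin (z * (1 - α)) := by rw [← Real.cos_add, ← hab]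
  have ha := Real.sin_sq_add_cos_sq (z * α)
  have hb := Real.sin_sq_add_cos_sq (z * (1 - α))
  set sa := Real.sin (z * α)
  set ca := Real.cos (z * α)
  set sb := Real.sin (z * (1 - α))
  set cb := Real.cos (z * (1 - α))
  rcases eq_or_lt_of_le (show 0 ≤ θ by rw [hθ]; linarith [hk.1]) with h0 | h0
  -- At z = πk the factor P may vanish. Here either β = 0 or both sines are zero, so the β-part of
  -- the derivative drops out and z cos z is left.
  · have hs0 : Real.sin z = 0 := by rw [hs, ← h0]; simp
    have hc0 : Real.cos z = σ := by rw [hc, ← h0]; simp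
    have hz' : β * (α * ca * sb + sa * ((1 - α) * cb)) = 0 := by
      rw [hs0, mul_zero, zero_add] at h
      rcases mul_eq_zero.1 h with h | h
      · rw [h, zero_mul]
      · rw [hs0] at hsz
        rcases mul_eq_zero.1 h with h | h
        · have : ca ≠ 0 := by rintro h'; simp [h, h'] at ha
          have : sb = 0 := by
            rw [h, zero_mul, zero_add] at hsz
            exact (mul_eq_zero.1 hsz.symm).resolve_left this
          rw [h, this]; ring
        · have : cb ≠ 0 := by rintro h'; simp [h, h'] at hb
          have : sa = 0 := by
            rw [h, mul_zero, add_zero] at hsz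
            exact (mul_eq_zero.1 hsz.symm).resolve_right this
          rw [h, this]; ring
    rw [hz', hs0, hc0]
    have : σ * (0 + z * σ + 0) = z * (σ * σ) := by ring
    rw [this, hσ]
    linarith
  · have hsθ : 0 < Real.sin θ := Real.sin_pos_of_pos_of_lt_pi h0 (by rw [hθ]; linarith [hk.2])
    have hσs : 0 < σ * Real.sin z := by
      rw [hs, ← mul_assoc, hσ, one_mul]; exact hsθ
    have hP : β * (σ * (sa * sb)) < 0 := by
      have e : β * (σ * (sa * sb)) = -(z * (σ * Real.sin z)) := by linear_combination σ * h
      rw [e, neg_lt_zero]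
      exact mul_pos hz hσs
    have hσP : σ * (sa * sb) < 0 := by
      by_contra! hcon
      exact absurd (mul_nonneg hβ hcon) (not_le.2 hP)
    have hPne : sa * sb ≠ 0 := by rintro h'; simp [h'] at hσP
    have hsa : 0 < sa ^ 2 := pow_two_pos_of_ne_zero (left_ne_zero_of_mul hPne)
    have hsb : 0 < sb ^ 2 := pow_two_pos_of_ne_zero (right_ne_zero_of_mul hPne)
    have key : (Real.sin z + z * Real.cos z + β * (α * ca * sb + sa * ((1 - α) * cb))) * (sa * sb) =
        Real.sin z * (sa * sb) - z * (α * sb ^ 2 + (1 - α) * sa ^ 2) := by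
      have e1 : (α * ca * sb + sa * ((1 - α) * cb)) * (β * (sa * sb)) =
          (α * ca * sb + sa * ((1 - α) * cb)) * (-(z * Real.sin z)) := by
        rw [show β * (sa * sb) = -(z * Real.sin z) by linarith]
      have e2 : Real.cos z * (sa * sb) - Real.sin z * (α * ca * sb + sa * ((1 - α) * cb)) =
          -(α * sb ^ 2 + (1 - α) * sa ^ 2) := by
        rw [hsz, hcz]
        linear_combination (-α * sb ^ 2) * ha - ((1 - α) * sa ^ 2) * hb
      linear_combination e1 + z * e2
    have h1 : Real.sin z * (sa * sb) < 0 := by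
      have : (σ * Real.sin z) * (σ * (sa * sb)) < 0 := mul_neg_of_pos_of_neg hσs hσP
      have e : (σ * Real.sin z) * (σ * (sa * sb)) = (σ * σ) * (Real.sin z * (sa * sb)) := by ring
      rwa [e, hσ, one_mul] at this
    have h2 : 0 < z * (α * sb ^ 2 + (1 - α) * sa ^ 2) :=
      mul_pos hz (add_pos (mul_pos hα.1 hsb) (mul_pos (by linarith [hα.2]) hsa))
    refine pos_of_mul_neg_left (b := σ * (sa * sb)) ?_ hσP.le
    calc _ = (σ * σ) * ((Real.sin z + z * Real.cos z +
          β * (α * ca * sb + sa * ((1 - α) * cb))) * (sa * sb)) := by ring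
      _ < 0 := by rw [hσ, key]; linarith

theorem sign_basicChar {α β z : ℝ} (hα : α ∈ Ioo (0 : ℝ) 1) (hβ : 0 ≤ β) (hz : 0 < z) (k : ℕ)
    (hk : z ∈ Ico (Real.pi * k) (Real.pi * (k + 1))) (h : basicChar α β z = 0) :
    ∀ᶠ x in 𝓝 z, SignType.sign ((-1) ^ k * basicChar α β x) = SignType.sign (x - z) := by
  have hd := (hasDerivAt_basicChar α β z).const_mul ((-1 : ℝ) ^ k)
  have := eventually_nhdsWithin_sign_eq_of_deriv_pos
    (f := fun x => (-1) ^ k * basicChar α β x) (x₀ := z)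
    (by rw [hd.deriv]; exact basicChar'_pos hα hβ hz k hk h) (by simp [h])
  exact this

/-- Between two upward crossings of (-1)ᵏ times the function there would have to be a zero crossed
downwards. -/
theorem basicChar_root_unique {α β : ℝ} (hα : α ∈ Ioo (0 : ℝ) 1) (hβ : 0 ≤ β) {k : ℕ}
    {z₁ z₂ : ℝ} (hz : 0 < z₁) (h₁ : z₁ ∈ Ico (Real.pi * k) (Real.pi * (k + 1)))
    (h₂ : z₂ ∈ Ico (Real.pi * k) (Real.pi * (k + 1))) (e₁ : basicChar α β z₁ = 0)
    (e₂ : basicChar α β z₂ = 0) (hlt : z₁ < z₂) : False := by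
  set g : ℝ → ℝ := fun x => (-1) ^ k * basicChar α β x with hg
  have hgc : Continuous g := (continuous_basicChar α β).const_mul _
  have hg0 : ∀ x, g x = 0 → basicChar α β x = 0 := fun x hx =>
    (mul_eq_zero.1 hx).resolve_left (pow_ne_zero _ (by norm_num))
  obtain ⟨c, hc1, hc2, hc3⟩ : ∃ c, z₁ < c ∧ c < z₂ ∧ 0 < g c := by
    have h1 : ∀ᶠ x in 𝓝[>] z₁, SignType.sign (g x) = SignType.sign (x - z₁) :=
      nhdsWithin_le_nhds (sign_basicChar hα hβ hz k h₁ e₁)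
    obtain ⟨c, hc, hc1, hc2⟩ := (h1.and (Ioo_mem_nhdsGT hlt)).exists
    rw [sign_pos (sub_pos.2 hc1), sign_eq_one_iff] at hc
    exact ⟨c, hc1, hc2, hc⟩
  -- Let z be the first zero after c. The function is positive at c and negative just before z, so
  -- there is a zero in between, contradicting the choice of z.
  have hcomp : IsCompact (Icc c z₂ ∩ g ⁻¹' {0}) :=
    isCompact_Icc.inter_right (isClosed_singleton.preimage hgc)
  obtain ⟨z, ⟨hzm, hz0⟩, hmin⟩ := hcomp.exists_isLeast ⟨z₂, ⟨hc2.le, le_rfl⟩, by simp [hg, e₂]⟩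
  have hz0 : g z = 0 := hz0
  have hcz : c < z := lt_of_le_of_ne hzm.1 (by rintro rfl; linarith)
  have h2 : ∀ᶠ x in 𝓝[<] z, SignType.sign (g x) = SignType.sign (x - z) :=
    nhdsWithin_le_nhds (sign_basicChar hα hβ (hz.trans (hc1.trans hcz)) k
      ⟨h₁.1.trans (hc1.trans hcz).le, hzm.2.trans_lt h₂.2⟩ (hg0 z hz0))
  obtain ⟨d, hd, hd1, hd2⟩ := (h2.and (Ioo_mem_nhdsLT hcz)).exists
  rw [sign_neg (sub_neg.2 hd2), sign_eq_neg_one_iff] at hd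
  obtain ⟨e, he, he0⟩ := intermediate_value_Icc' hd1.le hgc.continuousOn
    (show (0 : ℝ) ∈ Icc (g d) (g c) from ⟨hd.le, hc3.le⟩)
  have := hmin ⟨⟨he.1, he.2.trans (hd2.le.trans hzm.2)⟩, he0⟩
  linarith [he.2]

theorem basicChar_pi_mul (α β : ℝ) (k : ℕ) :
    (-1) ^ k * basicChar α β (Real.pi * k) = -(β * Real.sin (Real.pi * k * α) ^ 2) := by
  have hs : Real.sin (Real.pi * k) = 0 := by rw [mul_comm]; exact Real.sin_nat_mul_pi k
  have hc : Real.cos (Real.pi * k) = (-1) ^ k := by rw [mul_comm]; exact Real.cos_nat_mul_pi k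
  have hσ : ((-1 : ℝ) ^ k) * (-1) ^ k = 1 := by rw [← mul_pow]; simp
  rw [basicChar, mul_sub, mul_one, Real.sin_sub, hs, hc]
  linear_combination (-β * Real.sin (Real.pi * k * α) ^ 2) * hσ

theorem exists_basicChar_root {α β : ℝ} (hα : α ∈ Ioo (0 : ℝ) 1) (hβ : 0 ≤ β) {k : ℕ}
    (hk : 1 ≤ k) : ∃ z ∈ Ico (Real.pi * k) (Real.pi * (k + 1)), basicChar α β z = 0 := by
  have hπ := Real.pi_pos
  have hk0 : (0 : ℝ) < k := by exact_mod_cast hk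
  set g : ℝ → ℝ := fun x => (-1) ^ k * basicChar α β x with hg
  have hgc : Continuous g := (continuous_basicChar α β).const_mul _
  have hg0 : ∀ x, g x = 0 → basicChar α β x = 0 := fun x hx =>
    (mul_eq_zero.1 hx).resolve_left (pow_ne_zero _ (by norm_num))
  have hlt : Real.pi * k < Real.pi * (k + 1) := by nlinarith
  have ha : g (Real.pi * k) ≤ 0 := by
    rw [hg]; simp only [basicChar_pi_mul]
    have : 0 ≤ β * Real.sin (Real.pi * k * α) ^ 2 := by positivity
    linarith
  have hb : 0 ≤ g (Real.pi * (k + 1)) := by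
    have := basicChar_pi_mul α β (k + 1)
    rw [pow_succ] at this
    push_cast at this
    have h2 : 0 ≤ β * Real.sin (Real.pi * (k + 1) * α) ^ 2 := by positivity
    simp only [hg]
    linarith
  -- The right end point is excluded from the interval. If it is a root, it is the left end of the
  -- next interval, where the crossing direction is reversed; so g is positive just before it and a
  -- root is found earlier.
  obtain ⟨c, hc1, hc2, hc3⟩ : ∃ c, Real.pi * k ≤ c ∧ c ≤ Real.pi * (k + 1) ∧
      0 ≤ g c ∧ (c = Real.pi * (k + 1) → 0 < g c) := by
    rcases eq_or_lt_of_le hb with hb0 | hb0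
    · have h1 : ∀ᶠ x in 𝓝[<] (Real.pi * (k + 1)), SignType.sign ((-1) ^ (k + 1) * basicChar α β x) =
          SignType.sign (x - Real.pi * (k + 1)) :=
        nhdsWithin_le_nhds (sign_basicChar hα hβ (by positivity) (k + 1)
          (by push_cast; constructor <;> nlinarith) (hg0 _ hb0.symm))
      obtain ⟨c, hc, hc1, hc2⟩ := (h1.and (Ioo_mem_nhdsLT hlt)).exists
      rw [sign_neg (sub_neg.2 hc2), sign_eq_neg_one_iff, pow_succ] at hc
      refine ⟨c, hc1.le, hc2.le, ?_, fun h => absurd h hc2.ne⟩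
      simp only [hg]
      linarith
    · exact ⟨_, hlt.le, le_rfl, hb, fun _ => hb0⟩
  obtain ⟨z, hz, hz0⟩ := intermediate_value_Icc hc1 hgc.continuousOn
    (show (0 : ℝ) ∈ Icc _ _ from ⟨ha, hc3.1⟩)
  refine ⟨z, ⟨hz.1, lt_of_le_of_ne (hz.2.trans hc2) fun h => ?_⟩, hg0 z hz0⟩
  have hcz : c = z := le_antisymm (h ▸ hc2) hz.2
  have := hc3.2 (hcz.trans h)
  rw [hcz] at this
  linarith

theorem basicChar_pos {α β z : ℝ} (hα : α ∈ Ioo (0 : ℝ) 1) (hβ : 0 ≤ β) (hz : z ∈ Ioo 0 Real.pi) :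
    0 < basicChar α β z := by
  have h1 := Real.sin_pos_of_pos_of_lt_pi hz.1 hz.2
  have h2 : 0 < Real.sin (z * α) := Real.sin_pos_of_pos_of_lt_pi (mul_pos hz.1 hα.1)
    (by nlinarith [hz.1, hz.2, hα.1, hα.2])
  have h3 : 0 < Real.sin (z * (1 - α)) := Real.sin_pos_of_pos_of_lt_pi
    (mul_pos hz.1 (by linarith [hα.2])) (by nlinarith [hz.1, hz.2, hα.1, hα.2])
  have := hz.1
  unfold basicChar
  positivity

theorem IsBasicEigenvalue.sqrt_mem {α β lam0 : ℝ} {n : ℕ} (h : IsBasicEigenvalue α β n lam0) :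
    √lam0 ∈ Ico (Real.pi * n) (Real.pi * (n + 1)) := by
  have hπ := Real.pi_pos
  obtain ⟨⟨h1, h2⟩, -⟩ := h
  constructor
  · exact Real.le_sqrt_of_sq_le (by rw [mul_pow]; exact h1)
  · rw [Real.sqrt_lt' (by positivity), mul_pow]; exact h2

theorem IsBasicEigenvalue.basicChar_eq_zero {α β lam0 : ℝ} {n : ℕ}
    (h : IsBasicEigenvalue α β n lam0) : basicChar α β √lam0 = 0 := by
  have := h.2
  rw [basicChar]
  linarith

/-- The number of eigenvalues of the basic problem below the `n`-th root. -/
theorem encard_basic_eigenvalues {α β lam0 : ℝ} {n : ℕ} (hα : α ∈ Ioo (0 : ℝ) 1) (hβ : 0 ≤ β)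
    (hn : 1 ≤ n) (h : IsBasicEigenvalue α β n lam0) (q : ℝ → ℝ) :
    {μ | IsEigenvalue α β (fun x => 0 * q x) μ ∧ μ < lam0}.encard + 1 = (n : ℕ∞) := by
  have hπ := Real.pi_pos
  have hn0 : (1 : ℝ) ≤ n := by exact_mod_cast hn
  have hy := h.sqrt_mem
  have hy0 : 0 < √lam0 := lt_of_lt_of_le (by positivity) hy.1
  have hlam : √lam0 ^ 2 = lam0 := Real.sq_sqrt (Real.sqrt_pos.1 hy0).le
  choose! ρ hρ hρ0 using fun (k : ℕ) (hk : 1 ≤ k) => exists_basicChar_root hα hβ hk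
  have hρpos : ∀ k, 1 ≤ k → 0 < ρ k := fun k hk => by
    have : (1 : ℝ) ≤ k := by exact_mod_cast hk
    exact lt_of_lt_of_le (by positivity) (hρ k hk).1
  have hmono : ∀ j k, 1 ≤ j → j < k → ρ j < ρ k := fun j k hj hjk => by
    have : (j : ℝ) + 1 ≤ k := by exact_mod_cast hjk
    calc ρ j < Real.pi * (j + 1) := (hρ j hj).2
      _ ≤ Real.pi * k := by gcongr
      _ ≤ ρ k := (hρ k (by omega)).1
  -- The intervals with k ≥ 1 tile [π, ∞) and ρ k is the only root in the k-th one. Nothing is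
  -- missed: eigenvalues are positive and there is no root in (0, π).
  have hset : {μ | IsEigenvalue α β (fun x => 0 * q x) μ ∧ μ < lam0} =
      (fun k => ρ k ^ 2) '' (Finset.Ico 1 n : Set ℕ) := by
    ext μ
    simp only [mem_ofPred_eq, mem_image, Finset.coe_Ico]
    constructor
    · rintro ⟨hμ, hlt⟩
      have hμ0 : 0 < μ := by
        obtain ⟨u, hu⟩ := hμ
        obtain ⟨h1, e₁, e₂, hI⟩ := isSolution_iff.1 hu
        simp only [zero_mul, zero_sub] at hI
        exact hI.pos_of_potential_zero hα hβ h1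
      have hη : 0 < √μ := Real.sqrt_pos.2 hμ0
      have hημ : √μ ^ 2 = μ := Real.sq_sqrt hμ0.le
      have hroot : basicChar α β √μ = 0 := by
        rw [← isEigenvalue_zero_iff hα hη q, hημ]; exact hμ
      have hηπ : Real.pi ≤ √μ := by
        by_contra! hcon
        exact (basicChar_pos hα hβ ⟨hη, hcon⟩).ne' hroot
      have hηy : √μ < √lam0 := Real.sqrt_lt_sqrt hμ0.le hlt
      set k := ⌊√μ / Real.pi⌋₊ with hk
      have hk1 : 1 ≤ k := Nat.le_floor (by rw [Nat.cast_one, le_div_iff₀ hπ]; linarith)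
      have hka : Real.pi * k ≤ √μ := by
        have := Nat.floor_le (show 0 ≤ √μ / Real.pi by positivity)
        rw [le_div_iff₀ hπ] at this
        linarith
      have hkb : √μ < Real.pi * (k + 1) := by
        have := Nat.lt_floor_add_one (√μ / Real.pi)
        rw [div_lt_iff₀ hπ] at this
        linarith
      have heq : ρ k = √μ := by
        rcases lt_trichotomy (ρ k) √μ with hlt' | heq | hlt'
        · exact (basicChar_root_unique hα hβ (hρpos k hk1) (hρ k hk1) ⟨hka, hkb⟩ (hρ0 k hk1)
            hroot hlt').elim
        · exact heq
        · exact (basicChar_root_unique hα hβ hη ⟨hka, hkb⟩ (hρ k hk1) hroot (hρ0 k hk1) hlt').elim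
      refine ⟨k, ⟨hk1, ?_⟩, by rw [heq, hημ]⟩
      have hkn : k ≤ n := by
        by_contra! hcon
        have : (n : ℝ) + 1 ≤ k := by exact_mod_cast hcon
        have : Real.pi * (n + 1) ≤ Real.pi * k := by gcongr
        linarith [hy.2]
      refine lt_of_le_of_ne hkn fun hkn => ?_
      rw [hkn] at hka hkb
      exact basicChar_root_unique hα hβ hη ⟨hka, hkb⟩ hy hroot h.basicChar_eq_zero hηy
    · rintro ⟨k, hk, rfl⟩
      refine ⟨(isEigenvalue_zero_iff hα (hρpos k hk.1) q).2 (hρ0 k hk.1), ?_⟩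
      have : (k : ℝ) + 1 ≤ n := by exact_mod_cast hk.2
      have h1 : ρ k < √lam0 := by
        calc ρ k < Real.pi * (k + 1) := (hρ k hk.1).2
          _ ≤ Real.pi * n := by gcongr
          _ ≤ √lam0 := hy.1
      change ρ k ^ 2 < lam0
      rw [← hlam]
      exact pow_lt_pow_left₀ h1 (hρpos k hk.1).le two_ne_zero
  have hinj : InjOn (fun k => ρ k ^ 2) (Finset.Ico 1 n : Set ℕ) := by
    intro j hj k hk hjk
    rw [Finset.coe_Ico] at hj hk
    have hjk' : ρ j = ρ k := (pow_left_inj₀ (hρpos j hj.1).le (hρpos k hk.1).le two_ne_zero).1 hjk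
    rcases lt_trichotomy j k with hlt | heq | hlt
    · exact absurd hjk' (hmono j k hj.1 hlt).ne
    · exact heq
    · exact absurd hjk' (hmono k j hk.1 hlt).ne'
  rw [hset, hinj.encard_image, encard_coe_eq_coe_finsetCard, Nat.card_Ico]
  norm_cast
  omega

/-! ### Catalan numbers and the majorant series. -/

/-- Identifies α_j, j ≥ 1, as the Taylor coefficients of s = (1 - √(1 - X))/2, which makes the
Catalan convolution available. Both sides satisfy the same two-term recursion. -/
theorem alphaCoeff_succ (j : ℕ) : alphaCoeff (j + 1) = (catalan j : ℝ) / 4 ^ (j + 1) := by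
  induction j with
  | zero => norm_num [alphaCoeff, Nat.doubleFactorial]
  | succ j ih =>
    have h1 : alphaCoeff (j + 1 + 1) = alphaCoeff (j + 1) * ((2 * j + 1) / (2 * j + 4)) := by
      have e1 : Nat.doubleFactorial (2 * (j + 1 + 1) - 3) =
          (2 * j + 1) * Nat.doubleFactorial (2 * (j + 1) - 3) := by
        cases j with
        | zero => rfl
        | succ i =>
          rw [show 2 * (i + 1 + 1 + 1) - 3 = (2 * i + 1) + 2 by omega,
            show 2 * (i + 1 + 1) - 3 = 2 * i + 1 by omega, Nat.doubleFactorial_add_two]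
          ring
      have e2 : Nat.doubleFactorial (2 * (j + 1 + 1)) =
          (2 * j + 4) * Nat.doubleFactorial (2 * (j + 1)) := by
        rw [show 2 * (j + 1 + 1) = (2 * (j + 1)) + 2 by ring, Nat.doubleFactorial_add_two]
        ring
      have : (0 : ℝ) < Nat.doubleFactorial (2 * (j + 1)) := by
        exact_mod_cast Nat.doubleFactorial_pos _
      rw [alphaCoeff, alphaCoeff, e1, e2]
      push_cast
      field_simp
    have h2 : ((j : ℝ) + 2) * catalan (j + 1) = 2 * (2 * j + 1) * catalan j := by
      have a1 := succ_mul_catalan_eq_centralBinom j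
      have a2 := succ_mul_catalan_eq_centralBinom (j + 1)
      have a3 := Nat.succ_mul_centralBinom_succ j
      rw [← a1, ← a2] at a3
      have a4 : ((j : ℝ) + 1) * (((j + 1 : ℕ) + 1) * catalan (j + 1)) =
          2 * (2 * j + 1) * ((j + 1) * catalan j) := by exact_mod_cast a3
      have : ((j : ℝ) + 1) ≠ 0 := by positivity
      apply mul_left_cancel₀ this
      push_cast at a4
      linear_combination a4
    rw [h1, ih, pow_succ _ (j + 1)]
    field_simp
    linear_combination -2 * h2

theorem alphaCoeff_nonneg (j : ℕ) : 0 ≤ alphaCoeff j := by unfold alphaCoeff; positivity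

theorem alphaCoeff_succ_le (j : ℕ) : alphaCoeff (j + 2) ≤ alphaCoeff (j + 1) := by
  have h1 : catalan (j + 1) ≤ 4 * catalan j := by
    have a1 := succ_mul_catalan_eq_centralBinom j
    have a2 := succ_mul_catalan_eq_centralBinom (j + 1)
    have a3 := Nat.succ_mul_centralBinom_succ j
    rw [← a1, ← a2] at a3
    have h5 : (j + 2) * catalan (j + 1) = (4 * j + 2) * catalan j := by
      apply Nat.eq_of_mul_eq_mul_left (Nat.succ_pos j)
      rw [Nat.succ_eq_add_one]
      linear_combination a3
    refine le_of_mul_le_mul_left (a := j + 2) ?_ (by positivity)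
    rw [h5]
    nlinarith [Nat.zero_le (catalan j)]
  rw [alphaCoeff_succ, alphaCoeff_succ, pow_succ _ (j + 1), div_le_div_iff₀ (by positivity)
    (by positivity)]
  have : (catalan (j + 1) : ℝ) ≤ 4 * catalan j := by exact_mod_cast h1
  have h4 : (0 : ℝ) < 4 ^ (j + 1) := by positivity
  nlinarith

theorem alphaCoeff_antitone {i j : ℕ} (h : i ≤ j) : alphaCoeff (j + 1) ≤ alphaCoeff (i + 1) :=
  antitone_nat_of_succ_le (f := fun k => alphaCoeff (k + 1)) alphaCoeff_succ_le h

theorem tendsto_alphaCoeff : Tendsto (fun m => alphaCoeff (m + 1)) atTop (𝓝 0) := by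
  refine squeeze_zero (fun m => alphaCoeff_nonneg _) (fun m => ?_)
    tendsto_one_div_add_atTop_nhds_zero_nat
  rw [alphaCoeff_succ, div_le_div_iff₀ (by positivity) (by positivity), one_mul]
  have h1 := succ_mul_catalan_eq_centralBinom m
  have h2 : m.centralBinom ≤ 4 ^ m := by
    rw [Nat.centralBinom, show 4 ^ m = 2 ^ (2 * m) by rw [pow_mul]; norm_num]
    exact Nat.choose_le_two_pow _ _
  have h3 : ((m : ℝ) + 1) * catalan m ≤ 4 ^ m := by exact_mod_cast h1.trans_le h2
  rw [pow_succ]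
  have : (0 : ℝ) < 4 ^ m := by positivity
  linarith

/-- The coefficients of `(1 - √(1 - X)) / 2`. -/
noncomputable def sqrtCoeff : ℕ → ℝ
  | 0 => 0
  | j + 1 => (catalan j : ℝ) / 4 ^ (j + 1)

theorem sqrtCoeff_nonneg (j : ℕ) : 0 ≤ sqrtCoeff j := by
  cases j <;> (simp only [sqrtCoeff, le_refl]; try positivity)

/-- The series `(1 - √(1 - X)) / 2`. -/
noncomputable def sqrtSeries : PowerSeries ℝ := PowerSeries.mk sqrtCoeff

theorem coeff_sqrtSeries (j : ℕ) : PowerSeries.coeff j sqrtSeries = sqrtCoeff j := by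
  simp [sqrtSeries]

/-- The Catalan convolution identity in generating-function form. In degrees at least 2 it says that
s and s² have equal coefficients. -/
theorem sqrtSeries_mul_self :
    sqrtSeries * sqrtSeries = sqrtSeries - PowerSeries.C (1 / 4 : ℝ) * PowerSeries.X := by
  set H : PowerSeries ℝ := PowerSeries.mk fun j => (catalan j : ℝ) / 4 ^ (j + 1) with hH
  have hG : sqrtSeries = PowerSeries.X * H := by
    ext j
    cases j with
    | zero => simp [sqrtSeries, sqrtCoeff]
    | succ j => rw [PowerSeries.coeff_succ_X_mul]; simp [sqrtSeries, sqrtCoeff, hH]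
  have hHH : ∀ j, PowerSeries.coeff j (H * H) = (catalan (j + 1) : ℝ) / 4 ^ (j + 2) := by
    intro j
    rw [PowerSeries.coeff_mul, catalan_succ']
    push_cast
    rw [Finset.sum_div]
    refine Finset.sum_congr rfl fun p hp => ?_
    rw [← Finset.HasAntidiagonal.mem_antidiagonal.1 hp]
    simp only [hH, PowerSeries.coeff_mk]
    rw [div_mul_div_comm]
    congr 1
    ring
  have hGG : sqrtSeries * sqrtSeries = PowerSeries.X * (PowerSeries.X * (H * H)) := by
    rw [hG]; ring
  ext j
  rw [hGG]
  rcases j with _ | _ | j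
  · rw [map_sub, coeff_sqrtSeries]
    simp [sqrtCoeff]
  · rw [PowerSeries.coeff_succ_X_mul, map_sub, PowerSeries.coeff_C_mul]
    simp [coeff_sqrtSeries, sqrtCoeff]
  · rw [PowerSeries.coeff_succ_X_mul, PowerSeries.coeff_succ_X_mul, hHH, map_sub,
      PowerSeries.coeff_C_mul, coeff_sqrtSeries]
    simp [sqrtCoeff, PowerSeries.coeff_X]

/-- The majorant series `1 - X - √(1 - w X) √(1 - X / w)`. -/
noncomputable def majorant (w : ℝ) : PowerSeries ℝ :=
  1 - PowerSeries.X - (1 - 2 * PowerSeries.rescale w sqrtSeries) *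
    (1 - 2 * PowerSeries.rescale w⁻¹ sqrtSeries)

theorem rescale_sqrtSeries_sq (w : ℝ) :
    (1 - 2 * PowerSeries.rescale w sqrtSeries) * (1 - 2 * PowerSeries.rescale w sqrtSeries) =
      1 - PowerSeries.C w * PowerSeries.X := by
  have h := congrArg (PowerSeries.rescale w) sqrtSeries_mul_self
  rw [map_mul, map_sub, map_mul, PowerSeries.rescale_X] at h
  have hC : PowerSeries.rescale w (PowerSeries.C (1 / 4 : ℝ)) = PowerSeries.C (1 / 4 : ℝ) := by
    ext j
    cases j <;> simp [PowerSeries.coeff_rescale, PowerSeries.coeff_C]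
  rw [hC] at h
  have h4 : 4 * PowerSeries.C (1 / 4 : ℝ) = 1 := by
    rw [show (4 : PowerSeries ℝ) = PowerSeries.C 4 from (map_ofNat PowerSeries.C 4).symm, ← map_mul]
    norm_num
  linear_combination 4 * h + (-PowerSeries.C w * PowerSeries.X) * h4

/-- For G = `majorant w`, (1 - X - G)² = (1 - wX)(1 - X/w) = 1 - (w + w⁻¹) X + X². For g = G/2 this
is g = g² + X g + v X, the recurrence to be majorized. -/
theorem majorant_mul_self {w v : ℝ} (hw : w ≠ 0) (hwv : w + w⁻¹ = 2 + 4 * v) :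
    majorant w * majorant w =
      2 * majorant w - 2 * (PowerSeries.X * majorant w) - PowerSeries.C (4 * v) * PowerSeries.X := by
  have h1 := rescale_sqrtSeries_sq w
  have h2 := rescale_sqrtSeries_sq w⁻¹
  have h3 : (PowerSeries.C w : PowerSeries ℝ) * PowerSeries.C w⁻¹ = 1 := by
    rw [← map_mul, mul_inv_cancel₀ hw, map_one]
  have h4 : (PowerSeries.C w : PowerSeries ℝ) + PowerSeries.C w⁻¹ = 2 + PowerSeries.C (4 * v) := by
    rw [← map_add, hwv, map_add, map_ofNat]
  unfold majorant
  set p := 1 - 2 * PowerSeries.rescale w sqrtSeries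
  set q := 1 - 2 * PowerSeries.rescale w⁻¹ sqrtSeries
  linear_combination (q * q) * h1 + (1 - PowerSeries.C w * PowerSeries.X) * h2 +
    PowerSeries.X ^ 2 * h3 - PowerSeries.X * h4

/-- Half of the coefficients of the majorant series. -/
noncomputable def majCoeff (w : ℝ) (j : ℕ) : ℝ := PowerSeries.coeff j (majorant w) / 2

theorem majCoeff_zero (w : ℝ) : majCoeff w 0 = 0 := by
  have h : ∀ a : ℝ, PowerSeries.constantCoeff (PowerSeries.rescale a sqrtSeries) = 0 := fun a => by
    rw [← PowerSeries.coeff_zero_eq_constantCoeff_apply, PowerSeries.coeff_rescale,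
      coeff_sqrtSeries, sqrtCoeff, mul_zero]
  simp [majCoeff, majorant, h]

/-- The case distinction arises because g has no constant term, whereas the sequence to be majorized
starts from v. -/
theorem majCoeff_succ {w v : ℝ} (hw : w ≠ 0) (hwv : w + w⁻¹ = 2 + 4 * v) (j : ℕ) :
    majCoeff w (j + 1) = ∑ p ∈ Finset.Ico 1 (j + 1), majCoeff w (j + 1 - p) * majCoeff w p +
      if j = 0 then v else majCoeff w j := by
  have h := congrArg (PowerSeries.coeff (j + 1)) (majorant_mul_self hw hwv)
  rw [PowerSeries.coeff_mul, map_sub, map_sub, PowerSeries.coeff_C_mul,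
    show (2 : PowerSeries ℝ) = PowerSeries.C 2 from (map_ofNat PowerSeries.C 2).symm,
    PowerSeries.coeff_C_mul, PowerSeries.coeff_C_mul, PowerSeries.coeff_succ_X_mul,
    PowerSeries.coeff_X, Finset.Nat.sum_antidiagonal_eq_sum_range_succ_mk] at h
  have hc : ∀ i, PowerSeries.coeff i (majorant w) = 2 * majCoeff w i := fun i => by
    rw [majCoeff]; ring
  simp only [hc] at h
  rw [Finset.sum_range_succ, Finset.range_eq_Ico, Finset.sum_eq_sum_Ico_succ_bot (Nat.succ_pos j),
    Nat.sub_self, majCoeff_zero, zero_add] at h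
  have hs : ∑ k ∈ Finset.Ico 1 (j + 1), 2 * majCoeff w k * (2 * majCoeff w (j + 1 - k)) =
      4 * ∑ p ∈ Finset.Ico 1 (j + 1), majCoeff w (j + 1 - p) * majCoeff w p := by
    rw [Finset.mul_sum]
    exact Finset.sum_congr rfl fun k _ => by ring
  rw [hs] at h
  by_cases hj : j = 0
  · subst hj
    simp [majCoeff_zero] at h ⊢
    linarith
  · simp only [hj, if_false]
    rw [if_neg (by omega)] at h
    linarith

theorem majCoeff_nonneg {w v : ℝ} (hw : w ≠ 0) (hv : 0 ≤ v) (hwv : w + w⁻¹ = 2 + 4 * v) (j : ℕ) :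
    0 ≤ majCoeff w j := by
  induction j using Nat.strong_induction_on with
  | _ j ih =>
    cases j with
    | zero => rw [majCoeff_zero]
    | succ j =>
      rw [majCoeff_succ hw hwv]
      refine add_nonneg (Finset.sum_nonneg fun p hp => ?_) ?_
      · have := Finset.mem_Ico.1 hp
        exact mul_nonneg (ih _ (by omega)) (ih _ (by omega))
      · split_ifs
        · exact hv
        · exact ih _ (by omega)

/-- With P = s(wX) and Q = s(X/w), g = P + Q - 2PQ - X/2, and the coefficients of P are the asserted
bounds. In degrees j ≥ 2, PQ dominates Q: there s = s², so Q has the coefficient w⁻ʲ ∑ s_p s_{j-p},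
and replacing w⁻ᵖ by the larger wᵖ gives that of PQ. -/
theorem majCoeff_le {w v : ℝ} (hw : 1 ≤ w) (hwv : w + w⁻¹ = 2 + 4 * v) (j : ℕ) :
    majCoeff w (j + 1) ≤ alphaCoeff (j + 1) * w ^ (j + 1) := by
  have hw0 : 0 < w := by linarith
  have hwi : w⁻¹ ≤ 1 := inv_le_one_of_one_le₀ hw
  cases j with
  | zero =>
    rw [majCoeff_succ hw0.ne' hwv, alphaCoeff_succ]
    simp
    linarith
  | succ j =>
    set P := PowerSeries.rescale w sqrtSeries with hP
    set Q := PowerSeries.rescale w⁻¹ sqrtSeries with hQ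
    have e : majorant w = 2 * P + 2 * Q - 4 * (P * Q) - PowerSeries.X := by
      rw [majorant]; ring
    have hc : majCoeff w (j + 2) = PowerSeries.coeff (j + 2) P + PowerSeries.coeff (j + 2) Q -
        2 * PowerSeries.coeff (j + 2) (P * Q) := by
      rw [majCoeff, e, map_sub, map_sub, map_add,
        show (2 : PowerSeries ℝ) = PowerSeries.C 2 from (map_ofNat PowerSeries.C 2).symm,
        show (4 : PowerSeries ℝ) = PowerSeries.C 4 from (map_ofNat PowerSeries.C 4).symm,
        PowerSeries.coeff_C_mul, PowerSeries.coeff_C_mul, PowerSeries.coeff_C_mul,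
        PowerSeries.coeff_X, if_neg (by omega)]
      ring
    have hPc : PowerSeries.coeff (j + 2) P = alphaCoeff (j + 2) * w ^ (j + 2) := by
      rw [hP, PowerSeries.coeff_rescale, coeff_sqrtSeries, alphaCoeff_succ, sqrtCoeff, mul_comm]
    have hGG : ∑ p ∈ Finset.HasAntidiagonal.antidiagonal (j + 2), sqrtCoeff p.1 * sqrtCoeff p.2 =
        sqrtCoeff (j + 2) := by
      have := congrArg (PowerSeries.coeff (j + 2)) sqrtSeries_mul_self
      rw [PowerSeries.coeff_mul, map_sub, PowerSeries.coeff_C_mul, PowerSeries.coeff_X,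
        if_neg (by omega), mul_zero, sub_zero] at this
      simpa only [coeff_sqrtSeries] using this
    have hPQ : PowerSeries.coeff (j + 2) Q ≤ PowerSeries.coeff (j + 2) (P * Q) := by
      rw [PowerSeries.coeff_mul, hQ, PowerSeries.coeff_rescale, coeff_sqrtSeries, ← hGG,
        Finset.mul_sum]
      refine Finset.sum_le_sum fun p hp => ?_
      rw [hP, PowerSeries.coeff_rescale, PowerSeries.coeff_rescale, coeff_sqrtSeries,
        coeff_sqrtSeries, ← Finset.HasAntidiagonal.mem_antidiagonal.1 hp, pow_add]
      have h1 : w⁻¹ ^ p.1 ≤ w ^ p.1 := pow_le_pow_left₀ (by positivity) (hwi.trans hw) _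
      have h2 : 0 ≤ w⁻¹ ^ p.2 * (sqrtCoeff p.1 * sqrtCoeff p.2) :=
        mul_nonneg (by positivity) (mul_nonneg (sqrtCoeff_nonneg _) (sqrtCoeff_nonneg _))
      calc _ = w⁻¹ ^ p.1 * (w⁻¹ ^ p.2 * (sqrtCoeff p.1 * sqrtCoeff p.2)) := by ring
        _ ≤ w ^ p.1 * (w⁻¹ ^ p.2 * (sqrtCoeff p.1 * sqrtCoeff p.2)) :=
          mul_le_mul_of_nonneg_right h1 h2
        _ = _ := by ring
    have hQ0 : 0 ≤ PowerSeries.coeff (j + 2) Q := by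
      rw [hQ, PowerSeries.coeff_rescale, coeff_sqrtSeries]
      exact mul_nonneg (by positivity) (sqrtCoeff_nonneg _)
    rw [hc, hPc]
    linarith

/-- Majorization of a quadratic recurrence by the coefficients `alphaCoeff`. -/
theorem recurrence_majorized {ℓ v : ℕ → ℝ} {N κ w v₀ : ℝ} (hN : 0 ≤ N) (hκ : 0 < κ) (hv₀ : 0 ≤ v₀)
    (hw : 1 ≤ w) (hwv : w + w⁻¹ = 2 + 4 * v₀) (hv0 : ∀ j, 0 ≤ v j)
    (h0 : v 0 ≤ v₀)
    (hℓ : ∀ j, 1 ≤ j → ℓ j ≤ ∑ p ∈ Finset.Ico 1 j, ℓ (j - p) * v p + N * v (j - 1))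
    (hv : ∀ j, 1 ≤ j → v j ≤ κ * (∑ p ∈ Finset.Ico 1 j, ℓ (j - p) * v p + N * v (j - 1)))
    (j : ℕ) (hj : 1 ≤ j) :
    v j ≤ alphaCoeff j * (w * (κ * N)) ^ j ∧ ℓ j ≤ alphaCoeff j * (w * (κ * N)) ^ j / κ := by
  have hw0 : w ≠ 0 := by linarith
  have hm := majCoeff_nonneg hw0 hv₀ hwv
  have ha : 0 ≤ κ * N := by positivity
  -- Scaling: g_j (κN)ʲ majorizes v_j, and the same divided by κ majorizes ℓ_j, since one factor κ
  -- separates the two inequalities.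
  have main : ∀ j, 1 ≤ j → v j ≤ majCoeff w j * (κ * N) ^ j ∧
      ℓ j ≤ majCoeff w j * (κ * N) ^ j / κ := by
    intro j
    induction j using Nat.strong_induction_on with
    | _ j ih =>
      intro hj
      obtain ⟨i, rfl⟩ : ∃ i, j = i + 1 := ⟨j - 1, by omega⟩
      have hS : ∑ p ∈ Finset.Ico 1 (i + 1), ℓ (i + 1 - p) * v p + N * v (i + 1 - 1) ≤
          majCoeff w (i + 1) * (κ * N) ^ (i + 1) / κ := by
        rw [majCoeff_succ hw0 hwv, add_mul, add_div, Finset.sum_mul, Finset.sum_div]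
        refine add_le_add (Finset.sum_le_sum fun p hp => ?_) ?_
        · have hp' := Finset.mem_Ico.1 hp
          have h1 := (ih (i + 1 - p) (by omega) (by omega)).2
          have h2 := (ih p (by omega) hp'.1).1
          calc _ ≤ (majCoeff w (i + 1 - p) * (κ * N) ^ (i + 1 - p) / κ) *
                (majCoeff w p * (κ * N) ^ p) :=
                mul_le_mul h1 h2 (hv0 p) (by have := hm (i + 1 - p); positivity)
            _ = majCoeff w (i + 1 - p) * majCoeff w p *
                ((κ * N) ^ (i + 1 - p) * (κ * N) ^ p) / κ := by ring
            _ = _ := by rw [← pow_add, Nat.sub_add_cancel (by omega)]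
        · rw [Nat.add_sub_cancel]
          split_ifs with hi
          · subst hi
            calc N * v 0 ≤ N * v₀ := mul_le_mul_of_nonneg_left h0 hN
              _ = _ := by field_simp; ring
          · have h2 := (ih i (by omega) (by omega)).1
            calc N * v i ≤ N * (majCoeff w i * (κ * N) ^ i) := mul_le_mul_of_nonneg_left h2 hN
              _ = _ := by rw [pow_succ]; field_simp
      refine ⟨(hv _ hj).trans ?_, (hℓ _ hj).trans hS⟩
      calc _ ≤ κ * (majCoeff w (i + 1) * (κ * N) ^ (i + 1) / κ) :=
            mul_le_mul_of_nonneg_left hS hκ.le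
        _ = _ := by field_simp
  obtain ⟨i, rfl⟩ : ∃ i, j = i + 1 := ⟨j - 1, by omega⟩
  have hle : majCoeff w (i + 1) * (κ * N) ^ (i + 1) ≤
      alphaCoeff (i + 1) * (w * (κ * N)) ^ (i + 1) := by
    rw [mul_pow w, ← mul_assoc]
    exact mul_le_mul_of_nonneg_right (majCoeff_le hw hwv i) (by positivity)
  exact ⟨(main _ hj).1.trans hle, (main _ hj).2.trans (div_le_div_of_nonneg_right hle hκ.le)⟩

/-! ### The basic eigenfunction and solvability of the correction problems. -/

theorem integral_split {f : ℝ → ℝ} (hf : IntervalIntegrable f volume 0 1) {x : ℝ}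
    (hx : x ∈ Icc (0 : ℝ) 1) :
    ∫ t in (0 : ℝ)..1, f t = (∫ t in (0 : ℝ)..x, f t) + ∫ t in x..1, f t :=
  (intervalIntegral.integral_add_adjacent_intervals (intervalIntegrable_sub hf (by simp) hx)
    (intervalIntegrable_sub hf hx (by simp))).symm

/-- Continuity and the jump condition of u⁽⁰⁾ at α. They hold in both cases of the definition of
c⁽⁰⁾: if sin(y(1-α)) = 0, the characteristic equation forces sin(yα) = 0 as well. -/
theorem basicC_spec {α β lam0 : ℝ} (hy : 0 < √lam0) (h : basicChar α β √lam0 = 0) :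
    Real.sin (√lam0 * α) / √lam0 = basicC α lam0 * Real.sin (√lam0 * (1 - α)) ∧
    -√lam0 * (basicC α lam0 * Real.cos (√lam0 * (1 - α))) =
      Real.cos (√lam0 * α) + β / √lam0 * Real.sin (√lam0 * α) := by
  rw [basicChar] at h
  unfold basicC
  set y := √lam0
  have hab : y = y * α + y * (1 - α) := by ring
  have hsz : Real.sin y = Real.sin (y * α) * Real.cos (y * (1 - α)) +
      Real.cos (y * α) * Real.sin (y * (1 - α)) := by rw [← Real.sin_add, ← hab]
  have hcz : Real.cos y = Real.cos (y * α) * Real.cos (y * (1 - α)) -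
      Real.sin (y * α) * Real.sin (y * (1 - α)) := by rw [← Real.cos_add, ← hab]
  have hb := Real.sin_sq_add_cos_sq (y * (1 - α))
  rw [hsz] at h
  split_ifs with hs
  · constructor
    · field_simp
    · field_simp
      linear_combination -h
  · rw [not_not] at hs
    rw [hs] at h hb ⊢
    have hcb : Real.cos (y * (1 - α)) ≠ 0 := by rintro h'; simp [h'] at hb
    have hsa : Real.sin (y * α) = 0 := by
      have : y * Real.cos (y * (1 - α)) * Real.sin (y * α) = 0 := by linear_combination h
      exact (mul_eq_zero.1 this).resolve_left (mul_ne_zero hy.ne' hcb)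
    rw [hcz, hs, hsa]
    constructor
    · simp
    · field_simp
      linear_combination y * Real.cos (y * α) * hb

/-- The sum of the squares of the two matching conditions; it shows that √c̃ / y is the amplitude of
u⁽⁰⁾ on the right piece. -/
theorem sq_mul_basicC_sq {α β lam0 : ℝ} (hy : 0 < √lam0) (h : basicChar α β √lam0 = 0) :
    √lam0 ^ 2 * basicC α lam0 ^ 2 = cTilde α β lam0 := by
  obtain ⟨h1, h2⟩ := basicC_spec hy h
  rw [div_eq_iff hy.ne'] at h1
  have hb := Real.sin_sq_add_cos_sq (√lam0 * (1 - α))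
  rw [cTilde, ← h2, h1]
  linear_combination (-√lam0 ^ 2 * basicC α lam0 ^ 2) * hb

theorem cTilde_pos (α β lam0 : ℝ) : 0 < cTilde α β lam0 := by
  unfold cTilde
  have ha := Real.sin_sq_add_cos_sq (√lam0 * α)
  by_cases hs : Real.sin (√lam0 * α) = 0
  · rw [hs] at ha ⊢
    simp only [mul_zero, add_zero]
    linarith
  · have := pow_two_pos_of_ne_zero hs
    positivity

theorem abs_basicC {α β lam0 : ℝ} (hy : 0 < √lam0) (h : basicChar α β √lam0 = 0) :
    |basicC α lam0| = √(cTilde α β lam0) / √lam0 := by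
  rw [← sq_mul_basicC_sq hy h, ← mul_pow, Real.sqrt_sq_eq_abs, abs_mul, abs_of_pos hy]
  field_simp

theorem basicC_ne_zero {α β lam0 : ℝ} (hy : 0 < √lam0) (h : basicChar α β √lam0 = 0) :
    basicC α lam0 ≠ 0 := by
  intro h0
  have := sq_mul_basicC_sq hy h
  rw [h0] at this
  have := cTilde_pos α β lam0
  simp_all

theorem sin_one_sub (y α x : ℝ) : Real.sin (y * (1 - x)) =
    Real.sin (y * (1 - α)) * Real.cos (y * (x - α)) -
      Real.cos (y * (1 - α)) * Real.sin (y * (x - α)) := by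
  rw [← Real.sin_sub]
  ring_nf

theorem basicU_eq_basicSol {α β lam0 : ℝ} (hy : 0 < √lam0) (h : basicChar α β √lam0 = 0)
    (x : ℝ) : basicU α lam0 x = basicSol α β √lam0 x := by
  obtain ⟨h1, h2⟩ := basicC_spec hy h
  unfold basicU basicSol
  set y := √lam0
  split_ifs with hx
  · rw [max_eq_right (by linarith)]
    simp
  · rw [max_eq_left (by linarith), sin_one_sub y α x]
    have hs : Real.sin (y * x) = Real.sin (y * α) * Real.cos (y * (x - α)) +
        Real.cos (y * α) * Real.sin (y * (x - α)) := by
      rw [← Real.sin_add]; ring_nf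
    rw [hs]
    have h3 : basicC α lam0 * Real.cos (y * (1 - α)) =
        -(Real.cos (y * α) + β / y * Real.sin (y * α)) / y := by
      rw [eq_div_iff hy.ne']
      linear_combination -h2
    linear_combination (-Real.cos (y * (x - α))) * h1 - Real.sin (y * (x - α)) * h3

theorem continuous_basicU {α β lam0 : ℝ} (hy : 0 < √lam0) (h : basicChar α β √lam0 = 0) :
    Continuous (basicU α lam0) := by
  rw [funext (basicU_eq_basicSol hy h)]
  exact continuous_basicSol _ _ _

/-- On `[α,1]` the representation by `c` gives the solution formula based at `0`. -/
theorem corrector_volterra {α β y c : ℝ} {F w : ℝ → ℝ} (hα : α ∈ Ioo (0 : ℝ) 1)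
    (hF : IntervalIntegrable F volume 0 1)
    (hsin : c * Real.sin (y * (1 - α)) = ∫ ξ in (0 : ℝ)..1, Real.sin (y * (α - ξ)) / y * F ξ)
    (hcos : c * Real.cos (y * (1 - α)) =
      -(∫ ξ in (0 : ℝ)..1, Real.cos (y * (α - ξ)) / y * F ξ)
        - β * ∫ ξ in (0 : ℝ)..α, Real.sin (y * (α - ξ)) / y ^ 2 * F ξ)
    (hl : ∀ x ∈ Icc 0 α, w x = ∫ ξ in (0 : ℝ)..x, Real.sin (y * (x - ξ)) / y * F ξ)
    (hr : ∀ x ∈ Icc α 1, w x = c * Real.sin (y * (1 - x))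
      - ∫ ξ in x..1, Real.sin (y * (x - ξ)) / y * F ξ) :
    (∀ x ∈ Icc (0 : ℝ) 1, w x = (∫ ξ in (0 : ℝ)..x, Real.sin (y * (x - ξ)) / y * F ξ) +
      β * (Real.sin (y * max (x - α) 0) / y) * w α) ∧ w 1 = 0 := by
  have hαm : α ∈ Icc (0 : ℝ) 1 := Ioo_subset_Icc_self hα
  refine ⟨fun x hx => ?_, ?_⟩
  · rcases le_total x α with hxα | hxα
    · rw [hl x ⟨hx.1, hxα⟩, max_eq_right (by linarith)]
      simp
    · have hG : IntervalIntegrable (fun ξ => Real.sin (y * (x - ξ)) / y * F ξ) volume 0 1 :=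
        hF.continuousOn_mul (by fun_prop)
      have hsplit := (integral_split hG hx).symm
      have e1 : ∫ ξ in (0 : ℝ)..1, Real.cos (y * (α - ξ)) / y * F ξ =
          (∫ ξ in (0 : ℝ)..1, Real.cos (y * (α - ξ)) * F ξ) / y := by
        rw [← intervalIntegral.integral_div]
        exact intervalIntegral.integral_congr fun ξ _ => by ring
      have e2 : ∫ ξ in (0 : ℝ)..α, Real.sin (y * (α - ξ)) / y ^ 2 * F ξ = w α / y := by
        rw [hl α (right_mem_Icc.2 hα.1.le), ← intervalIntegral.integral_div]
        exact intervalIntegral.integral_congr fun ξ _ => by ring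
      rw [hr x ⟨hxα, hx.2⟩, max_eq_left (by linarith), sin_one_sub y α x]
      rw [e1, e2, integral_cos_sub hF] at hcos
      rw [integral_sin_sub hF] at hsin hsplit
      have s1 : Real.sin (y * x) = Real.sin (y * α) * Real.cos (y * (x - α)) +
          Real.cos (y * α) * Real.sin (y * (x - α)) := by
        rw [← Real.sin_add]; ring_nf
      have s2 : Real.cos (y * x) = Real.cos (y * α) * Real.cos (y * (x - α)) -
          Real.sin (y * α) * Real.sin (y * (x - α)) := by
        rw [← Real.cos_add]; ring_nf
      rw [s1, s2] at hsplit
      linear_combination Real.cos (y * (x - α)) * hsin - Real.sin (y * (x - α)) * hcos - hsplit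
  · rw [hr 1 (right_mem_Icc.2 hα.2.le)]
    simp

/-- The two equations for `c` are consistent when `F` is orthogonal to `basicU`. -/
theorem exists_corrector {α β lam0 : ℝ} {F : ℝ → ℝ} (hα : α ∈ Ioo (0 : ℝ) 1) (hy : 0 < √lam0)
    (h : basicChar α β √lam0 = 0) (hF : IntervalIntegrable F volume 0 1)
    (horth : ∫ ξ in (0 : ℝ)..1, F ξ * basicU α lam0 ξ = 0) {c : ℝ}
    (hc : c = Real.sin (√lam0 * (1 - α)) *
        (∫ ξ in (0 : ℝ)..1, Real.sin (√lam0 * (α - ξ)) / √lam0 * F ξ) +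
      Real.cos (√lam0 * (1 - α)) * (-(∫ ξ in (0 : ℝ)..1, Real.cos (√lam0 * (α - ξ)) / √lam0 * F ξ)
        - β * ∫ ξ in (0 : ℝ)..α, Real.sin (√lam0 * (α - ξ)) / lam0 * F ξ)) :
    c * Real.sin (√lam0 * (1 - α)) =
      ∫ ξ in (0 : ℝ)..1, Real.sin (√lam0 * (α - ξ)) / √lam0 * F ξ ∧
    c * Real.cos (√lam0 * (1 - α)) =
      -(∫ ξ in (0 : ℝ)..1, Real.cos (√lam0 * (α - ξ)) / √lam0 * F ξ)
        - β * ∫ ξ in (0 : ℝ)..α, Real.sin (√lam0 * (α - ξ)) / lam0 * F ξ := by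
  obtain ⟨h1, h2⟩ := basicC_spec hy h
  have hC := basicC_ne_zero hy h
  have hlam : lam0 = √lam0 ^ 2 := (Real.sq_sqrt (Real.sqrt_pos.1 hy).le).symm
  have hαm : α ∈ Icc (0 : ℝ) 1 := Ioo_subset_Icc_self hα
  have hF1 : IntervalIntegrable F volume 0 α := intervalIntegrable_sub hF (by simp) hαm
  have hF2 : IntervalIntegrable F volume α 1 := intervalIntegrable_sub hF hαm (by simp)
  have hFU : IntervalIntegrable (fun ξ => F ξ * basicU α lam0 ξ) volume 0 1 :=
    intervalIntegrable_mul_continuousOn hF (continuous_basicU hy h).continuousOn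
  rw [integral_split hFU hαm] at horth
  have hb := Real.sin_sq_add_cos_sq (√lam0 * (1 - α))
  have ha := Real.sin_sq_add_cos_sq (√lam0 * α)
  set A := ∫ ξ in (0 : ℝ)..1, Real.sin (√lam0 * (α - ξ)) / √lam0 * F ξ with hA
  set B := -(∫ ξ in (0 : ℝ)..1, Real.cos (√lam0 * (α - ξ)) / √lam0 * F ξ)
        - β * ∫ ξ in (0 : ℝ)..α, Real.sin (√lam0 * (α - ξ)) / lam0 * F ξ with hB
  -- This c is the projection of (A, B) on the unit vector (sin, cos) of y(1-α); it solves both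
  -- equations once (A, B) is parallel to that vector.
  suffices hAB : A * Real.cos (√lam0 * (1 - α)) = B * Real.sin (√lam0 * (1 - α)) by
    rw [hc]
    constructor
    · linear_combination A * hb - Real.cos (√lam0 * (1 - α)) * hAB
    · linear_combination B * hb + Real.sin (√lam0 * (1 - α)) * hAB
  set C := basicC α lam0 with hCdef
  have e0 : ∫ ξ in (0 : ℝ)..α, F ξ * basicU α lam0 ξ =
      (∫ ξ in (0 : ℝ)..α, Real.sin (√lam0 * ξ) * F ξ) / √lam0 := by
    rw [← intervalIntegral.integral_div]
    refine intervalIntegral.integral_congr fun ξ hξ => ?_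
    rw [uIcc_of_le hα.1.le] at hξ
    simp only [basicU, if_pos hξ.2]
    ring
  have e1 : ∫ ξ in α..1, F ξ * basicU α lam0 ξ =
      C * √lam0 * ∫ ξ in α..1, Real.sin (√lam0 * (1 - ξ)) / √lam0 * F ξ := by
    rw [← intervalIntegral.integral_const_mul]
    refine intervalIntegral.integral_congr_ae (Eventually.of_forall fun ξ hξ => ?_)
    rw [uIoc_of_le hα.2.le] at hξ
    simp only [basicU, if_neg (not_le.2 hξ.1)]
    rw [hCdef]
    field_simp
  rw [e0, e1, integral_sin_sub hF2, mul_one] at horth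
  have e2 : ∫ ξ in (0 : ℝ)..1, Real.cos (√lam0 * (α - ξ)) / √lam0 * F ξ =
      (∫ ξ in (0 : ℝ)..1, Real.cos (√lam0 * (α - ξ)) * F ξ) / √lam0 := by
    rw [← intervalIntegral.integral_div]
    exact intervalIntegral.integral_congr fun ξ _ => by ring
  have e3 : ∫ ξ in (0 : ℝ)..α, Real.sin (√lam0 * (α - ξ)) / lam0 * F ξ =
      (∫ ξ in (0 : ℝ)..α, Real.sin (√lam0 * (α - ξ)) / √lam0 * F ξ) / √lam0 := by
    rw [← intervalIntegral.integral_div]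
    refine intervalIntegral.integral_congr fun ξ _ => ?_
    have hinv : lam0⁻¹ = (√lam0)⁻¹ * (√lam0)⁻¹ := by rw [← mul_inv, ← pow_two, ← hlam]
    rw [div_eq_mul_inv, hinv]
    ring
  have hc1 : IntervalIntegrable (fun ξ => Real.cos (√lam0 * ξ) * F ξ) volume 0 1 :=
    hF.continuousOn_mul (by fun_prop)
  have hs1 : IntervalIntegrable (fun ξ => Real.sin (√lam0 * ξ) * F ξ) volume 0 1 :=
    hF.continuousOn_mul (by fun_prop)
  rw [e2, e3, integral_cos_sub hF, integral_sin_sub hF1] at hB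
  rw [integral_sin_sub hF] at hA
  rw [integral_split hc1 hαm, integral_split hs1 hαm] at hA hB
  clear_value A B C
  rw [basicChar] at h
  set y := √lam0
  have hsz : Real.sin y = Real.sin (y * α) * Real.cos (y * (1 - α)) +
      Real.cos (y * α) * Real.sin (y * (1 - α)) := by rw [← Real.sin_add]; ring_nf
  have hcz : Real.cos y = Real.cos (y * α) * Real.cos (y * (1 - α)) -
      Real.sin (y * α) * Real.sin (y * (1 - α)) := by rw [← Real.cos_add]; ring_nf
  rw [hsz] at h
  rw [hsz, hcz] at horth
  set I₁ := ∫ ξ in (0 : ℝ)..α, Real.cos (y * ξ) * F ξ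
  set J₁ := ∫ ξ in (0 : ℝ)..α, Real.sin (y * ξ) * F ξ
  set I₂ := ∫ ξ in α..1, Real.cos (y * ξ) * F ξ
  set J₂ := ∫ ξ in α..1, Real.sin (y * ξ) * F ξ
  set sa := Real.sin (y * α)
  set ca := Real.cos (y * α)
  set sb := Real.sin (y * (1 - α))
  set cb := Real.cos (y * (1 - α))
  have h3 : C * sb = sa / y := h1.symm
  have h4 : C * cb = -(ca + β / y * sa) / y := by
    rw [eq_div_iff hy.ne']; linear_combination -h2
  have hJ : -(C * (ca * cb - sa * sb + β * sb * ca / y)) = 1 / y := by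
    calc _ = -ca * (C * cb) + (sa - β * ca / y) * (C * sb) := by ring
      _ = (sa ^ 2 + ca ^ 2) / y := by rw [h3, h4]; field_simp; ring
      _ = 1 / y := by rw [ha]
  -- Multiplied by y c⁽⁰⁾ ≠ 0, the defect of compatibility equals ∫ F u⁽⁰⁾. The coefficient of I₁
  -- vanishes by the characteristic equation and that of J₁ is 1/y.
  have key : y * C * (A * cb - B * sb) = 0 := by
    have hI : (sa * cb + ca * sb) / y + β * sa * sb / y ^ 2 = 0 := by
      have : (sa * cb + ca * sb) / y + β * sa * sb / y ^ 2 =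
        (y * (sa * cb + ca * sb) + β * (sa * sb)) / y ^ 2 := by field_simp
      rw [this, h, zero_div]
    rw [← horth, hA, hB]
    have e : y * C * (((sa / y * (I₁ + I₂) - ca / y * (J₁ + J₂)) * cb -
        (-((ca * (I₁ + I₂) + sa * (J₁ + J₂)) / y) - β * ((sa / y * I₁ - ca / y * J₁) / y)) * sb)) =
        y * C * I₁ * ((sa * cb + ca * sb) / y + β * sa * sb / y ^ 2) +
        J₁ * (-(C * (ca * cb - sa * sb + β * sb * ca / y))) +
        C * y * ((sa * cb + ca * sb) / y * I₂ - (ca * cb - sa * sb) / y * J₂) := by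
      field_simp
      ring
    rw [e, hI, hJ]
    ring
  have := (mul_eq_zero.1 key).resolve_left (mul_ne_zero hy.ne' hC)
  linarith

/-! ### The FD-recursion: orthogonality, integral equations, existence. -/

section Method

variable {α β : ℝ} {q : ℝ → ℝ} {lam0 : ℝ} {lam : ℕ → ℝ} {u : ℕ → ℝ → ℝ}

theorem intervalIntegrable_rhs (hq : IntervalIntegrable q volume 0 1) {j : ℕ} (hj : 1 ≤ j)
    (hu : ∀ p < j, ContinuousOn (u p) (Icc 0 1)) :
    IntervalIntegrable (rhs q lam u j) volume 0 1 := by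
  have h1 : ContinuousOn (fun x => -∑ p ∈ Finset.range j, lam (j - p) * u p x) (Icc 0 1) :=
    (continuousOn_finsetSum _ fun p hp =>
      continuousOn_const.mul (hu p (Finset.mem_range.1 hp))).neg
  exact (h1.intervalIntegrable_of_Icc zero_le_one).add
    (intervalIntegrable_mul_continuousOn hq (hu (j - 1) (by omega)))

theorem M_pos (hy : 0 < √lam0) (h : basicChar α β √lam0 = 0) (hα : α ∈ Ioo (0 : ℝ) 1) :
    0 < M α lam0 := by
  have hlam : 0 < lam0 := Real.sqrt_pos.1 hy
  refine mul_pos hlam ?_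
  have hp : IntervalIntegrable (fun _ : ℝ => -√lam0 ^ 2) volume 0 1 := intervalIntegrable_const
  obtain ⟨d₁, d₂, hd⟩ := (isVolterra_basicSol (α := α) (β := β) (y := √lam0)
    (p := fun _ => -√lam0 ^ 2) (by simp)).isIVP hα hy.ne' hp (continuous_basicSol _ _ _).continuousOn
  simpa only [basicU_eq_basicSol hy h] using hd.integral_sq_pos hα

/-- In ∫ F⁽ʲ⁾ u⁽⁰⁾ the term p = 0 is -λ⁽ʲ⁾ ∫ (u⁽⁰⁾)² = -λ⁽ʲ⁾ M / λ⁽⁰⁾, and the formula for λ⁽ʲ⁾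
makes it cancel all others. -/
theorem integral_rhs_mul (hy : 0 < √lam0) (h : basicChar α β √lam0 = 0) (hα : α ∈ Ioo (0 : ℝ) 1)
    (hq : IntervalIntegrable q volume 0 1)
    (hu0 : ∀ x ∈ Icc (0 : ℝ) 1, u 0 x = basicU α lam0 x) {j : ℕ} (hj : 1 ≤ j)
    (hu : ∀ p < j, ContinuousOn (u p) (Icc 0 1))
    (hlam : lam j = lam0 / M α lam0 *
      (-(∑ p ∈ Finset.Ico 1 j, lam (j - p) * ∫ ξ in (0 : ℝ)..1, u 0 ξ * u p ξ)
        + ∫ ξ in (0 : ℝ)..1, q ξ * u (j - 1) ξ * u 0 ξ)) :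
    ∫ ξ in (0 : ℝ)..1, rhs q lam u j ξ * u 0 ξ = 0 := by
  have hM := M_pos hy h hα
  have hlam0 : 0 < lam0 := Real.sqrt_pos.1 hy
  have hu00 := hu 0 hj
  have i1 : ∀ p ∈ Finset.range j, IntervalIntegrable
      (fun ξ => lam (j - p) * (u 0 ξ * u p ξ)) volume 0 1 := fun p hp =>
    ((hu00.mul (hu p (Finset.mem_range.1 hp))).intervalIntegrable_of_Icc zero_le_one).const_mul _
  have i2 : IntervalIntegrable (fun ξ => q ξ * u (j - 1) ξ * u 0 ξ) volume 0 1 :=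
    intervalIntegrable_mul_continuousOn
      (intervalIntegrable_mul_continuousOn hq (hu (j - 1) (by omega))) hu00
  have e1 : ∫ ξ in (0 : ℝ)..1, rhs q lam u j ξ * u 0 ξ =
      ∫ ξ in (0 : ℝ)..1, (q ξ * u (j - 1) ξ * u 0 ξ -
        ∑ p ∈ Finset.range j, lam (j - p) * (u 0 ξ * u p ξ)) := by
    refine intervalIntegral.integral_congr fun ξ _ => ?_
    simp only [rhs, add_mul, neg_mul, Finset.sum_mul]
    rw [neg_add_eq_sub]
    congr 1
    exact Finset.sum_congr rfl fun p _ => by ring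
  have i3 : IntervalIntegrable (fun ξ => ∑ p ∈ Finset.range j, lam (j - p) * (u 0 ξ * u p ξ))
      volume 0 1 := by
    have := IntervalIntegrable.sum (Finset.range j) (f := fun p ξ => lam (j - p) * (u 0 ξ * u p ξ)) i1
    have e : (fun ξ => ∑ p ∈ Finset.range j, lam (j - p) * (u 0 ξ * u p ξ)) =
        ∑ p ∈ Finset.range j, fun ξ => lam (j - p) * (u 0 ξ * u p ξ) := by
      ext ξ
      simp
    rwa [e]
  have e2 : ∫ ξ in (0 : ℝ)..1, u 0 ξ * u 0 ξ = M α lam0 / lam0 := by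
    rw [M, mul_div_cancel_left₀ _ hlam0.ne']
    refine intervalIntegral.integral_congr fun ξ hξ => ?_
    rw [uIcc_of_le zero_le_one] at hξ
    simp only [hu0 ξ hξ, pow_two]
  rw [e1, intervalIntegral.integral_sub i2 i3, intervalIntegral.integral_finsetSum i1]
  simp only [intervalIntegral.integral_const_mul]
  rw [Finset.range_eq_Ico, Finset.sum_eq_sum_Ico_succ_bot (by omega), e2, Nat.sub_zero, hlam]
  field_simp
  ring

theorem IsFDMethod.volterra {c : ℕ → ℝ} (hα : α ∈ Ioo (0 : ℝ) 1) (hy : 0 < √lam0)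
    (hM : IsFDMethod α β q lam0 lam u c) {j : ℕ} (hj : 1 ≤ j)
    (hF : IntervalIntegrable (rhs q lam u j) volume 0 1) :
    (∀ x ∈ Icc (0 : ℝ) 1, u j x =
      (∫ ξ in (0 : ℝ)..x, Real.sin (√lam0 * (x - ξ)) / √lam0 * rhs q lam u j ξ) +
      β * (Real.sin (√lam0 * max (x - α) 0) / √lam0) * u j α) ∧ u j 1 = 0 := by
  have hlam : √lam0 ^ 2 = lam0 := Real.sq_sqrt (Real.sqrt_pos.1 hy).le
  exact corrector_volterra hα hF (hM.c_sin j hj) (by rw [hlam]; exact hM.c_cos j hj)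
    (hM.u_left j hj) (hM.u_right j hj)

theorem continuousOn_of_volterra {α β y : ℝ} {F w : ℝ → ℝ} (hF : IntervalIntegrable F volume 0 1)
    {b : ℝ} (h : ∀ x ∈ Icc (0 : ℝ) 1, w x = (∫ ξ in (0 : ℝ)..x, Real.sin (y * (x - ξ)) / y * F ξ) +
      β * (Real.sin (y * max (x - α) 0) / y) * b) : ContinuousOn w (Icc 0 1) := by
  refine ContinuousOn.congr ((continuousOn_integral_kernel hF).add ?_) h
  exact (by fun_prop : Continuous fun x => β * (Real.sin (y * max (x - α) 0) / y) * b).continuousOn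

theorem IsFDMethod.continuousOn {c : ℕ → ℝ} (hα : α ∈ Ioo (0 : ℝ) 1) (hy : 0 < √lam0)
    (h : basicChar α β √lam0 = 0) (hq : IntervalIntegrable q volume 0 1)
    (hM : IsFDMethod α β q lam0 lam u c) (j : ℕ) : ContinuousOn (u j) (Icc 0 1) := by
  induction j using Nat.strong_induction_on with
  | _ j ih =>
    rcases Nat.eq_zero_or_pos j with rfl | hj
    · exact (continuous_basicU hy h).continuousOn.congr hM.u_zero
    · have hF := intervalIntegrable_rhs (lam := lam) hq hj ih
      exact continuousOn_of_volterra hF (hM.volterra hα hy hj hF).1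

/-- Since `step j` reads only the values below j, the default filled in elsewhere has no effect. -/
theorem exists_strong_rec {X : Type*} [Inhabited X] (step : ℕ → (ℕ → X) → X)
    (hstep : ∀ j f g, (∀ i < j, f i = g i) → step j f = step j g) :
    ∃ f : ℕ → X, ∀ j, f j = step j f := by
  let F : ∀ j : ℕ, (∀ i < j, X) → X := fun j ih =>
    step j fun i => if hi : i < j then ih i hi else default
  refine ⟨Nat.strongRec F, fun j => ?_⟩
  beta_reduce
  rw [Nat.strongRec_eq]
  refine hstep _ _ _ fun i hi => ?_
  simp [hi]

/-- The FD-method is well defined. -/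
theorem exists_fdMethod (hα : α ∈ Ioo (0 : ℝ) 1) (hy : 0 < √lam0)
    (h : basicChar α β √lam0 = 0) (hq : IntervalIntegrable q volume 0 1) :
    ∃ (lam : ℕ → ℝ) (u : ℕ → ℝ → ℝ) (c : ℕ → ℝ), IsFDMethod α β q lam0 lam u c := by
  classical
  let newLam : ℕ → (ℕ → ℝ) → (ℕ → ℝ → ℝ) → ℝ := fun j lam u => lam0 / M α lam0 *
      (-(∑ p ∈ Finset.Ico 1 j, lam (j - p) * ∫ ξ in (0 : ℝ)..1, u 0 ξ * u p ξ)
        + ∫ ξ in (0 : ℝ)..1, q ξ * u (j - 1) ξ * u 0 ξ)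
  let newC : (ℝ → ℝ) → ℝ := fun F => Real.sin (√lam0 * (1 - α)) *
        (∫ ξ in (0 : ℝ)..1, Real.sin (√lam0 * (α - ξ)) / √lam0 * F ξ) +
      Real.cos (√lam0 * (1 - α)) * (-(∫ ξ in (0 : ℝ)..1, Real.cos (√lam0 * (α - ξ)) / √lam0 * F ξ)
        - β * ∫ ξ in (0 : ℝ)..α, Real.sin (√lam0 * (α - ξ)) / lam0 * F ξ)
  let newU : (ℝ → ℝ) → ℝ → ℝ := fun F x =>
    if x ≤ α then ∫ ξ in (0 : ℝ)..x, Real.sin (√lam0 * (x - ξ)) / √lam0 * F ξ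
    else newC F * Real.sin (√lam0 * (1 - x)) -
      ∫ ξ in x..1, Real.sin (√lam0 * (x - ξ)) / √lam0 * F ξ
  -- λ⁽ʲ⁾ itself enters F⁽ʲ⁾ through p = 0, hence the update before the right-hand side is formed.
  let newF : ℕ → (ℕ → ℝ) → (ℕ → ℝ → ℝ) → ℝ → ℝ := fun j lam u =>
    rhs q (Function.update lam j (newLam j lam u)) u j
  have hLam : ∀ j lam lam' u u', (∀ i < j, lam i = lam' i) → (∀ i < j, u i = u' i) → 1 ≤ j →
      newLam j lam u = newLam j lam' u' := by
    intro j lam lam' u u' h1 h2 hj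
    simp only [newLam]
    rw [h2 0 hj, h2 (j - 1) (by omega)]
    congr 3
    refine Finset.sum_congr rfl fun p hp => ?_
    have := Finset.mem_Ico.1 hp
    rw [h1 (j - p) (by omega), h2 p this.2]
  have hFF : ∀ j lam lam' u u', (∀ i < j, lam i = lam' i) → (∀ i < j, u i = u' i) → 1 ≤ j →
      newF j lam u = newF j lam' u' := by
    intro j lam lam' u u' h1 h2 hj
    funext x
    simp only [newF, rhs]
    rw [hLam j lam lam' u u' h1 h2 hj, h2 (j - 1) (by omega)]
    congr 2
    refine Finset.sum_congr rfl fun p hp => ?_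
    have hp' := Finset.mem_range.1 hp
    rw [h2 p hp']
    congr 1
    by_cases hp0 : p = 0
    · simp [hp0]
    · rw [Function.update_of_ne (by omega), Function.update_of_ne (by omega), h1 _ (by omega)]
  let step : ℕ → (ℕ → ℝ × (ℝ → ℝ)) → ℝ × (ℝ → ℝ) := fun j f =>
    if j = 0 then (lam0, basicU α lam0)
    else (newLam j (fun i => (f i).1) (fun i => (f i).2),
      newU (newF j (fun i => (f i).1) (fun i => (f i).2)))
  obtain ⟨f, hf⟩ := exists_strong_rec step (by
    intro j f g hfg
    simp only [step]
    split_ifs with hj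
    · rfl
    · have h1 : ∀ i < j, (fun i => (f i).1) i = (fun i => (g i).1) i := fun i hi => by
        simp only [hfg i hi]
      have h2 : ∀ i < j, (fun i => (f i).2) i = (fun i => (g i).2) i := fun i hi => by
        simp only [hfg i hi]
      rw [hLam j _ _ _ _ h1 h2 (by omega), hFF j _ _ _ _ h1 h2 (by omega)])
  set lam : ℕ → ℝ := fun i => (f i).1 with hlamdef
  set u : ℕ → ℝ → ℝ := fun i => (f i).2 with hudef
  have hlam0 : lam 0 = lam0 := by simp only [hlamdef]; rw [hf 0]; simp [step]
  have hu0 : u 0 = basicU α lam0 := by simp only [hudef]; rw [hf 0]; simp [step]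
  have hlamj : ∀ j, 1 ≤ j → lam j = newLam j lam u := fun j hj => by
    change (f j).1 = _
    rw [hf j]
    simp only [step, if_neg (show j ≠ 0 by omega)]
    rfl
  have hrhs : ∀ j, 1 ≤ j → newF j lam u = rhs q lam u j := fun j hj => by
    simp only [newF]
    rw [← hlamj j hj, Function.update_eq_self]
  have huj : ∀ j, 1 ≤ j → u j = newU (rhs q lam u j) := fun j hj => by
    rw [← hrhs j hj]
    change (f j).2 = _
    rw [hf j]
    simp only [step, if_neg (show j ≠ 0 by omega)]
    rfl
  have hlamsq : √lam0 ^ 2 = lam0 := Real.sq_sqrt (Real.sqrt_pos.1 hy).le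
  have hu0' : ∀ x ∈ Icc (0 : ℝ) 1, u 0 x = basicU α lam0 x := fun x _ => by rw [hu0]
  have correct : ∀ j, 1 ≤ j → (∀ p < j, ContinuousOn (u p) (Icc 0 1)) →
      (newC (rhs q lam u j) * Real.sin (√lam0 * (1 - α)) =
        ∫ ξ in (0 : ℝ)..1, Real.sin (√lam0 * (α - ξ)) / √lam0 * rhs q lam u j ξ) ∧
      (newC (rhs q lam u j) * Real.cos (√lam0 * (1 - α)) =
      -(∫ ξ in (0 : ℝ)..1, Real.cos (√lam0 * (α - ξ)) / √lam0 * rhs q lam u j ξ)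
        - β * ∫ ξ in (0 : ℝ)..α, Real.sin (√lam0 * (α - ξ)) / lam0 * rhs q lam u j ξ) := by
    intro j hj hc
    have hF := intervalIntegrable_rhs (lam := lam) hq hj hc
    have ho := integral_rhs_mul hy h hα hq hu0' hj hc (hlamj j hj)
    rw [hu0] at ho
    exact exists_corrector hα hy h hF ho rfl
  have hleft : ∀ j, 1 ≤ j → ∀ x ∈ Icc 0 α, u j x =
      ∫ ξ in (0 : ℝ)..x, Real.sin (√lam0 * (x - ξ)) / √lam0 * rhs q lam u j ξ := by
    intro j hj x hx
    rw [huj j hj]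
    simp only [newU, if_pos hx.2]
  have hright : ∀ j, 1 ≤ j → (∀ p < j, ContinuousOn (u p) (Icc 0 1)) → ∀ x ∈ Icc α 1, u j x =
      newC (rhs q lam u j) * Real.sin (√lam0 * (1 - x))
      - ∫ ξ in x..1, Real.sin (√lam0 * (x - ξ)) / √lam0 * rhs q lam u j ξ := by
    intro j hj hc x hx
    -- At x = α the definition uses the left formula; its agreement with the right one is the sine
    -- equation for c.
    rcases eq_or_lt_of_le hx.1 with rfl | hlt
    · rw [hleft j hj _ (right_mem_Icc.2 hα.1.le), (correct j hj hc).1]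
      have hG : IntervalIntegrable (fun ξ => Real.sin (√lam0 * (α - ξ)) / √lam0 * rhs q lam u j ξ)
          volume 0 1 := (intervalIntegrable_rhs (lam := lam) hq hj hc).continuousOn_mul (by fun_prop)
      have hαm : α ∈ Icc (0 : ℝ) 1 := Ioo_subset_Icc_self hα
      rw [integral_split hG hαm]
      ring
    · rw [huj j hj]
      simp only [newU, if_neg (not_le.2 hlt)]
  have hcont : ∀ j, ContinuousOn (u j) (Icc 0 1) := by
    intro j
    induction j using Nat.strong_induction_on with
    | _ j ih =>
      rcases Nat.eq_zero_or_pos j with rfl | hj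
      · rw [hu0]; exact (continuous_basicU hy h).continuousOn
      · have hF := intervalIntegrable_rhs (lam := lam) hq hj ih
        have hc := correct j hj ih
        exact continuousOn_of_volterra hF (corrector_volterra hα hF hc.1
          (by rw [hlamsq]; exact hc.2) (hleft j hj) (hright j hj ih)).1
  refine ⟨lam, u, fun j => if j = 0 then basicC α lam0 else newC (rhs q lam u j), ?_⟩
  have hcj : ∀ j, 1 ≤ j → (if j = 0 then basicC α lam0 else newC (rhs q lam u j)) =
      newC (rhs q lam u j) := fun j hj => if_neg (by omega)
  exact
    { lam_zero := hlam0
      c_zero := by simp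
      u_zero := hu0'
      lam_succ := hlamj
      c_sin := fun j hj => by rw [hcj j hj]; exact (correct j hj fun p _ => hcont p).1
      c_cos := fun j hj => by rw [hcj j hj]; exact (correct j hj fun p _ => hcont p).2
      u_left := hleft
      u_right := fun j hj x hx => by rw [hcj j hj]; exact hright j hj (fun p _ => hcont p) x hx }

end Method

/-! ### Norms, and bounds for the constants of the basic problem. -/

theorem abs_le_supNorm {f : ℝ → ℝ} (hf : ContinuousOn f (Icc 0 1)) {x : ℝ}
    (hx : x ∈ Icc (0 : ℝ) 1) : |f x| ≤ supNorm f :=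
  le_csSup (isCompact_Icc.image_of_continuousOn hf.abs).bddAbove ⟨x, hx, rfl⟩

theorem supNorm_le {f : ℝ → ℝ} {B : ℝ} (h : ∀ x ∈ Icc (0 : ℝ) 1, |f x| ≤ B) : supNorm f ≤ B :=
  csSup_le ⟨_, 0, by simp, rfl⟩ (by rintro _ ⟨x, hx, rfl⟩; exact h x hx)

theorem supNorm_nonneg (f : ℝ → ℝ) : 0 ≤ supNorm f :=
  Real.sSup_nonneg (by rintro _ ⟨x, -, rfl⟩; exact abs_nonneg _)

theorem supNorm_congr {f g : ℝ → ℝ} (h : ∀ x ∈ Icc (0 : ℝ) 1, f x = g x) :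
    supNorm f = supNorm g := by
  unfold supNorm
  congr 1
  exact image_congr fun x hx => by rw [h x hx]

theorem normL1_nonneg (q : ℝ → ℝ) : 0 ≤ normL1 q :=
  intervalIntegral.integral_nonneg zero_le_one fun _ _ => abs_nonneg _

theorem abs_integral_mul_le {g F : ℝ → ℝ} {a b D : ℝ} (ha : 0 ≤ a) (hab : a ≤ b) (hb : b ≤ 1)
    (hF : IntervalIntegrable F volume 0 1) (hD : 0 ≤ D) (hg : ∀ x ∈ Icc (0 : ℝ) 1, |g x| ≤ D) :
    |∫ ξ in a..b, g ξ * F ξ| ≤ D * normL1 F := by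
  have h1 : ‖∫ ξ in a..b, g ξ * F ξ‖ ≤ ∫ ξ in a..b, D * |F ξ| := by
    refine intervalIntegral.norm_integral_le_of_norm_le hab (Eventually.of_forall fun ξ hξ => ?_)
      ((intervalIntegrable_sub hF ⟨ha, hab.trans hb⟩ ⟨ha.trans hab, hb⟩).abs.const_mul _)
    rw [Real.norm_eq_abs, abs_mul]
    exact mul_le_mul_of_nonneg_right (hg ξ ⟨ha.trans hξ.1.le, hξ.2.trans hb⟩) (abs_nonneg _)
  refine h1.trans ?_
  rw [intervalIntegral.integral_const_mul]
  exact mul_le_mul_of_nonneg_left (intervalIntegral.integral_mono_interval ha hab hb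
    (Eventually.of_forall fun _ => abs_nonneg _) hF.abs) hD

section Basic

variable {α β lam0 : ℝ}

theorem basicU_right (hy : 0 < √lam0) (h : basicChar α β √lam0 = 0)
    {x : ℝ} (hx : x ∈ Icc α 1) :
    basicU α lam0 x = basicC α lam0 * Real.sin (√lam0 * (1 - x)) := by
  rcases eq_or_lt_of_le hx.1 with rfl | hlt
  · rw [basicU, if_pos le_rfl, (basicC_spec hy h).1]
  · rw [basicU, if_neg (not_le.2 hlt)]

/-- Substituting the matching conditions gives 1 = sin² a + cos² a = C² (sin² b + (cos b + t sin
b)²), where the bracket is at least 1. Thus a right piece of at most a quarter wave has no larger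
amplitude than the left piece. -/
theorem one_le_of_reflect {a b C t : ℝ} (ht : 0 ≤ t)
    (hb : 0 ≤ Real.sin b) (hb' : 0 ≤ Real.cos b)
    (h1 : Real.sin a = C * Real.sin b) (h2 : Real.cos a + t * Real.sin a = -(C * Real.cos b)) :
    C ^ 2 ≤ 1 := by
  have ha := Real.sin_sq_add_cos_sq a
  have hb1 := Real.sin_sq_add_cos_sq b
  have h3 : Real.cos a = -(C * (Real.cos b + t * Real.sin b)) := by
    linear_combination h2 - t * h1
  rw [h1, h3] at ha
  have h4 : 1 ≤ Real.sin b ^ 2 + (Real.cos b + t * Real.sin b) ^ 2 := by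
    have := mul_nonneg (mul_nonneg ht hb) hb'
    nlinarith [sq_nonneg (t * Real.sin b)]
  nlinarith [sq_nonneg C]

/-- `‖u⁽⁰⁾‖_∞ ≥ max{1, √c̃} / √λ⁽⁰⁾`. -/
theorem max_le_mul_supNorm (hα : α ∈ Ioo (0 : ℝ) 1) (hβ : 0 ≤ β) (hπ : Real.pi ≤ √lam0)
    (h : basicChar α β √lam0 = 0) :
    1 ≤ √lam0 * supNorm (basicU α lam0) ∧
      √(cTilde α β lam0) ≤ √lam0 * supNorm (basicU α lam0) := by
  have hpi := Real.pi_pos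
  have hy : 0 < √lam0 := hpi.trans_le hπ
  obtain ⟨h1, h2⟩ := basicC_spec hy h
  have hC := abs_basicC hy h
  have hCsq := sq_mul_basicC_sq hy h
  have hle := fun (x : ℝ) (hx : x ∈ Icc (0 : ℝ) 1) =>
    abs_le_supNorm (continuous_basicU hy h).continuousOn hx
  have hα1 : 0 < 1 - α := by linarith [hα.2]
  set y := √lam0
  -- A piece at least a quarter wave long contains a point where the sine is 1. As y ≥ π, one of the
  -- two pieces is that long, and if the other is not, its amplitude is the smaller one.
  have left : Real.pi / 2 ≤ y * α → 1 ≤ y * supNorm (basicU α lam0) := by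
    intro hl
    have hx : Real.pi / 2 / y ≤ α := by rw [div_le_iff₀ hy]; linarith
    have := hle (Real.pi / 2 / y) ⟨by positivity, hx.trans hα.2.le⟩
    rw [basicU, if_pos hx] at this
    change |Real.sin (y * (Real.pi / 2 / y)) / y| ≤ _ at this
    rw [mul_div_cancel₀ _ hy.ne', Real.sin_pi_div_two, abs_of_pos (by positivity),
      div_le_iff₀ hy] at this
    linarith
  have right : Real.pi / 2 ≤ y * (1 - α) → √(cTilde α β lam0) ≤ y * supNorm (basicU α lam0) := by
    intro hl
    have hx : Real.pi / 2 / y ≤ 1 - α := by rw [div_le_iff₀ hy]; linarith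
    have hx0 : 0 ≤ Real.pi / 2 / y := by positivity
    have := hle (1 - Real.pi / 2 / y) ⟨by linarith [hα.1], by linarith⟩
    rw [basicU_right hy h ⟨by linarith, by linarith⟩, sub_sub_cancel] at this
    change |basicC α lam0 * Real.sin (y * (Real.pi / 2 / y))| ≤ _ at this
    rw [mul_div_cancel₀ _ hy.ne', Real.sin_pi_div_two, mul_one, hC, div_le_iff₀ hy] at this
    linarith
  have hsum : y * α + y * (1 - α) = y := by ring
  have hβy : 0 ≤ β / y := by positivity
  rcases le_or_gt (Real.pi / 2) (y * α) with hl | hl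
  · rcases le_or_gt (Real.pi / 2) (y * (1 - α)) with hr | hr
    · exact ⟨left hl, right hr⟩
    · refine ⟨left hl, le_trans ?_ (left hl)⟩
      refine (Real.sqrt_le_sqrt ?_).trans_eq Real.sqrt_one
      rw [← hCsq, ← mul_pow]
      have hb0 : 0 ≤ y * (1 - α) := by positivity
      refine one_le_of_reflect (a := y * α) (b := y * (1 - α)) hβy
        (Real.sin_nonneg_of_nonneg_of_le_pi hb0 (by linarith))
        (Real.cos_nonneg_of_mem_Icc ⟨by linarith, hr.le⟩) ?_ ?_
      · rw [div_eq_iff hy.ne'] at h1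
        linear_combination h1
      · linear_combination -h2
  · have hr : Real.pi / 2 ≤ y * (1 - α) := by linarith
    refine ⟨le_trans ?_ (right hr), right hr⟩
    rw [Real.one_le_sqrt, cTilde]
    change 1 ≤ Real.sin (y * α) ^ 2 + (Real.cos (y * α) + β / y * Real.sin (y * α)) ^ 2
    have ha0 : 0 ≤ y * α := mul_nonneg hy.le hα.1.le
    have hs := Real.sin_nonneg_of_nonneg_of_le_pi ha0 (by linarith)
    have hc := Real.cos_nonneg_of_mem_Icc (x := y * α) ⟨by linarith, hl.le⟩
    have ha := Real.sin_sq_add_cos_sq (y * α)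
    have := mul_nonneg (mul_nonneg hβy hs) hc
    nlinarith [sq_nonneg (β / y * Real.sin (y * α))]

theorem mul_supNorm_le (hy : 0 < √lam0) (h : basicChar α β √lam0 = 0) :
    √lam0 * supNorm (basicU α lam0) ≤ max 1 √(cTilde α β lam0) := by
  rw [← le_div_iff₀' hy]
  refine supNorm_le fun x hx => ?_
  rcases le_total x α with hxα | hxα
  · rw [basicU, if_pos hxα, abs_div, abs_of_pos hy]
    gcongr
    exact (Real.abs_sin_le_one _).trans (le_max_left _ _)
  · rw [basicU_right hy h ⟨hxα, hx.2⟩, abs_mul, abs_basicC hy h]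
    calc _ ≤ √(cTilde α β lam0) / √lam0 * 1 := by
          gcongr
          exact Real.abs_sin_le_one _
      _ ≤ _ := by
          rw [mul_one]
          gcongr
          exact le_max_right _ _

theorem one_le_b : 1 ≤ b α β lam0 := le_max_left _ _

/-- The purpose of b: it absorbs the factor (λ⁽⁰⁾/M) ‖u⁽⁰⁾‖ in the formula for λ⁽ʲ⁾, because y
‖u⁽⁰⁾‖ ≤ max{1, √c̃}. -/
theorem lam0_div_M_mul_supNorm_le (hα : α ∈ Ioo (0 : ℝ) 1) (hy : 0 < √lam0)
    (h : basicChar α β √lam0 = 0) :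
    lam0 / M α lam0 * supNorm (basicU α lam0) ≤ b α β lam0 := by
  have hM := M_pos hy h hα
  have hlam : √lam0 ^ 2 = lam0 := Real.sq_sqrt (Real.sqrt_pos.1 hy).le
  calc _ = √lam0 / M α lam0 * (√lam0 * supNorm (basicU α lam0)) := by
        nth_rw 1 [← hlam]; ring
    _ ≤ √lam0 / M α lam0 * max 1 √(cTilde α β lam0) :=
        mul_le_mul_of_nonneg_left (mul_supNorm_le hy h) (by positivity)
    _ = max (√lam0 / M α lam0) (√lam0 * √(cTilde α β lam0) / M α lam0) := by
        rw [mul_max_of_nonneg _ _ (by positivity), mul_one]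
        congr 1
        ring
    _ ≤ _ := le_max_right _ _

theorem v0_nonneg : 0 ≤ v0 α β lam0 :=
  mul_nonneg (zero_le_one.trans one_le_b) (supNorm_nonneg _)

/-- Each entry of the maximum comes from one entry of b and a lower bound for y ‖u⁽⁰⁾‖. It brings
the explicit denominator into the eigenvalue estimate. -/
theorem max_le_M_mul_v0 (hα : α ∈ Ioo (0 : ℝ) 1) (hβ : 0 ≤ β) (hπ : Real.pi ≤ √lam0)
    (h : basicChar α β √lam0 = 0) :
    max 1 (max (cTilde α β lam0) (√(cTilde α β lam0) * M α lam0 / √lam0)) ≤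
      M α lam0 * v0 α β lam0 := by
  have hy : 0 < √lam0 := Real.pi_pos.trans_le hπ
  have hM := M_pos hy h hα
  obtain ⟨h1, h2⟩ := max_le_mul_supNorm hα hβ hπ h
  have hc := cTilde_pos α β lam0
  have hU := supNorm_nonneg (basicU α lam0)
  have b1 : √lam0 / M α lam0 ≤ b α β lam0 := (le_max_left _ _).trans (le_max_right _ _)
  have b2 : √lam0 * √(cTilde α β lam0) / M α lam0 ≤ b α β lam0 :=
    (le_max_right _ _).trans (le_max_right _ _)
  have key : ∀ t, t ≤ b α β lam0 →
      M α lam0 * (t * supNorm (basicU α lam0)) ≤ M α lam0 * v0 α β lam0 := fun t ht =>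
    mul_le_mul_of_nonneg_left (mul_le_mul_of_nonneg_right ht hU) hM.le
  refine max_le ?_ (max_le ?_ ?_)
  · refine le_trans ?_ (key _ b1)
    calc (1 : ℝ) ≤ _ := h1
      _ = _ := by field_simp
  · refine le_trans ?_ (key _ b2)
    calc cTilde α β lam0 = √(cTilde α β lam0) * √(cTilde α β lam0) := (Real.mul_self_sqrt hc.le).symm
      _ ≤ √(cTilde α β lam0) * (√lam0 * supNorm (basicU α lam0)) :=
          mul_le_mul_of_nonneg_left h2 (Real.sqrt_nonneg _)
      _ = _ := by field_simp
  · refine le_trans ?_ (key _ one_le_b)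
    rw [div_le_iff₀ hy]
    calc _ ≤ √lam0 * supNorm (basicU α lam0) * M α lam0 := mul_le_mul_of_nonneg_right h2 hM.le
      _ = _ := by ring

/-- w₁ = (√v̄₀ + √(1 + v̄₀))², whose reciprocal is the conjugate 1 + 2 v̄₀ - 2 √(v̄₀ (1 + v̄₀)). -/
theorem w1_add_inv : 1 ≤ w1 α β lam0 ∧ w1 α β lam0 + (w1 α β lam0)⁻¹ = 2 + 4 * v0 α β lam0 := by
  have hv : 0 ≤ v0 α β lam0 := v0_nonneg
  have hsq := Real.sq_sqrt (show 0 ≤ v0 α β lam0 * (1 + v0 α β lam0) by positivity)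
  have hs := Real.sqrt_nonneg (v0 α β lam0 * (1 + v0 α β lam0))
  unfold w1
  set s := √(v0 α β lam0 * (1 + v0 α β lam0))
  have h1 : 1 ≤ 1 + 2 * v0 α β lam0 + 2 * s := by linarith
  refine ⟨h1, ?_⟩
  have : (1 + 2 * v0 α β lam0 + 2 * s)⁻¹ = 1 + 2 * v0 α β lam0 - 2 * s := by
    refine inv_eq_of_mul_eq_one_right ?_
    linear_combination (-4 : ℝ) * hsq
  rw [this]
  ring

end Basic

/-! ### Estimates of the corrections and of the tails. -/

section Method

variable {α β : ℝ} {q : ℝ → ℝ} {lam0 : ℝ} {lam : ℕ → ℝ} {u : ℕ → ℝ → ℝ} {c : ℕ → ℝ}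

/-- The bound for the solution operator of the corrections. -/
noncomputable def solutionBound (β lam0 : ℝ) : ℝ := (1 + √(1 + (1 + β / √lam0) ^ 2)) / √lam0

theorem solutionBound_pos (hy : 0 < √lam0) : 0 < solutionBound β lam0 := by
  unfold solutionBound
  positivity

/-- Squaring and adding the two equations for c⁽ʲ⁾ avoids division by a possibly small sine or
cosine and gives |c⁽ʲ⁾| ≤ √(1 + (1 + β/y)²) ‖F⁽ʲ⁾‖ / y in terms of the L¹-norm; the Duhamel integral
adds ‖F⁽ʲ⁾‖ / y. -/
theorem IsFDMethod.supNorm_le (hα : α ∈ Ioo (0 : ℝ) 1) (hβ : 0 ≤ β) (hy : 0 < √lam0)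
    (hM : IsFDMethod α β q lam0 lam u c) {j : ℕ} (hj : 1 ≤ j)
    (hF : IntervalIntegrable (rhs q lam u j) volume 0 1) :
    supNorm (u j) ≤ solutionBound β lam0 * normL1 (rhs q lam u j) := by
  have hlam : √lam0 ^ 2 = lam0 := Real.sq_sqrt (Real.sqrt_pos.1 hy).le
  have hlam0 : 0 < lam0 := Real.sqrt_pos.1 hy
  have hI := normL1_nonneg (rhs q lam u j)
  have hs : ∀ z x : ℝ, |Real.sin (√lam0 * (z - x)) / √lam0| ≤ 1 / √lam0 := fun z x => by
    rw [abs_div, abs_of_pos hy]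
    gcongr
    exact Real.abs_sin_le_one _
  have hi : 0 ≤ 1 / √lam0 := by positivity
  have hc : |c j| ≤ √(1 + (1 + β / √lam0) ^ 2) / √lam0 * normL1 (rhs q lam u j) := by
    have hA := abs_integral_mul_le le_rfl zero_le_one le_rfl hF hi (fun x _ => hs α x)
    have hB1 := abs_integral_mul_le (g := fun ξ => Real.cos (√lam0 * (α - ξ)) / √lam0)
      le_rfl zero_le_one le_rfl hF hi (fun x _ => by
        rw [abs_div, abs_of_pos hy]
        gcongr
        exact Real.abs_cos_le_one _)
    have hB2 := abs_integral_mul_le (g := fun ξ => Real.sin (√lam0 * (α - ξ)) / lam0)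
      le_rfl hα.1.le hα.2.le hF (show 0 ≤ 1 / lam0 by positivity) (fun x _ => by
        rw [abs_div, abs_of_pos hlam0]
        gcongr
        exact Real.abs_sin_le_one _)
    rw [← hM.c_sin j hj] at hA
    have hB : |c j * Real.cos (√lam0 * (1 - α))| ≤
        (1 + β / √lam0) * (1 / √lam0 * normL1 (rhs q lam u j)) := by
      rw [hM.c_cos j hj]
      refine (abs_sub _ _).trans ?_
      rw [abs_neg, abs_mul, abs_of_nonneg hβ]
      refine (add_le_add hB1 (mul_le_mul_of_nonneg_left hB2 hβ)).trans_eq ?_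
      have hinv : 1 / lam0 = 1 / √lam0 * (1 / √lam0) := by
        rw [← hlam, Real.sqrt_sq hy.le]; field_simp
      rw [hinv]
      ring
    set T := 1 / √lam0 * normL1 (rhs q lam u j) with hT
    have hT0 : 0 ≤ T := by positivity
    have hβy : 0 ≤ 1 + β / √lam0 := by positivity
    have e : √(1 + (1 + β / √lam0) ^ 2) / √lam0 * normL1 (rhs q lam u j) =
        √(1 + (1 + β / √lam0) ^ 2) * T := by rw [hT]; ring
    rw [e]
    refine abs_le_of_sq_le_sq ?_ (by positivity)
    rw [mul_pow, Real.sq_sqrt (by positivity)]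
    have hb := Real.sin_sq_add_cos_sq (√lam0 * (1 - α))
    have hA2 := sq_le_sq' (abs_le.1 hA).1 (abs_le.1 hA).2
    have hB2 := sq_le_sq' (abs_le.1 hB).1 (abs_le.1 hB).2
    calc c j ^ 2 = (c j * Real.sin (√lam0 * (1 - α))) ^ 2 +
          (c j * Real.cos (√lam0 * (1 - α))) ^ 2 := by linear_combination (-c j ^ 2) * hb
      _ ≤ T ^ 2 + ((1 + β / √lam0) * T) ^ 2 := add_le_add hA2 hB2
      _ = _ := by ring
  have e : solutionBound β lam0 * normL1 (rhs q lam u j) =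
      √(1 + (1 + β / √lam0) ^ 2) / √lam0 * normL1 (rhs q lam u j) +
        1 / √lam0 * normL1 (rhs q lam u j) := by
    rw [solutionBound]; ring
  rw [e]
  refine FD.supNorm_le fun x hx => ?_
  rcases le_total x α with hxα | hxα
  · rw [hM.u_left j hj x ⟨hx.1, hxα⟩]
    refine (abs_integral_mul_le le_rfl hx.1 hx.2 hF hi (fun t _ => hs x t)).trans ?_
    have := (abs_nonneg _).trans hc
    linarith
  · rw [hM.u_right j hj x ⟨hxα, hx.2⟩]
    refine (abs_sub _ _).trans (add_le_add ?_
      (abs_integral_mul_le hx.1 hx.2 le_rfl hF hi (fun t _ => hs x t)))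
    rw [abs_mul]
    exact (mul_le_of_le_one_right (abs_nonneg _) (Real.abs_sin_le_one _)).trans hc

theorem normL1_rhs_le (hq : IntervalIntegrable q volume 0 1) {j : ℕ} (hj : 1 ≤ j)
    (hu : ∀ p < j, ContinuousOn (u p) (Icc 0 1)) :
    normL1 (rhs q lam u j) ≤ ∑ p ∈ Finset.range j, |lam (j - p)| * supNorm (u p) +
      normL1 q * supNorm (u (j - 1)) := by
  have hF := intervalIntegrable_rhs (lam := lam) hq hj hu
  have hle : normL1 (rhs q lam u j) ≤ ∫ x in (0 : ℝ)..1,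
      (∑ p ∈ Finset.range j, |lam (j - p)| * supNorm (u p) + |q x| * supNorm (u (j - 1))) := by
    refine intervalIntegral.integral_mono_on zero_le_one hF.abs
      (intervalIntegrable_const.add (hq.abs.mul_const _)) fun x hx => ?_
    refine (abs_add_le _ _).trans (add_le_add ?_ ?_)
    · rw [abs_neg]
      refine (Finset.abs_sum_le_sum_abs _ _).trans (Finset.sum_le_sum fun p hp => ?_)
      rw [abs_mul]
      exact mul_le_mul_of_nonneg_left (abs_le_supNorm (hu p (Finset.mem_range.1 hp)) hx)
        (abs_nonneg _)
    · rw [abs_mul]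
      exact mul_le_mul_of_nonneg_left (abs_le_supNorm (hu (j - 1) (by omega)) hx) (abs_nonneg _)
  rw [intervalIntegral.integral_add intervalIntegrable_const (hq.abs.mul_const _),
    intervalIntegral.integral_const, intervalIntegral.integral_mul_const] at hle
  simpa [normL1] using hle

/-- The estimates of the individual corrections. -/
theorem IsFDMethod.correction_le (hα : α ∈ Ioo (0 : ℝ) 1) (hβ : 0 ≤ β) (hπ : Real.pi ≤ √lam0)
    (h : basicChar α β √lam0 = 0) (hq : IntervalIntegrable q volume 0 1)
    (hM : IsFDMethod α β q lam0 lam u c) {j : ℕ} (hj : 1 ≤ j) :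
    b α β lam0 * supNorm (u j) ≤ alphaCoeff j * r α β q lam0 ^ j ∧
      |lam j| ≤ alphaCoeff j * r α β q lam0 ^ j /
        (solutionBound β lam0 * (1 + v0 α β lam0)) := by
  have hy : 0 < √lam0 := Real.pi_pos.trans_le hπ
  have hlam0 : 0 < lam0 := Real.sqrt_pos.1 hy
  have hMp := M_pos hy h hα
  have hcont := hM.continuousOn hα hy h hq
  have hb : 1 ≤ b α β lam0 := one_le_b
  have hb0 : 0 ≤ b α β lam0 := zero_le_one.trans hb
  have hv0 : 0 ≤ v0 α β lam0 := v0_nonneg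
  have hK := solutionBound_pos (β := β) hy
  have hN := normL1_nonneg q
  have hU0 : supNorm (u 0) = supNorm (basicU α lam0) := supNorm_congr hM.u_zero
  have hint : ∀ f : ℝ → ℝ, ∀ p, |∫ ξ in (0 : ℝ)..1, f ξ * u p ξ| =
    |∫ ξ in (0 : ℝ)..1, u p ξ * f ξ| := fun f p => by
      congr 1; exact intervalIntegral.integral_congr fun ξ _ => mul_comm _ _
  -- With the norms weighted by b, the inequality for |λ⁽ʲ⁾| contains no constant besides ‖q‖.
  have hlam : ∀ j, 1 ≤ j → |lam j| ≤ ∑ p ∈ Finset.Ico 1 j,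
      |lam (j - p)| * (b α β lam0 * supNorm (u p)) +
        normL1 q * (b α β lam0 * supNorm (u (j - 1))) := by
    intro j hj
    have hfac : 0 ≤ lam0 / M α lam0 := by positivity
    have hfb := lam0_div_M_mul_supNorm_le hα hy h
    rw [hM.lam_succ j hj, abs_mul, abs_of_nonneg hfac]
    have h1 : ∀ p, |∫ ξ in (0 : ℝ)..1, u 0 ξ * u p ξ| ≤
        supNorm (basicU α lam0) * supNorm (u p) := by
      intro p
      refine (abs_integral_mul_le le_rfl zero_le_one le_rfl
        ((hcont p).intervalIntegrable_of_Icc zero_le_one) (supNorm_nonneg _)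
        (fun x hx => abs_le_supNorm (hcont 0) hx)).trans ?_
      rw [hU0]
      refine mul_le_mul_of_nonneg_left ?_ (supNorm_nonneg _)
      calc normL1 (u p) ≤ ∫ x in (0 : ℝ)..1, supNorm (u p) :=
            intervalIntegral.integral_mono_on zero_le_one
              ((hcont p).abs.intervalIntegrable_of_Icc zero_le_one) intervalIntegrable_const
              fun x hx => abs_le_supNorm (hcont p) hx
        _ = supNorm (u p) := by simp
    have h2 : |∫ ξ in (0 : ℝ)..1, q ξ * u (j - 1) ξ * u 0 ξ| ≤
        supNorm (u (j - 1)) * supNorm (basicU α lam0) * normL1 q := by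
      have e : ∫ ξ in (0 : ℝ)..1, q ξ * u (j - 1) ξ * u 0 ξ =
          ∫ ξ in (0 : ℝ)..1, (u (j - 1) ξ * u 0 ξ) * q ξ :=
        intervalIntegral.integral_congr fun ξ _ => by ring
      rw [e, ← hU0]
      refine abs_integral_mul_le le_rfl zero_le_one le_rfl hq
        (mul_nonneg (supNorm_nonneg _) (supNorm_nonneg _)) fun x hx => ?_
      rw [abs_mul]
      exact mul_le_mul (abs_le_supNorm (hcont _) hx) (abs_le_supNorm (hcont 0) hx) (abs_nonneg _)
        (supNorm_nonneg _)
    calc _ ≤ lam0 / M α lam0 * (∑ p ∈ Finset.Ico 1 j, |lam (j - p)| *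
            (supNorm (basicU α lam0) * supNorm (u p)) +
          supNorm (u (j - 1)) * supNorm (basicU α lam0) * normL1 q) := by
          refine mul_le_mul_of_nonneg_left ((abs_add_le _ _).trans (add_le_add ?_ h2)) hfac
          rw [abs_neg]
          refine (Finset.abs_sum_le_sum_abs _ _).trans (Finset.sum_le_sum fun p _ => ?_)
          rw [abs_mul]
          exact mul_le_mul_of_nonneg_left (h1 p) (abs_nonneg _)
      _ = ∑ p ∈ Finset.Ico 1 j, |lam (j - p)| *
            (lam0 / M α lam0 * supNorm (basicU α lam0) * supNorm (u p)) +
          normL1 q * (lam0 / M α lam0 * supNorm (basicU α lam0) * supNorm (u (j - 1))) := by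
          rw [mul_add, Finset.mul_sum]
          congr 1
          · exact Finset.sum_congr rfl fun p _ => by ring
          · ring
      _ ≤ _ := by
          refine add_le_add (Finset.sum_le_sum fun p _ => ?_) ?_
          · exact mul_le_mul_of_nonneg_left
              (mul_le_mul_of_nonneg_right hfb (supNorm_nonneg _)) (abs_nonneg _)
          · exact mul_le_mul_of_nonneg_left
              (mul_le_mul_of_nonneg_right hfb (supNorm_nonneg _)) hN
  -- After weighting, the term p = 0 of F⁽ʲ⁾ contributes |λ⁽ʲ⁾| v̄₀ ≤ S v̄₀; this is the origin of
  -- the factor 1 + v̄₀ in w₂.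
  have hu : ∀ j, 1 ≤ j → b α β lam0 * supNorm (u j) ≤ solutionBound β lam0 * (1 + v0 α β lam0) *
      (∑ p ∈ Finset.Ico 1 j, |lam (j - p)| * (b α β lam0 * supNorm (u p)) +
        normL1 q * (b α β lam0 * supNorm (u (j - 1)))) := by
    intro j hj
    have hF := intervalIntegrable_rhs (lam := lam) hq hj fun p _ => hcont p
    have h1 := hM.supNorm_le hα hβ hy hj hF
    have h2 := normL1_rhs_le (lam := lam) hq hj fun p _ => hcont p
    rw [Finset.range_eq_Ico, Finset.sum_eq_sum_Ico_succ_bot (by omega), Nat.sub_zero, hU0,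
      zero_add] at h2
    have h3 := hlam j hj
    set S := ∑ p ∈ Finset.Ico 1 j, |lam (j - p)| * (b α β lam0 * supNorm (u p)) +
        normL1 q * (b α β lam0 * supNorm (u (j - 1))) with hS
    have e : b α β lam0 * (|lam j| * supNorm (basicU α lam0) +
        ∑ p ∈ Finset.Ico 1 j, |lam (j - p)| * supNorm (u p) + normL1 q * supNorm (u (j - 1))) =
        |lam j| * v0 α β lam0 + S := by
      rw [hS, v0, mul_add, mul_add, Finset.mul_sum]
      have : ∀ p, b α β lam0 * (|lam (j - p)| * supNorm (u p)) =
        |lam (j - p)| * (b α β lam0 * supNorm (u p)) := fun p => by ring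
      simp only [this]
      ring
    calc _ ≤ b α β lam0 * (solutionBound β lam0 * (|lam j| * supNorm (basicU α lam0) +
          ∑ p ∈ Finset.Ico 1 j, |lam (j - p)| * supNorm (u p) +
            normL1 q * supNorm (u (j - 1)))) :=
          mul_le_mul_of_nonneg_left (h1.trans (mul_le_mul_of_nonneg_left h2 hK.le)) hb0
      _ = solutionBound β lam0 * (|lam j| * v0 α β lam0 + S) := by rw [← e]; ring
      _ ≤ solutionBound β lam0 * (S * v0 α β lam0 + S) := by gcongr
      _ = _ := by ring
  obtain ⟨hw, hwv⟩ := w1_add_inv (α := α) (β := β) (lam0 := lam0)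
  have := recurrence_majorized (ℓ := fun j => |lam j|) (v := fun j => b α β lam0 * supNorm (u j))
    hN (show 0 < solutionBound β lam0 * (1 + v0 α β lam0) by positivity) hv0 hw hwv
    (fun j => mul_nonneg hb0 (supNorm_nonneg _)) (by rw [hU0, v0]) hlam hu j hj
  have hr : w1 α β lam0 * (solutionBound β lam0 * (1 + v0 α β lam0) * normL1 q) = r α β q lam0 := by
    rw [r, invR, w2, solutionBound]; ring
  rwa [hr] at this

theorem r_nonneg (hy : 0 < √lam0) : 0 ≤ r α β q lam0 := by
  have h1 : 0 ≤ w1 α β lam0 := zero_le_one.trans w1_add_inv.1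
  have h2 : 0 ≤ v0 α β lam0 := v0_nonneg
  have h3 := normL1_nonneg q
  unfold r invR w2
  positivity

/-- Since α_j decreases, α_{m+1} can be taken out of the tail, leaving a geometric series. -/
theorem tail_bound {f : ℕ → ℝ} {ρ D : ℝ} (hρ : 0 ≤ ρ) (hρ1 : ρ < 1) (hD : 0 ≤ D)
    (hf0 : ∀ j, 0 ≤ f j) (hf : ∀ j, 1 ≤ j → f j ≤ alphaCoeff j * ρ ^ j * D) :
    Summable f ∧ ∀ m, ∑' j, f (m + 1 + j) ≤ alphaCoeff (m + 1) * ρ ^ (m + 1) / (1 - ρ) * D := by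
  have hle : ∀ m j, f (m + 1 + j) ≤ alphaCoeff (m + 1) * ρ ^ (m + 1) * D * ρ ^ j := by
    intro m j
    calc f (m + 1 + j) ≤ alphaCoeff (m + j + 1) * ρ ^ (m + 1 + j) * D := by
          have := hf (m + 1 + j) (by omega)
          rwa [show m + 1 + j = m + j + 1 by omega] at this ⊢
      _ ≤ alphaCoeff (m + 1) * ρ ^ (m + 1 + j) * D := by
          gcongr
          exact alphaCoeff_antitone (by omega)
      _ = _ := by rw [pow_add]; ring
  have hg := (hasSum_geometric_of_lt_one hρ hρ1)
  have hs : ∀ m, Summable fun j => f (m + 1 + j) := fun m =>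
    Summable.of_nonneg_of_le (fun j => hf0 _) (hle m) (hg.summable.mul_left _)
  refine ⟨?_, fun m => ?_⟩
  · rw [← summable_nat_add_iff 1]
    exact (hs 0).congr fun j => by rw [zero_add, add_comm]
  · refine ((hs m).tsum_le_tsum (hle m) (hg.summable.mul_left _)).trans_eq ?_
    rw [tsum_mul_left, hg.tsum_eq]
    ring

theorem IsFDMethod.summable_supNorm (hα : α ∈ Ioo (0 : ℝ) 1) (hβ : 0 ≤ β) (hπ : Real.pi ≤ √lam0)
    (h : basicChar α β √lam0 = 0) (hq : IntervalIntegrable q volume 0 1)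
    (hr : r α β q lam0 < 1) (hM : IsFDMethod α β q lam0 lam u c) :
    Summable (fun j => supNorm (u j)) ∧
      ∀ m, ∑' j, supNorm (u (m + 1 + j)) ≤ boundU α β q lam0 m := by
  have hy : 0 < √lam0 := Real.pi_pos.trans_le hπ
  have hb : 0 < b α β lam0 := zero_lt_one.trans_le one_le_b
  have hρ : 0 ≤ r α β q lam0 := r_nonneg hy
  obtain ⟨h1, h2⟩ := tail_bound hρ hr (inv_pos.2 hb).le (fun j => supNorm_nonneg (u j))
    (fun j hj => by
      rw [← div_eq_mul_inv, le_div_iff₀' hb]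
      exact (hM.correction_le hα hβ hπ h hq hj).1)
  refine ⟨h1, fun m => (h2 m).trans ?_⟩
  have hMp := M_pos hy h hα
  have hc : 0 < √(cTilde α β lam0) := Real.sqrt_pos.2 (cTilde_pos _ _ _)
  have b1 : √lam0 / M α lam0 ≤ b α β lam0 := (le_max_left _ _).trans (le_max_right _ _)
  have b2 : √lam0 * √(cTilde α β lam0) / M α lam0 ≤ b α β lam0 :=
    (le_max_right _ _).trans (le_max_right _ _)
  -- The minimum in the bound is 1/(M b) written out; only this inequality is needed.
  have hmin : (b α β lam0)⁻¹ ≤ M α lam0 *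
      min (1 / M α lam0) (min (1 / √lam0) (1 / (√lam0 * √(cTilde α β lam0)))) := by
    rw [mul_min_of_nonneg _ _ hMp.le, mul_min_of_nonneg _ _ hMp.le]
    have key : ∀ t, 0 < t → t / M α lam0 ≤ b α β lam0 → (b α β lam0)⁻¹ ≤ M α lam0 * (1 / t) := by
      intro t ht htb
      have := inv_anti₀ (by positivity) htb
      rwa [inv_div, div_eq_mul_one_div] at this
    refine le_min (key _ hMp ?_) (le_min (key _ hy b1) (key _ (by positivity) b2))
    rw [div_self hMp.ne']
    exact one_le_b
  have hr1 : 0 < 1 - r α β q lam0 := by linarith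
  have ha := alphaCoeff_nonneg (m + 1)
  rw [boundU, C]
  calc _ ≤ alphaCoeff (m + 1) * r α β q lam0 ^ (m + 1) / (1 - r α β q lam0) * (M α lam0 *
      min (1 / M α lam0) (min (1 / √lam0) (1 / (√lam0 * √(cTilde α β lam0))))) :=
        mul_le_mul_of_nonneg_left hmin (by positivity)
    _ = _ := by ring

theorem IsFDMethod.summable_lam (hα : α ∈ Ioo (0 : ℝ) 1) (hβ : 0 ≤ β) (hπ : Real.pi ≤ √lam0)
    (h : basicChar α β √lam0 = 0) (hq : IntervalIntegrable q volume 0 1)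
    (hr : r α β q lam0 < 1) (hM : IsFDMethod α β q lam0 lam u c) :
    Summable (fun j => |lam j|) ∧ ∀ m, ∑' j, |lam (m + 1 + j)| ≤ boundLam α β q lam0 m := by
  have hy : 0 < √lam0 := Real.pi_pos.trans_le hπ
  have hv : 0 ≤ v0 α β lam0 := v0_nonneg
  have hK := solutionBound_pos (β := β) hy
  have hκ : 0 < solutionBound β lam0 * (1 + v0 α β lam0) := by positivity
  have hρ : 0 ≤ r α β q lam0 := r_nonneg hy
  obtain ⟨h1, h2⟩ := tail_bound hρ hr (inv_pos.2 hκ).le (fun j => abs_nonneg (lam j))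
    (fun j hj => by
      rw [← div_eq_mul_inv]
      exact (hM.correction_le hα hβ hπ h hq hj).2)
  refine ⟨h1, fun m => (h2 m).trans ?_⟩
  have hMp := M_pos hy h hα
  have hr1 : 0 < 1 - r α β q lam0 := by linarith
  have ha := alphaCoeff_nonneg (m + 1)
  have hw : 0 ≤ w1 α β lam0 := zero_le_one.trans w1_add_inv.1
  have hN := normL1_nonneg q
  have hmax := max_le_M_mul_v0 hα hβ hπ h
  set k := max 1 (max (cTilde α β lam0) (√(cTilde α β lam0) * M α lam0 / √lam0)) with hk
  have hk0 : 0 < k := zero_lt_one.trans_le (le_max_left _ _)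
  -- One factor r cancels against κ without dividing by ‖q‖, which may be zero. What remains, w₁
  -- ‖q‖, is 1/R without its factor 1 + v̄₀.
  have hre : r α β q lam0 = solutionBound β lam0 * (1 + v0 α β lam0) *
      (w1 α β lam0 * normL1 q) := by
    rw [r, invR, w2, solutionBound]; ring
  -- Restores that factor, by M + max{…} ≤ M (1 + v̄₀).
  have hone : 1 ≤ M α lam0 / (M α lam0 + k) * (1 + v0 α β lam0) := by
    rw [div_mul_eq_mul_div, le_div_iff₀ (by positivity)]
    linarith
  rw [boundLam, C, ← hk, invR, w2]
  calc alphaCoeff (m + 1) * r α β q lam0 ^ (m + 1) / (1 - r α β q lam0) *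
        (solutionBound β lam0 * (1 + v0 α β lam0))⁻¹
      = alphaCoeff (m + 1) * r α β q lam0 ^ m / (1 - r α β q lam0) *
        (w1 α β lam0 * normL1 q) := by
        rw [pow_succ]
        have : r α β q lam0 * (solutionBound β lam0 * (1 + v0 α β lam0))⁻¹ =
          w1 α β lam0 * normL1 q := by
          rw [hre, mul_comm (solutionBound β lam0 * (1 + v0 α β lam0)),
            mul_inv_cancel_right₀ hκ.ne']
        rw [← this]
        ring
    _ ≤ alphaCoeff (m + 1) * r α β q lam0 ^ m / (1 - r α β q lam0) *
        (w1 α β lam0 * normL1 q) * (M α lam0 / (M α lam0 + k) * (1 + v0 α β lam0)) :=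
        le_mul_of_one_le_right (by positivity) hone
    _ = _ := by ring

end Method

/-! ### The homotopy t q and the index of the limit. -/

theorem hasSum_of_eq {f g : ℕ → ℝ} {a : ℝ} (hg : HasSum g a) (h : ∀ j, f j = g j) :
    HasSum f a := by
  rwa [funext h]

theorem abs_tsum_le {f : ℕ → ℝ} (hf : Summable f) : |∑' j, f j| ≤ ∑' j, |f j| := by
  simpa only [Real.norm_eq_abs] using norm_tsum_le_tsum_norm hf.norm

section Homotopy

variable {α β : ℝ} {q : ℝ → ℝ} {lam0 : ℝ} {lam : ℕ → ℝ} {u : ℕ → ℝ → ℝ} {t : ℝ}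

theorem abs_pow_mul_le (ht : |t| ≤ 1) (j : ℕ) (a : ℝ) : |t ^ j * a| ≤ |a| := by
  rw [abs_mul, abs_pow]
  exact mul_le_of_le_one_left (abs_nonneg _) (pow_le_one₀ (abs_nonneg _) ht)

theorem summable_pow_mul (ht : |t| ≤ 1) {f B : ℕ → ℝ} (hB : Summable B) (h : ∀ j, |f j| ≤ B j) :
    Summable fun j => |t ^ j * f j| :=
  Summable.of_nonneg_of_le (fun _ => abs_nonneg _)
    (fun j => (abs_pow_mul_le ht j _).trans (h j)) hB

/-- The double sum in F⁽ʲ⁾ is the Cauchy product of ∑ tʲ u⁽ʲ⁾ with the series of the λ⁽ʲ⁾ without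
its zeroth term, hence the summand `lam 0` on the right. -/
theorem hasSum_rhs (ht : |t| ≤ 1) (hu : ∀ j, ContinuousOn (u j) (Icc 0 1))
    (hsu : Summable fun j => supNorm (u j)) (hsl : Summable fun j => |lam j|) {ξ : ℝ}
    (hξ : ξ ∈ Icc (0 : ℝ) 1) :
    HasSum (fun j => t ^ (j + 1) * rhs q lam u (j + 1) ξ)
      ((t * q ξ - ∑' j, t ^ j * lam j + lam 0) * ∑' j, t ^ j * u j ξ) := by
  have sl := summable_pow_mul ht hsl fun _ => le_rfl
  have su := summable_pow_mul ht hsu fun j => abs_le_supNorm (hu j) hξ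
  have h1 := hasSum_sum_range_mul_of_summable_norm su.of_abs.norm
    ((summable_nat_add_iff 1).2 sl.of_abs).norm
  have h2 := su.of_abs.hasSum.mul_left (t * q ξ)
  have h3 := sl.of_abs.sum_add_tsum_nat_add 1
  rw [Finset.sum_range_one, pow_zero, one_mul] at h3
  rw [← h3]
  have h4 : (t * q ξ) * ∑' j, t ^ j * u j ξ -
      (∑' j, t ^ j * u j ξ) * ∑' j, t ^ (j + 1) * lam (j + 1) =
      (t * q ξ - (lam 0 + ∑' j, t ^ (j + 1) * lam (j + 1)) + lam 0) * ∑' j, t ^ j * u j ξ := by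
    ring
  rw [← h4]
  refine hasSum_of_eq (h2.sub h1) fun j => ?_
  · rw [rhs, Nat.add_sub_cancel, mul_add, mul_neg, Finset.mul_sum, neg_add_eq_sub]
    congr 1
    · ring
    · refine Finset.sum_congr rfl fun p hp => ?_
      have hp' : p ≤ j := Nat.lt_succ_iff.1 (Finset.mem_range.1 hp)
      rw [← Nat.sub_add_comm hp', show j + 1 = p + (j + 1 - p) by omega, pow_add,
        Nat.add_sub_cancel_left]
      ring

theorem abs_rhs_le (hu : ∀ j, ContinuousOn (u j) (Icc 0 1)) {ξ : ℝ} (hξ : ξ ∈ Icc (0 : ℝ) 1)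
    (j : ℕ) : |rhs q lam u (j + 1) ξ| ≤
      (∑ p ∈ Finset.range (j + 1), supNorm (u p) * |lam (j - p + 1)|) +
        |q ξ| * supNorm (u j) := by
  rw [rhs, Nat.add_sub_cancel]
  refine (abs_add_le _ _).trans (add_le_add ?_ ?_)
  · rw [abs_neg]
    refine (Finset.abs_sum_le_sum_abs _ _).trans (Finset.sum_le_sum fun p hp => ?_)
    have hp' : p ≤ j := Nat.lt_succ_iff.1 (Finset.mem_range.1 hp)
    rw [abs_mul, mul_comm, ← Nat.sub_add_comm hp']
    exact mul_le_mul_of_nonneg_right (abs_le_supNorm (hu p) hξ) (abs_nonneg _)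
  · rw [abs_mul]
    exact mul_le_mul_of_nonneg_left (abs_le_supNorm (hu j) hξ) (abs_nonneg _)

/-- Dominated convergence: the majorants add up to a constant, from the Cauchy product of the norms,
plus |q| ∑ ‖u⁽ʲ⁾‖, which is integrable. -/
theorem hasSum_integral_kernel_rhs {y : ℝ} (hy : 0 < y) (ht : |t| ≤ 1)
    (hq : IntervalIntegrable q volume 0 1) (hu : ∀ j, ContinuousOn (u j) (Icc 0 1))
    (hsu : Summable fun j => supNorm (u j)) (hsl : Summable fun j => |lam j|) {x : ℝ}
    (hx : x ∈ Icc (0 : ℝ) 1) :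
    HasSum (fun j => t ^ (j + 1) *
        ∫ ξ in (0 : ℝ)..x, Real.sin (y * (x - ξ)) / y * rhs q lam u (j + 1) ξ)
      (∫ ξ in (0 : ℝ)..x, Real.sin (y * (x - ξ)) / y *
        ((t * q ξ - ∑' j, t ^ j * lam j + lam 0) * ∑' j, t ^ j * u j ξ)) := by
  have hmem : ∀ ξ ∈ uIoc 0 x, ξ ∈ Icc (0 : ℝ) 1 := fun ξ hξ => by
    rw [uIoc_of_le hx.1] at hξ
    exact ⟨hξ.1.le, hξ.2.trans hx.2⟩
  have hq' : IntervalIntegrable q volume 0 x := intervalIntegrable_sub hq (by simp) hx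
  have hprod := (summable_norm_sum_mul_range_of_summable_norm hsu.norm
    ((summable_nat_add_iff (f := fun j => |lam j|) 1).2 hsl).norm).of_norm
  simp only [← intervalIntegral.integral_const_mul]
  refine intervalIntegral.hasSum_integral_of_dominated_convergence
    (fun j ξ => (∑ p ∈ Finset.range (j + 1), supNorm (u p) * |lam (j - p + 1)|) +
        |q ξ| * supNorm (u j)) (fun j => ?_) (fun j => Eventually.of_forall fun ξ hξ => ?_)
    (Eventually.of_forall fun ξ _ => hprod.add (hsu.mul_left _)) ?_
    (Eventually.of_forall fun ξ hξ => ?_)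
  · have h1 : IntervalIntegrable (rhs q lam u (j + 1)) volume 0 x :=
      intervalIntegrable_sub (intervalIntegrable_rhs hq (by omega) fun p _ => hu p) (by simp) hx
    have h2 := (h1.continuousOn_mul (g := fun ξ => Real.sin (y * (x - ξ)) / y)
      (by fun_prop)).const_mul (t ^ (j + 1))
    rw [uIoc_of_le hx.1]
    exact h2.1.aestronglyMeasurable
  · refine (abs_pow_mul_le ht _ _).trans ?_
    have hξ' := hmem ξ hξ
    rw [abs_mul]
    have h1 : |Real.sin (y * (x - ξ)) / y| ≤ 1 :=
      (abs_sin_div_le hy).trans (abs_le.2 ⟨by linarith [hξ'.2, hx.1], by linarith [hξ'.1, hx.2]⟩)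
    exact (mul_le_of_le_one_left (abs_nonneg _) h1).trans (abs_rhs_le hu hξ' j)
  · have e : (fun ξ => ∑' j, ((∑ p ∈ Finset.range (j + 1), supNorm (u p) * |lam (j - p + 1)|) +
        |q ξ| * supNorm (u j))) = fun ξ =>
        (∑' j, ∑ p ∈ Finset.range (j + 1), supNorm (u p) * |lam (j - p + 1)|) +
        |q ξ| * ∑' j, supNorm (u j) := by
      funext ξ
      rw [hprod.tsum_add (hsu.mul_left _), tsum_mul_left]
    rw [e]
    exact intervalIntegrable_const.add (hq'.abs.mul_const _)
  · exact hasSum_of_eq ((hasSum_rhs ht hu hsu hsl (hmem ξ hξ)).mul_left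
      (Real.sin (y * (x - ξ)) / y)) fun j => by ring

/-- The sum of the FD-series for the potential `t q` solves the perturbed problem. -/
theorem IsFDMethod.isSolution {c : ℕ → ℝ} (hα : α ∈ Ioo (0 : ℝ) 1) (hy : 0 < √lam0)
    (h : basicChar α β √lam0 = 0) (hq : IntervalIntegrable q volume 0 1)
    (hM : IsFDMethod α β q lam0 lam u c)
    (hsu : Summable fun j => supNorm (u j)) (hsl : Summable fun j => |lam j|) (ht : |t| ≤ 1) :
    IsSolution α β (fun x => t * q x) (∑' j, t ^ j * lam j) fun x => ∑' j, t ^ j * u j x := by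
  have hu := hM.continuousOn hα hy h hq
  have hlam : √lam0 ^ 2 = lam 0 := by rw [hM.lam_zero, Real.sq_sqrt (Real.sqrt_pos.1 hy).le]
  have hαm : α ∈ Icc (0 : ℝ) 1 := Ioo_subset_Icc_self hα
  have hF := fun j => intervalIntegrable_rhs (lam := lam) hq (Nat.succ_pos j) fun p _ => hu p
  have hV := fun j => hM.volterra hα hy (Nat.succ_pos j) (hF j)
  have su : ∀ x ∈ Icc (0 : ℝ) 1, Summable fun j => t ^ j * u j x := fun x hx =>
    (summable_pow_mul ht hsu fun j => abs_le_supNorm (hu j) hx).of_abs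
  have tail : ∀ x ∈ Icc (0 : ℝ) 1, HasSum (fun j => t ^ (j + 1) * u (j + 1) x)
      ((∑' j, t ^ j * u j x) - u 0 x) := fun x hx => by
    simpa using (hasSum_nat_add_iff' 1).2 (su x hx).hasSum
  rw [isSolution_iff]
  constructor
  · have h0 : u 0 1 = 0 := by
      rw [hM.u_zero 1 (by simp), basicU_eq_basicSol hy h, basicSol_one hα hy.ne', h, zero_div]
    have := (tail 1 (by simp)).unique
      (hasSum_of_eq hasSum_zero fun j => by rw [(hV j).2, mul_zero])
    linarith
  -- The integral equations of all corrections are summed. As y² = λ⁽⁰⁾, the potential plus y² is t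
  -- q - λ(t) + λ⁽⁰⁾, the factor produced by the Cauchy product.
  · refine IsVolterra.isIVP hα hy.ne' ((hq.const_mul t).sub intervalIntegrable_const)
      (continuousOn_tsum (fun j => continuousOn_const.mul (hu j)) hsu fun j x hx =>
        (abs_pow_mul_le ht j _).trans (abs_le_supNorm (hu j) hx)) fun x hx => ?_
    have h1 := (hasSum_integral_kernel_rhs hy ht hq hu hsu hsl hx).add
      ((tail α hαm).mul_left (β * (Real.sin (√lam0 * max (x - α) 0) / √lam0)))
    have h2 := (tail x hx).unique (hasSum_of_eq h1 fun j => by rw [(hV j).1 x hx]; ring)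
    have h3 := isVolterra_basicSol (α := α) (β := β) (y := √lam0) (p := fun _ => -√lam0 ^ 2)
      (by simp) x hx
    simp only [neg_add_cancel, zero_mul, mul_zero, intervalIntegral.integral_zero, add_zero,
      ← basicU_eq_basicSol hy h] at h3
    rw [hM.u_zero x hx, hM.u_zero α hαm] at h2
    simp only [hlam]
    linear_combination h2 + h3

/-- The limit of the FD-method has the same index as the basic eigenvalue. -/
theorem IsFDMethod.isNthEigenpair {c : ℕ → ℝ} {n : ℕ} (hα : α ∈ Ioo (0 : ℝ) 1) (hβ : 0 ≤ β)
    (hn : 1 ≤ n) (h : IsBasicEigenvalue α β n lam0) (hq : IntervalIntegrable q volume 0 1)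
    (hM : IsFDMethod α β q lam0 lam u c)
    (hsu : Summable fun j => supNorm (u j)) (hsl : Summable fun j => |lam j|) :
    IsNthEigenpair α β q n (∑' j, lam j) fun x => ∑' j, u j x := by
  have hy : 0 < √lam0 :=
    lt_of_lt_of_le (mul_pos Real.pi_pos (by exact_mod_cast hn)) h.sqrt_mem.1
  have hsol := fun (t : ℝ) (ht : |t| ≤ 1) =>
    hM.isSolution hα hy h.basicChar_eq_zero hq hsu hsl ht
  have hI : ∀ t ∈ Icc (0 : ℝ) 1, |t| ≤ 1 := fun t ht => by rw [abs_of_nonneg ht.1]; exact ht.2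
  obtain ⟨D, hD, hDiff, huniq, hsign⟩ := exists_characteristic hα hβ hq
  have hN := normL1_nonneg q
  -- The curve is λ(t), running from λ⁽⁰⁾ to the limit of the method. The energy bound needs Q > 0,
  -- hence ‖q‖ + 1 in place of ‖q‖.
  have hcount := encard_zeros_eq hD huniq hsign (L := -(normL1 q + 1) ^ 2)
    (fun t ht μ hμ => by
      obtain ⟨w, hw⟩ := (hDiff μ t).2 hμ
      obtain ⟨hw1, d₁, d₂, hd⟩ := isSolution_iff.1 hw
      exact hd.neg_sq_le hα hβ hq (hI t ht) (by linarith) (by linarith) hw1)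
    (Λ := fun t => ∑' j, (t : ℝ) ^ j * lam j)
    (continuous_tsum (fun j => by fun_prop) hsl fun j t => abs_pow_mul_le (hI t t.2) j _)
    (fun t => (hDiff _ _).1 ⟨_, hsol t (hI t t.2)⟩)
  -- With 0 ^ 0 = 1, only the term j = 0 survives.
  have h0 : ∑' j, ((0 : unitInterval) : ℝ) ^ j * lam j = lam0 := by
    rw [tsum_eq_single 0 fun j hj => by simp [hj]]
    simp [hM.lam_zero]
  have hbasic := encard_basic_eigenvalues hα hβ hn h q
  have hone := hsol 1 (by simp)
  simp only [h0, ← hDiff] at hcount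
  simp only [Set.Icc.coe_one, one_pow, one_mul] at hcount hone
  exact ⟨hone, by rw [← hcount]; exact hbasic⟩

end Homotopy

/-! ### Superexponential convergence and the main theorem. -/

/-- The factor α_{m+1} → 0 in the error constant turns the explicit bounds into little-o statements;
k = 1 for eigenfunctions, k = 0 for eigenvalues. -/
theorem isLittleO_mul_pow {f a : ℕ → ℝ} {ρ K : ℝ} {k : ℕ} (ha : Tendsto a atTop (𝓝 0))
    (h : ∀ m, |f m| ≤ a m * ρ ^ (m + k) * K) : f =o[atTop] fun m => ρ ^ (m + k) := by
  have h1 : (fun m => a m * ρ ^ (m + k)) =o[atTop] fun m => 1 * ρ ^ (m + k) :=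
    ((Asymptotics.isLittleO_one_iff ℝ).2 ha).mul_isBigO (Asymptotics.isBigO_refl _ _)
  simp only [one_mul] at h1
  refine Asymptotics.IsBigO.trans_isLittleO (Asymptotics.IsBigO.of_bound |K| ?_) h1
  refine Eventually.of_forall fun m => ?_
  rw [Real.norm_eq_abs, Real.norm_eq_abs, ← abs_mul, mul_comm K]
  exact (h m).trans (le_abs_self _)

end FD

theorem theorem2 (α β : ℝ) (hα : α ∈ Set.Ioo (0 : ℝ) 1) (hβ : 0 ≤ β)
    (q : ℝ → ℝ) (hq : IntervalIntegrable q MeasureTheory.volume 0 1)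
    (n : ℕ) (hn : 1 ≤ n) (lam0 : ℝ) (hlam0 : FD.IsBasicEigenvalue α β n lam0)
    (hr : FD.r α β q lam0 < 1) :
    (∃ (lam : ℕ → ℝ) (u : ℕ → ℝ → ℝ) (c : ℕ → ℝ), FD.IsFDMethod α β q lam0 lam u c) ∧
    ∀ (lam : ℕ → ℝ) (u : ℕ → ℝ → ℝ) (c : ℕ → ℝ), FD.IsFDMethod α β q lam0 lam u c →
      -- every correction is continuous, and the orthogonality condition holds
      (∀ j, ContinuousOn (u j) (Set.Icc 0 1)) ∧
      (∀ j, 1 ≤ j → ∫ ξ in (0 : ℝ)..1, FD.rhs q lam u j ξ * u 0 ξ = 0) ∧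
      ∃ (lamEx : ℝ) (uEx : ℝ → ℝ),
        -- the limit is the exact `n`-th eigenpair
        FD.IsNthEigenpair α β q n lamEx uEx ∧
        Filter.Tendsto (FD.lamApprox lam) Filter.atTop (nhds lamEx) ∧
        TendstoUniformlyOn (FD.uApprox u) uEx Filter.atTop (Set.Icc 0 1) ∧
        -- error estimates
        Summable (fun j => FD.supNorm (u j)) ∧
        Summable (fun j => |lam j|) ∧
        (∀ m : ℕ,
          FD.supNorm (fun x => uEx x - FD.uApprox u m x) ≤ ∑' j : ℕ, FD.supNorm (u (m + 1 + j)) ∧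
          ∑' j : ℕ, FD.supNorm (u (m + 1 + j)) ≤ FD.boundU α β q lam0 m ∧
          |lamEx - FD.lamApprox lam m| ≤ ∑' j : ℕ, |lam (m + 1 + j)| ∧
          ∑' j : ℕ, |lam (m + 1 + j)| ≤ FD.boundLam α β q lam0 m) ∧
        -- superexponential convergence: faster than the geometric rate
        (fun m : ℕ => FD.supNorm (fun x => uEx x - FD.uApprox u m x)) =o[Filter.atTop]
          (fun m : ℕ => FD.r α β q lam0 ^ (m + 1)) ∧
        (fun m : ℕ => lamEx - FD.lamApprox lam m) =o[Filter.atTop]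
          (fun m : ℕ => FD.r α β q lam0 ^ m) := by
  open FD in
  have hπ : Real.pi ≤ √lam0 :=
    (le_mul_of_one_le_right Real.pi_pos.le (by exact_mod_cast hn)).trans hlam0.sqrt_mem.1
  have hy : 0 < √lam0 := Real.pi_pos.trans_le hπ
  have h := hlam0.basicChar_eq_zero
  refine ⟨exists_fdMethod hα hy h hq, fun lam u c hM => ?_⟩
  have hu := hM.continuousOn hα hy h hq
  obtain ⟨hsu, hbu⟩ := hM.summable_supNorm hα hβ hπ h hq hr
  obtain ⟨hsl, hbl⟩ := hM.summable_lam hα hβ hπ h hq hr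
  -- Applied to the λ⁽ʲ⁾ and, at each fixed x, to the u⁽ʲ⁾(x) with B_j = ‖u⁽ʲ⁾‖.
  have tail : ∀ (f : ℕ → ℝ) (B : ℕ → ℝ), Summable B → (∀ j, |f j| ≤ B j) → ∀ m,
      |∑' j, f j - ∑ j ∈ Finset.range (m + 1), f j| ≤ ∑' j, B (m + 1 + j) := by
    intro f B hB hf m
    have hsf : Summable fun j => |f j| := Summable.of_nonneg_of_le (fun _ => abs_nonneg _) hf hB
    rw [← hsf.of_abs.sum_add_tsum_nat_add (m + 1), add_sub_cancel_left]
    simp only [add_comm (m + 1)]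
    have hsm := (summable_nat_add_iff (m + 1)).2 hsf.of_abs
    exact (abs_tsum_le hsm).trans
      (hsm.abs.tsum_le_tsum (fun j => hf _) ((summable_nat_add_iff (m + 1)).2 hB))
  have hU : ∀ m, supNorm (fun x => (∑' j, u j x) - uApprox u m x) ≤
      ∑' j, supNorm (u (m + 1 + j)) := fun m => supNorm_le fun x hx =>
    tail (fun j => u j x) _ hsu (fun j => abs_le_supNorm (hu j) hx) m
  have hL : ∀ m, |∑' j, lam j - lamApprox lam m| ≤ ∑' j, |lam (m + 1 + j)| :=
    tail lam _ hsl fun _ => le_rfl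
  refine ⟨hu, fun j hj => integral_rhs_mul hy h hα hq hM.u_zero hj (fun p _ => hu p)
      (hM.lam_succ j hj), ∑' j, lam j, fun x => ∑' j, u j x,
    hM.isNthEigenpair hα hβ hn hlam0 hq hsu hsl,
    hsl.of_abs.hasSum.tendsto_sum_nat.comp (tendsto_add_atTop_nat 1), fun s hs => ?_, hsu, hsl,
    fun m => ⟨hU m, hbu m, hL m, hbl m⟩, ?_, ?_⟩
  · have := tendstoUniformlyOn_tsum_nat (f := u) (s := Icc 0 1) hsu (fun j x hx => abs_le_supNorm (hu j) hx)
    exact (tendsto_add_atTop_nat 1).eventually (this s hs)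
  · refine isLittleO_mul_pow (K := M α lam0 / (1 - r α β q lam0) *
      min (1 / M α lam0) (min (1 / √lam0) (1 / (√lam0 * √(cTilde α β lam0)))))
      tendsto_alphaCoeff fun m => ?_
    rw [abs_of_nonneg (supNorm_nonneg _)]
    refine ((hU m).trans (hbu m)).trans_eq ?_
    rw [boundU, C]
    ring
  · refine isLittleO_mul_pow (k := 0) (K := M α lam0 / (1 - r α β q lam0) /
      (M α lam0 + max 1 (max (cTilde α β lam0) (√(cTilde α β lam0) * M α lam0 / √lam0))) *
      invR α β q lam0) tendsto_alphaCoeff fun m => ?_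
    refine ((hL m).trans (hbl m)).trans_eq ?_
    rw [boundLam, C]
    ring
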